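/- Let $X$ be a regular one-dimensional diffusion on $(0,\infty)$ with generator $\mathcal A=\mu(x)\frac{d}{dx}+\frac12\sigma^2(x)\frac{d^2}{dx^2}$ ($\mu$ differentiable, $\sigma>0$ continuous on $(0,\infty)$), with natural boundaries $0$ and $\infty$, and let $r,\lambda>0$. Let $S'(x)=\exp(-\int_1^x 2\mu(z)\sigma^{-2}(z)\,dz)$ and $m'=2/(\sigma^2S')$ be the scale and speed densities, and for $q>0$ let $\psi_q>0$ and $\varphi_q>0$ be the increasing and decreasing solutions of $(\mathcal A-q)f=0$ on $(0,\infty)$ (unique up to positive factors). Write $f\in\mathcal L_1^q$ if $E_x\int_0^\infty e^{-qs}|f(X_s)|\,ds<\infty$ for all $x>0$, and then $(R_qf)(x)=E_x\int_0^\infty e^{-qs}f(X_s)\,ds$. Given $\pi:(0,\infty)\to\mathbb R$ and constants $\gamma_d,\gamma_u$ put, for $n\in\{d,u\}$, $$\theta_n(x)=\pi(x)+\gamma_n(\mu(x)-rx),\qquad g_n(x)=\gamma_nx-(R_r\pi)(x).$$ Assume: (i) $\gamma_d<\gamma_u$; (ii) $\theta_d,\theta_u$ and $x\mapsto x$ are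 in $\mathcal L_1^r$; (iii) $\pi$ is positive, continuous and non-decreasing; (iv) $\mu'(x)<r$ for all $x>0$; (v) $\theta_n$ is differentiable on $(0,\infty)$ and there is a unique $x_n^*\ge0$ such that for $x>0$ one has $\theta_n'(x)>0$, $=0$, $<0$ according as $x<x_n^*$, $x=x_n^*$, $x>x_n^*$, and, if $x_n^*>0$, then $\theta_n'>0$ also at the boundary point $0$, in the sense that $\liminf_{x\to0+}(\theta_n(x)-\theta_n(0+))/x>0$; (vi) $\lim_{x\to0+}\theta_n(x)$ exists in $(0,\infty]$ and $\lim_{x\to\infty}\theta_n(x)=-\infty$. For $q>0$ let $$L_f^q(x)=q\int_x^\infty f\varphi_qm'\,dy+\frac{\varphi_q'(x)}{S'(x)}f(x),\qquad K_f^q(x)=q\int_0^x f\psi_qm'\,dy-\frac{\psi_q'(x)}{S'(x)}f(x),$$ and for $h\in\{\psi_r,\varphi_r\}$ let $$Q(g_d,h;x)=\frac{g_d'(x)L_h^{r+\lambda}(x)-h'(x)L_{g_d}^{r+\lambda}(x)}{\varphi_{r+\lambda}'(x)},\qquad H(h,g_u;x)=\frac{h'(x)K_{g_u}^{r+\lambda}(x)-g_u'(x)K_h^{r+\lambda}(x)}{\psi_{r+\lambda}'(x)}.$$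 Write $Q_{d,\psi},Q_{d,\varphi}$ for $Q(g_d,\psi_r;\cdot),Q(g_d,\varphi_r;\cdot)$ and $H_{u,\psi},H_{u,\varphi}$ for $H(\psi_r,g_u;\cdot),H(\varphi_r,g_u;\cdot)$. Let $\tilde x,\hat x\in(0,\infty)$ be roots of $K^{r+\lambda}_{\theta_u}$ and $L^{r+\lambda}_{\theta_d}$, and assume $\tilde x<\hat x$. Then the pair of equations $$H(\psi_r,g_u;a)=Q(g_d,\psi_r;b),\qquad H(\varphi_r,g_u;a)=Q(g_d,\varphi_r;b)$$ has exactly one solution $(a^*,b^*)$ with $0<a^*<b^*$. Moreover the restrictions $\check H_{u,\psi},\check H_{u,\varphi}$ to $(0,\tilde x]$ and $\hat Q_{d,\psi},\hat Q_{d,\varphi}$ to $[\hat x,\infty)$ are injective, the map $$K=\check H_{u,\varphi}^{-1}\circ\hat Q_{d,\varphi}\circ\hat Q_{d,\psi}^{-1}\circ\check H_{u,\psi}:(0,\tilde x]\to(0,\tilde x]$$ is well defined and strictly increasing, $a^*$ is its unique fixed point, and $b^*=\hat Q_{d,\psi}^{-1}(\check H_{u,\psi}(a^*))\in[\hat x,\infty)$.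 -/

import Mathlib

open Set Filter Topology MeasureTheory
open scoped NNReal ENNReal

noncomputable section

namespace PoissonControl

/-! ### The diffusion on the state space `(0, ∞)` -/

/-- The generator `𝒜 f = μ f' + (1/2) σ² f''`. -/
def generator (μ σ f : ℝ → ℝ) (x : ℝ) : ℝ :=
  μ x * deriv f x + (1 / 2) * σ x ^ 2 * deriv (deriv f) x

/-- The scale density `S'(x) = exp (-∫_1^x 2 μ(z) / σ²(z) dz)` (base point `1`). -/
def scaleDensity (μ σ : ℝ → ℝ) (x : ℝ) : ℝ :=
  Real.exp (-∫ z in (1 : ℝ)..x, 2 * μ z / σ z ^ 2)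

/-- The density `m'(x) = 2 / (σ²(x) S'(x))` of the speed measure. -/
def speedDensity (μ σ : ℝ → ℝ) (x : ℝ) : ℝ :=
  2 / (σ x ^ 2 * scaleDensity μ σ x)

/-- The boundary `0` is natural in Feller's classification: it is neither exit,
`∫_0^1 m((z,1)) S'(z) dz = ∞`, nor entrance, `∫_0^1 S((z,1)) m'(z) dz = ∞`. -/
def IsNaturalZero (μ σ : ℝ → ℝ) : Prop :=
  (∫⁻ z in Ioc (0 : ℝ) 1, ENNReal.ofReal (scaleDensity μ σ z) *
      ∫⁻ y in Ioc z 1, ENNReal.ofReal (speedDensity μ σ y)) = ⊤ ∧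
  (∫⁻ z in Ioc (0 : ℝ) 1, ENNReal.ofReal (speedDensity μ σ z) *
      ∫⁻ y in Ioc z 1, ENNReal.ofReal (scaleDensity μ σ y)) = ⊤

/-- The boundary `∞` is natural: neither exit nor entrance. -/
def IsNaturalInfty (μ σ : ℝ → ℝ) : Prop :=
  (∫⁻ z in Ioi (1 : ℝ), ENNReal.ofReal (scaleDensity μ σ z) *
      ∫⁻ y in Ioc 1 z, ENNReal.ofReal (speedDensity μ σ y)) = ⊤ ∧
  (∫⁻ z in Ioi (1 : ℝ), ENNReal.ofReal (speedDensity μ σ z) *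
      ∫⁻ y in Ioc 1 z, ENNReal.ofReal (scaleDensity μ σ y)) = ⊤

/-- `X` under the laws `P x`, `x > 0`, is the regular diffusion on `(0, ∞)` with drift `μ` and
volatility `σ`: its paths are continuous and stay in `(0, ∞)`, it starts from `x` under `P x`,
and it solves the martingale problem for the generator, i.e. for every `C²` function `f` with
compact support in `(0, ∞)` the process `f(X_t) - ∫_0^t (𝒜 f)(X_s) ds` is a `P x`-martingale. -/
structure IsDiffusion {Ω : Type*} {mΩ : MeasurableSpace Ω} (μ σ : ℝ → ℝ)
    (ℱ : Filtration ℝ≥0 mΩ) (P : ℝ → Measure Ω) (X : ℝ≥0 → Ω → ℝ) : Prop where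
  differentiableOn_drift : DifferentiableOn ℝ μ (Ioi 0)
  continuousOn_vol : ContinuousOn σ (Ioi 0)
  vol_pos : ∀ x, 0 < x → 0 < σ x
  natural_zero : IsNaturalZero μ σ
  natural_infty : IsNaturalInfty μ σ
  isProbabilityMeasure : ∀ x, 0 < x → IsProbabilityMeasure (P x)
  adapted : ∀ t, Measurable[ℱ t] (X t)
  continuous_path : ∀ ω, Continuous fun t => X t ω
  path_pos : ∀ t ω, 0 < X t ω
  initial : ∀ x, 0 < x → ∀ᵐ ω ∂(P x), X 0 ω = x
  martingale : ∀ x, 0 < x → ∀ f : ℝ → ℝ, ContDiff ℝ 2 f → HasCompactSupport f →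
    tsupport f ⊆ Ioi 0 →
    Martingale (fun (t : ℝ≥0) ω =>
      f (X t ω) - ∫ s in (0 : ℝ)..t, generator μ σ f (X s.toNNReal ω)) ℱ (P x)

/-- The class `ℒ₁^r`: `E_x [∫_0^∞ e^{-rs} |f(X_s)| ds] < ∞` for all `x > 0`. -/
def MemL1 {Ω : Type*} {mΩ : MeasurableSpace Ω} (P : ℝ → Measure Ω) (X : ℝ≥0 → Ω → ℝ)
    (r : ℝ) (f : ℝ → ℝ) : Prop :=
  ∀ x, 0 < x →
    (∫⁻ ω, (∫⁻ s in Ioi (0 : ℝ),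
      ENNReal.ofReal (Real.exp (-r * s) * |f (X s.toNNReal ω)|)) ∂(P x)) < ⊤

/-- The resolvent `(R_r f)(x) = E_x [∫_0^∞ e^{-rs} f(X_s) ds]`. -/
def resolvent {Ω : Type*} {mΩ : MeasurableSpace Ω} (P : ℝ → Measure Ω) (X : ℝ≥0 → Ω → ℝ)
    (r : ℝ) (f : ℝ → ℝ) (x : ℝ) : ℝ :=
  ∫ ω, (∫ s in Ioi (0 : ℝ), Real.exp (-r * s) * f (X s.toNNReal ω)) ∂(P x)

/-- A positive `C²` solution of `(𝒜 - r) f = 0` on `(0, ∞)`. -/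
structure IsPosHarmonic (μ σ : ℝ → ℝ) (r : ℝ) (f : ℝ → ℝ) : Prop where
  contDiffOn : ContDiffOn ℝ 2 f (Ioi 0)
  pos : ∀ x, 0 < x → 0 < f x
  ode : ∀ x, 0 < x → generator μ σ f x - r * f x = 0

/-- `ψ` is the increasing fundamental solution `ψ_r` (determined up to a positive factor). -/
def IsPsi (μ σ : ℝ → ℝ) (r : ℝ) (ψ : ℝ → ℝ) : Prop :=
  IsPosHarmonic μ σ r ψ ∧ StrictMonoOn ψ (Ioi 0)

/-- `φ` is the decreasing fundamental solution `φ_r` (determined up to a positive factor). -/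
def IsPhi (μ σ : ℝ → ℝ) (r : ℝ) (φ : ℝ → ℝ) : Prop :=
  IsPosHarmonic μ σ r φ ∧ StrictAntiOn φ (Ioi 0)

/-! ### Data of the control problem -/

/-- `θ_n(x) = π(x) + γ_n (μ(x) - r x)`. -/
def theta (μ : ℝ → ℝ) (r : ℝ) (pay : ℝ → ℝ) (γ : ℝ) (x : ℝ) : ℝ :=
  pay x + γ * (μ x - r * x)

/-- `g_n(x) = γ_n x - (R_r π)(x)`. -/
def gfun {Ω : Type*} {mΩ : MeasurableSpace Ω} (P : ℝ → Measure Ω) (X : ℝ≥0 → Ω → ℝ)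
    (r : ℝ) (pay : ℝ → ℝ) (γ : ℝ) (x : ℝ) : ℝ :=
  γ * x - resolvent P X r pay x

/-- There is a state `x* ≥ 0` with `θ' > 0` to the left of `x*`, `θ' = 0` at `x*` and `θ' < 0` to
the right of `x*`. For `x* > 0` the condition `θ' > 0` is also imposed at the boundary point `0` of
the state space, where it says that the lower right derivative
`liminf_{x → 0+} (θ(x) - θ(0+)) / x` is positive. -/
def HasPeak (θ : ℝ → ℝ) : Prop :=
  DifferentiableOn ℝ θ (Ioi 0) ∧
  ∃ xs : ℝ, 0 ≤ xs ∧
    (∀ x, 0 < x → (x < xs → 0 < deriv θ x) ∧ (x = xs → deriv θ x = 0) ∧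
      (xs < x → deriv θ x < 0)) ∧
    (0 < xs → ∀ l : ℝ, Tendsto θ (𝓝[>] 0) (𝓝 l) →
      ∃ c : ℝ, 0 < c ∧ ∀ᶠ x in 𝓝[>] (0 : ℝ), l + c * x ≤ θ x)

/-- The main assumptions. -/
structure MainAssumptions {Ω : Type*} {mΩ : MeasurableSpace Ω} (μ : ℝ → ℝ)
    (P : ℝ → Measure Ω) (X : ℝ≥0 → Ω → ℝ) (r : ℝ) (pay : ℝ → ℝ) (γd γu : ℝ) : Prop where
  price_lt : γd < γu
  theta_d_mem : MemL1 P X r (theta μ r pay γd)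
  theta_u_mem : MemL1 P X r (theta μ r pay γu)
  id_mem : MemL1 P X r (fun x => x)
  pay_pos : ∀ x, 0 < x → 0 < pay x
  pay_cont : ContinuousOn pay (Ioi 0)
  pay_mono : MonotoneOn pay (Ioi 0)
  drift_deriv_lt : ∀ x, 0 < x → deriv μ x < r
  peak_d : HasPeak (theta μ r pay γd)
  peak_u : HasPeak (theta μ r pay γu)
  theta_d_zero : ∃ l : EReal, 0 < l ∧
    Tendsto (fun x => (theta μ r pay γd x : EReal)) (𝓝[>] 0) (𝓝 l)
  theta_u_zero : ∃ l : EReal, 0 < l ∧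
    Tendsto (fun x => (theta μ r pay γu x : EReal)) (𝓝[>] 0) (𝓝 l)
  theta_d_infty : Tendsto (theta μ r pay γd) atTop atBot
  theta_u_infty : Tendsto (theta μ r pay γu) atTop atBot

/-! ### The functionals `L`, `K`, `Q`, `H` and the fixed-point map -/

/-- `L_f^q(x) = q ∫_x^∞ f φ_q m' dy + (φ_q'(x) / S'(x)) f(x)`, where `φ = φ_q`. -/
def Lfun (μ σ : ℝ → ℝ) (q : ℝ) (φ f : ℝ → ℝ) (x : ℝ) : ℝ :=
  q * (∫ y in Ioi x, f y * φ y * speedDensity μ σ y) + deriv φ x / scaleDensity μ σ x * f x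

/-- `K_f^q(x) = q ∫_0^x f ψ_q m' dy - (ψ_q'(x) / S'(x)) f(x)`, where `ψ = ψ_q`. -/
def Kfun (μ σ : ℝ → ℝ) (q : ℝ) (ψ f : ℝ → ℝ) (x : ℝ) : ℝ :=
  q * (∫ y in Ioc 0 x, f y * ψ y * speedDensity μ σ y) - deriv ψ x / scaleDensity μ σ x * f x

/-- `Q(g, h; x) = (g'(x) L_h^q(x) - h'(x) L_g^q(x)) / φ_q'(x)`, where `φ = φ_q`. -/
def Qfun (μ σ : ℝ → ℝ) (q : ℝ) (φ g h : ℝ → ℝ) (x : ℝ) : ℝ :=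
  (deriv g x * Lfun μ σ q φ h x - deriv h x * Lfun μ σ q φ g x) / deriv φ x

/-- `H(h, g; x) = (h'(x) K_g^q(x) - g'(x) K_h^q(x)) / ψ_q'(x)`, where `ψ = ψ_q`. -/
def Hfun (μ σ : ℝ → ℝ) (q : ℝ) (ψ h g : ℝ → ℝ) (x : ℝ) : ℝ :=
  (deriv h x * Kfun μ σ q ψ g x - deriv g x * Kfun μ σ q ψ h x) / deriv ψ x

/-- `(a, b)`, with `0 < a < b`, solves the pair of equations
`H_{u,ψ}(a) = Q_{d,ψ}(b)`, `H_{u,φ}(a) = Q_{d,φ}(b)`. -/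
def SolvesPair (Hψ Hφ Qψ Qφ : ℝ → ℝ) (a b : ℝ) : Prop :=
  0 < a ∧ a < b ∧ Hψ a = Qψ b ∧ Hφ a = Qφ b

/-- `K = Ȟ_{u,φ}⁻¹ ∘ Q̂_{d,φ} ∘ Q̂_{d,ψ}⁻¹ ∘ Ȟ_{u,ψ}`, where `Ȟ` and `Q̂` are the restrictions to
`(0, xt]` and `[xh, ∞)`. -/
def fixedPointMap (Hψ Hφ Qψ Qφ : ℝ → ℝ) (xt xh : ℝ) (x : ℝ) : ℝ :=
  Function.invFunOn Hφ (Ioc 0 xt) (Qφ (Function.invFunOn Qψ (Ici xh) (Hψ x)))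

/-- The four restrictions are injective and the successive ranges fit, so that the inverses in
`fixedPointMap` are genuine inverses and the composition is defined on all of `(0, xt]`. -/
def FixedPointMapWellDefined (Hψ Hφ Qψ Qφ : ℝ → ℝ) (xt xh : ℝ) : Prop :=
  InjOn Hψ (Ioc 0 xt) ∧ InjOn Hφ (Ioc 0 xt) ∧ InjOn Qψ (Ici xh) ∧ InjOn Qφ (Ici xh) ∧
  (∀ x ∈ Ioc 0 xt, Hψ x ∈ Qψ '' Ici xh) ∧
  (∀ x ∈ Ioc 0 xt, ∀ y ∈ Ici xh, Qψ y = Hψ x → Qφ y ∈ Hφ '' Ioc 0 xt)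

end PoissonControl

end

/-! Notation: q = r + λ; u, v, u_q, v_q are the scale derivatives of ψ_r, φ_r, ψ_q, φ_q; w(x) = r x
- μ(x); δ = γ_u - γ_d, so that θ_d = θ_u + δ w.

Closed forms. The martingale problem identifies the resolvent with the Green operator
(`occupationMeasure_eq_greenMeasure`), and x = R_r w (`greenFun_eq_id`), hence g_n = -R_r θ_n.
Wronskian identities then remove the resolvent from H and Q (`Hfun_eq`, `Qfun_eq`); for example (q -
r) H(ψ_r, g_u; x) = -r ∫_0^x θ_u ψ_r m' + q (u / u_q) ∫_0^x θ_u ψ_q m'. The derivatives of these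
expressions factor (`hasDerivAt_lower`, `hasDerivAt_upper`): up to positive factors each is a
coefficient of constant sign times K^q_{θ_u} or L^q_{θ_d}, and these functionals change sign exactly
at their roots. So H_ψ increases and H_φ decreases on (0, x̃], while Q_ψ decreases and Q_φ increases
on [x̂, ∞).

Existence. The ranges fit because H_ψ is positive, Q_ψ takes a nonpositive value, H_φ is unbounded
near 0, and the H-values at x̃ do not exceed the Q-values at x̂. At the roots the closed forms
reduce to functionals with q replaced by r, which are comparable since w is increasing. The delicate
point is the unboundedness of H_φ: the positive slope of θ_u at 0 reduces it to ∫_0^1 y φ_r m' dy =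
∞ (`not_integrableOn_id_mul_dec`). The map K is then increasing and bounded away from 0, and the
supremum of the points with x ≤ K x is fixed.

Uniqueness. For each x₀ > 0 take h = ψ_r + k φ_r with h'(x₀) = 0, so h decreases before x₀ and
increases after it (`ControlData.combination`). At x₀ one has H_h < Q_h, the gap being a positive
multiple of δ h(x₀). The monotonicity of H_h and Q_h with x₀ = b or x₀ = a forces a < x̃ and x̂ < b
for every solution; with x₀ = x̃ both combinations are strictly decreasing, which excludes two
solutions.

The boundary analysis uses only that 0 and ∞ are natural. Everything at 0 that has a counterpart at
∞ is transferred by x ↦ 1/x; the limits of Wronskians at ∞ come from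
`DecSolution.eq_zero_of_wronskian_tendsto`. -/

namespace PoissonControl

/-! ### Calculus on the half-line -/

section Calculus

variable {f f' F : ℝ → ℝ} {D : Set ℝ} {x : ℝ}

theorem monotoneOn_of_hasDerivAt (hD : Convex ℝ D) (h : ∀ x ∈ D, HasDerivAt f (f' x) x)
    (h0 : ∀ x ∈ interior D, 0 ≤ f' x) : MonotoneOn f D :=
  monotoneOn_of_hasDerivWithinAt_nonneg hD (fun x hx => (h x hx).continuousAt.continuousWithinAt)
    (fun x hx => (h x (interior_subset hx)).hasDerivWithinAt) h0

theorem antitoneOn_of_hasDerivAt (hD : Convex ℝ D) (h : ∀ x ∈ D, HasDerivAt f (f' x) x)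
    (h0 : ∀ x ∈ interior D, f' x ≤ 0) : AntitoneOn f D :=
  antitoneOn_of_hasDerivWithinAt_nonpos hD (fun x hx => (h x hx).continuousAt.continuousWithinAt)
    (fun x hx => (h x (interior_subset hx)).hasDerivWithinAt) h0

theorem strictMonoOn_of_hasDerivAt (hD : Convex ℝ D) (h : ∀ x ∈ D, HasDerivAt f (f' x) x)
    (h0 : ∀ x ∈ interior D, 0 < f' x) : StrictMonoOn f D :=
  strictMonoOn_of_hasDerivWithinAt_pos hD (fun x hx => (h x hx).continuousAt.continuousWithinAt)
    (fun x hx => (h x (interior_subset hx)).hasDerivWithinAt) h0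

theorem strictAntiOn_of_hasDerivAt (hD : Convex ℝ D) (h : ∀ x ∈ D, HasDerivAt f (f' x) x)
    (h0 : ∀ x ∈ interior D, f' x < 0) : StrictAntiOn f D :=
  strictAntiOn_of_hasDerivWithinAt_neg hD (fun x hx => (h x hx).continuousAt.continuousWithinAt)
    (fun x hx => (h x (interior_subset hx)).hasDerivWithinAt) h0

theorem exists_tendsto_atTop_of_monotoneOn {a c : ℝ} (h : MonotoneOn f (Ici a))
    (hc : ∀ x, a ≤ x → f x ≤ c) : ∃ l, Tendsto f atTop (𝓝 l) ∧ ∀ x, a ≤ x → f x ≤ l := by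
  have hm : Monotone fun x => f (max a x) := fun x y hxy =>
    h (mem_Ici.2 (le_max_left _ _)) (mem_Ici.2 (le_max_left _ _)) (max_le_max le_rfl hxy)
  have hb : BddAbove (range fun x => f (max a x)) :=
    ⟨c, by rintro _ ⟨x, rfl⟩; exact hc _ (le_max_left _ _)⟩
  refine ⟨_, (tendsto_atTop_ciSup hm hb).congr' ?_, fun x hx => ?_⟩
  · filter_upwards [eventually_ge_atTop a] with x hx
    rw [max_eq_right hx]
  · have := le_ciSup hb x
    simpa only [max_eq_right hx] using this

theorem exists_tendsto_atTop_of_antitoneOn {a c : ℝ} (h : AntitoneOn f (Ici a))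
    (hc : ∀ x, a ≤ x → c ≤ f x) : ∃ l, Tendsto f atTop (𝓝 l) ∧ ∀ x, a ≤ x → l ≤ f x := by
  obtain ⟨l, h1, h2⟩ := exists_tendsto_atTop_of_monotoneOn (f := fun x => - f x) (a := a) (c := -c)
    h.neg (fun x hx => neg_le_neg (hc x hx))
  exact ⟨-l, by simpa using h1.neg, fun x hx => by linarith [h2 x hx]⟩

theorem intervalIntegrable_of_continuousOn (hF : ContinuousOn F (Ioi 0)) {a b : ℝ} (ha : 0 < a)
    (hb : 0 < b) : IntervalIntegrable F volume a b :=
  (hF.mono fun _ hy => lt_of_lt_of_le (lt_min ha hb) hy.1).intervalIntegrable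

theorem continuousAt_of_continuousOn (hF : ContinuousOn F (Ioi 0)) (hx : 0 < x) :
    ContinuousAt F x := hF.continuousAt (Ioi_mem_nhds hx)

theorem hasDerivAt_integral_of_continuousOn (hF : ContinuousOn F (Ioi 0)) {a : ℝ} (ha : 0 < a)
    (hx : 0 < x) : HasDerivAt (fun x => ∫ y in a..x, F y) (F x) x :=
  intervalIntegral.integral_hasDerivAt_right (intervalIntegrable_of_continuousOn hF ha hx)
    (hF.stronglyMeasurableAtFilter isOpen_Ioi x hx) (continuousAt_of_continuousOn hF hx)

theorem exists_primitive (hF : ContinuousOn F (Ioi 0)) :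
    ∃ M : ℝ → ℝ, M 1 = 0 ∧ ∀ x, 0 < x → HasDerivAt M (F x) x :=
  ⟨fun x => ∫ y in (1 : ℝ)..x, F y, by simp,
    fun _ hx => hasDerivAt_integral_of_continuousOn hF one_pos hx⟩

theorem integrableOn_Ioc_of_continuousOn (hF : ContinuousOn F (Ioi 0)) {a : ℝ} (ha : 0 < a)
    (hi : IntegrableOn F (Ioc 0 a)) (hx : 0 < x) : IntegrableOn F (Ioc 0 x) := by
  have h1 : IntegrableOn F (Ioc a x) := by
    rcases le_or_gt a x with h | h
    · exact (intervalIntegrable_iff_integrableOn_Ioc_of_le h).1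
        (intervalIntegrable_of_continuousOn hF ha hx)
    · simp [Ioc_eq_empty (not_lt.2 h.le)]
  refine (hi.union h1).mono_set fun y hy => ?_
  rcases le_or_gt y a with h | h
  · exact Or.inl ⟨hy.1, h⟩
  · exact Or.inr ⟨h, hy.2⟩

theorem hasDerivAt_integral_Ioi (hF : ContinuousOn F (Ioi 0))
    (hi : ∀ a, 0 < a → IntegrableOn F (Ioi a)) (hx : 0 < x) :
    HasDerivAt (fun x => ∫ y in Ioi x, F y) (-F x) x := by
  have h1 := (hasDerivAt_integral_of_continuousOn hF hx hx).const_sub (∫ y in Ioi x, F y)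
  refine h1.congr_of_eventuallyEq ?_
  filter_upwards [Ioi_mem_nhds hx] with z hz
  rw [← intervalIntegral.integral_Ioi_sub_Ioi' (hi x hx) (hi z hz)]
  ring

theorem integral_Ioc_add_interval (hF : ContinuousOn F (Ioi 0))
    (hi : ∀ a, 0 < a → IntegrableOn F (Ioc 0 a)) {a b : ℝ} (ha : 0 < a) (hb : 0 < b) :
    (∫ y in Ioc 0 b, F y) = (∫ y in Ioc 0 a, F y) + ∫ y in a..b, F y := by
  rw [← intervalIntegral.integral_of_le ha.le, ← intervalIntegral.integral_of_le hb.le,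
    intervalIntegral.integral_add_adjacent_intervals
      ((intervalIntegrable_iff_integrableOn_Ioc_of_le ha.le).2 (hi a ha))
      (intervalIntegrable_of_continuousOn hF ha hb)]

theorem hasDerivAt_integral_Ioc (hF : ContinuousOn F (Ioi 0))
    (hi : ∀ a, 0 < a → IntegrableOn F (Ioc 0 a)) (hx : 0 < x) :
    HasDerivAt (fun x => ∫ y in Ioc 0 x, F y) (F x) x := by
  have h1 := (hasDerivAt_integral_of_continuousOn hF hx hx).const_add (∫ y in Ioc 0 x, F y)
  refine h1.congr_of_eventuallyEq ?_
  filter_upwards [Ioi_mem_nhds hx] with z hz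
  exact integral_Ioc_add_interval hF hi hx hz

theorem integral_Ioi_of_tendsto_zero {Z : ℝ → ℝ} (hZ : ∀ x, 0 < x → HasDerivAt Z (F x) x)
    (hi : IntegrableOn F (Ioi x)) (hx : 0 < x) (h0 : Tendsto Z atTop (𝓝 0)) :
    ∫ y in Ioi x, F y = -Z x := by
  rw [integral_Ioi_of_hasDerivAt_of_tendsto' (fun y hy => hZ y (lt_of_lt_of_le hx hy)) hi h0]
  ring

end Calculus

/-! ### Reflection `x ↦ 1 / x` -/

/-- The reflected function `x ↦ f (1 / x)`. -/
noncomputable def reflect (f : ℝ → ℝ) (x : ℝ) : ℝ := f x⁻¹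

/-- The reflected density `x ↦ f (1 / x) / x²`. -/
noncomputable def reflectDensity (f : ℝ → ℝ) (x : ℝ) : ℝ := f x⁻¹ * (x ^ 2)⁻¹

section Reflection

variable {f F : ℝ → ℝ} {x : ℝ}

theorem hasDerivAt_reflect {f' : ℝ} (hx : 0 < x) (h : HasDerivAt f f' x⁻¹) :
    HasDerivAt (reflect f) (-(f' * (x ^ 2)⁻¹)) x := by
  have := HasDerivAt.comp x h (hasDerivAt_inv hx.ne')
  convert! this using 1
  ring

theorem image_inv_Ioi_pos (hx : 0 < x) : (fun y : ℝ => y⁻¹) '' Ioi x = Ioo 0 x⁻¹ := by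
  have := Set.inv_Ioi₀ hx
  rw [← this, ← Set.image_inv_eq_inv]

theorem integral_Ioi_reflectDensity (hx : 0 < x) :
    ∫ y in Ioi x, reflectDensity F y = ∫ y in Ioc 0 x⁻¹, F y := by
  rw [integral_Ioc_eq_integral_Ioo, ← image_inv_Ioi_pos hx,
    integral_image_eq_integral_abs_deriv_smul measurableSet_Ioi
      (f' := fun y => -(y ^ 2)⁻¹)
      (fun y hy => (hasDerivAt_inv (lt_trans hx hy).ne').hasDerivWithinAt)
      (inv_injective.injOn)]
  refine setIntegral_congr_fun measurableSet_Ioi fun y hy => ?_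
  have : 0 < y := lt_trans hx hy
  simp only [reflectDensity, abs_neg, smul_eq_mul, abs_of_pos (inv_pos.2 (pow_pos this 2))]
  ring

theorem integrableOn_Ioi_reflectDensity (hx : 0 < x) :
    IntegrableOn (reflectDensity F) (Ioi x) ↔ IntegrableOn F (Ioc 0 x⁻¹) := by
  rw [integrableOn_Ioc_iff_integrableOn_Ioo, ← image_inv_Ioi_pos hx,
    integrableOn_image_iff_integrableOn_abs_deriv_smul measurableSet_Ioi
      (f' := fun y => -(y ^ 2)⁻¹)
      (fun y hy => (hasDerivAt_inv (lt_trans hx hy).ne').hasDerivWithinAt)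
      (inv_injective.injOn)]
  refine integrableOn_congr_fun (fun y hy => ?_) measurableSet_Ioi
  have : 0 < y := lt_trans hx hy
  simp only [reflectDensity, abs_neg, smul_eq_mul, abs_of_pos (inv_pos.2 (pow_pos this 2))]
  ring

theorem reflect_reflect : reflect (reflect f) = f := by
  funext x; simp [reflect]

theorem reflectDensity_reflectDensity (hx : 0 < x) :
    reflectDensity (reflectDensity F) x = F x := by
  simp only [reflectDensity, inv_inv, inv_pow]
  field_simp

theorem integral_Ioc_reflectDensity (hx : 0 < x) :
    ∫ y in Ioc 0 x, reflectDensity F y = ∫ y in Ioi x⁻¹, F y := by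
  have := integral_Ioi_reflectDensity (F := reflectDensity F) (inv_pos.2 hx)
  rw [inv_inv] at this
  rw [← this]
  exact setIntegral_congr_fun measurableSet_Ioi fun y hy =>
    reflectDensity_reflectDensity (lt_trans (inv_pos.2 hx) hy)

theorem integrableOn_Ioc_reflectDensity (hx : 0 < x) :
    IntegrableOn (reflectDensity F) (Ioc 0 x) ↔ IntegrableOn F (Ioi x⁻¹) := by
  have := integrableOn_Ioi_reflectDensity (F := reflectDensity F) (inv_pos.2 hx)
  rw [inv_inv] at this
  rw [← this]
  exact integrableOn_congr_fun (fun y hy =>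
    reflectDensity_reflectDensity (lt_trans (inv_pos.2 hx) hy)) measurableSet_Ioi

theorem continuousOn_reflect (hf : ContinuousOn f (Ioi 0)) : ContinuousOn (reflect f) (Ioi 0) :=
  hf.comp (continuousOn_inv₀.mono fun _ hx => (ne_of_gt hx : _)) fun _ hx => mem_Ioi.2 (inv_pos.2 hx)

theorem continuousOn_reflectDensity (hf : ContinuousOn f (Ioi 0)) :
    ContinuousOn (reflectDensity f) (Ioi 0) :=
  (continuousOn_reflect hf).mul ((continuousOn_id.pow 2).inv₀
    fun _ hx => pow_ne_zero 2 (ne_of_gt hx))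

theorem tendsto_reflect_atTop {l : Filter ℝ} (h : Tendsto f (𝓝[>] 0) l) :
    Tendsto (reflect f) atTop l := h.comp tendsto_inv_atTop_nhdsGT_zero

theorem tendsto_reflect_zero {l : Filter ℝ} (h : Tendsto f atTop l) :
    Tendsto (reflect f) (𝓝[>] 0) l := h.comp tendsto_inv_nhdsGT_zero

theorem tendsto_of_tendsto_reflect {l : Filter ℝ} (h : Tendsto (reflect f) atTop l) :
    Tendsto f (𝓝[>] 0) l := by
  have := tendsto_reflect_zero h
  rwa [reflect_reflect] at this

end Reflection

/-! ### Natural pairs of densities and fundamental solutions -/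

/-- `∫^∞ s(z) m((1, z)) dz = ∞`, in terms of primitives. -/
def DivergesAtTop (s m : ℝ → ℝ) : Prop :=
  ∀ M E : ℝ → ℝ, M 1 = 0 → (∀ x, 0 < x → HasDerivAt M (m x) x) →
    (∀ x, 0 < x → HasDerivAt E (s x * M x) x) → Tendsto E atTop atTop

/-- `∫_0 s(z) m((z, 1)) dz = ∞`, in terms of primitives. -/
def DivergesAtZero (s m : ℝ → ℝ) : Prop :=
  ∀ M E : ℝ → ℝ, M 1 = 0 → (∀ x, 0 < x → HasDerivAt M (m x) x) →
    (∀ x, 0 < x → HasDerivAt E (s x * M x) x) → Tendsto E (𝓝[>] 0) atTop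

/-- Scale and speed densities of a diffusion on `(0, ∞)` with natural boundaries. -/
structure NaturalPair (s m : ℝ → ℝ) : Prop where
  s_pos : ∀ x, 0 < x → 0 < s x
  m_pos : ∀ x, 0 < x → 0 < m x
  s_cont : ContinuousOn s (Ioi 0)
  m_cont : ContinuousOn m (Ioi 0)
  exit_top : DivergesAtTop s m
  entrance_top : DivergesAtTop m s
  exit_zero : DivergesAtZero s m
  entrance_zero : DivergesAtZero m s

/-- `f` solves `(𝒜 - q) f = ρ` on `(0, ∞)`, where `v = f' / s` is the derivative with respect to
the scale. -/
structure FluxSolution (s m : ℝ → ℝ) (q : ℝ) (ρ f v : ℝ → ℝ) : Prop where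
  deriv_fun : ∀ x, 0 < x → HasDerivAt f (v x * s x) x
  deriv_flux : ∀ x, 0 < x → HasDerivAt v ((q * f x + ρ x) * m x) x

/-- A positive solution of `(𝒜 - q) f = 0` with positive scale derivative. -/
structure IncSolution (s m : ℝ → ℝ) (q : ℝ) (f v : ℝ → ℝ) : Prop
    extends FluxSolution s m q 0 f v where
  pos : ∀ x, 0 < x → 0 < f x
  flux_pos : ∀ x, 0 < x → 0 < v x

/-- A positive solution of `(𝒜 - q) f = 0` with negative scale derivative. -/
structure DecSolution (s m : ℝ → ℝ) (q : ℝ) (f v : ℝ → ℝ) : Prop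
    extends FluxSolution s m q 0 f v where
  pos : ∀ x, 0 < x → 0 < f x
  flux_neg : ∀ x, 0 < x → v x < 0

section Basic

variable {s m : ℝ → ℝ} {q : ℝ} {ρ f v : ℝ → ℝ}

/-- Inversion reverses orientation, so the primitive of the original density is minus the reflected
one; the sign that inversion produces in the derivative of the reflected `E` is absorbed there. -/
theorem DivergesAtZero.reflect (h : DivergesAtZero s m) :
    DivergesAtTop (reflectDensity s) (reflectDensity m) := by
  intro M E hM hM' hE'
  have := h (fun x => - PoissonControl.reflect M x) (PoissonControl.reflect E)
    (by simp [PoissonControl.reflect, hM]) (fun x hx => ?_) (fun x hx => ?_)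
  · have h2 := tendsto_reflect_atTop this
    rwa [reflect_reflect] at h2
  · convert! (hasDerivAt_reflect hx (hM' _ (inv_pos.2 hx))).neg using 1
    simp only [reflectDensity, inv_inv, inv_pow]
    field_simp
  · convert! hasDerivAt_reflect hx (hE' _ (inv_pos.2 hx)) using 1
    simp only [reflectDensity, PoissonControl.reflect, inv_inv, inv_pow]
    field_simp

theorem DivergesAtTop.reflect (h : DivergesAtTop s m) :
    DivergesAtZero (reflectDensity s) (reflectDensity m) := by
  intro M E hM hM' hE'
  have := h (fun x => - PoissonControl.reflect M x) (PoissonControl.reflect E)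
    (by simp [PoissonControl.reflect, hM]) (fun x hx => ?_) (fun x hx => ?_)
  · have h2 := tendsto_reflect_zero this
    rwa [reflect_reflect] at h2
  · convert! (hasDerivAt_reflect hx (hM' _ (inv_pos.2 hx))).neg using 1
    simp only [reflectDensity, inv_inv, inv_pow]
    field_simp
  · convert! hasDerivAt_reflect hx (hE' _ (inv_pos.2 hx)) using 1
    simp only [reflectDensity, PoissonControl.reflect, inv_inv, inv_pow]
    field_simp

theorem NaturalPair.reflect (h : NaturalPair s m) :
    NaturalPair (reflectDensity s) (reflectDensity m) where
  s_pos _ hx := mul_pos (h.s_pos _ (inv_pos.2 hx)) (inv_pos.2 (pow_pos hx 2))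
  m_pos _ hx := mul_pos (h.m_pos _ (inv_pos.2 hx)) (inv_pos.2 (pow_pos hx 2))
  s_cont := continuousOn_reflectDensity h.s_cont
  m_cont := continuousOn_reflectDensity h.m_cont
  exit_top := h.exit_zero.reflect
  entrance_top := h.entrance_zero.reflect
  exit_zero := h.exit_top.reflect
  entrance_zero := h.entrance_top.reflect

/-- The scale derivative changes sign under inversion, so increasing and decreasing solutions are
exchanged, and a statement about one kind at infinity yields a statement about the other kind at
zero. -/
theorem FluxSolution.reflect (h : FluxSolution s m q ρ f v) :
    FluxSolution (reflectDensity s) (reflectDensity m) q (reflect ρ) (reflect f)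
      (fun x => - reflect v x) where
  deriv_fun x hx := by
    convert! hasDerivAt_reflect hx (h.deriv_fun _ (inv_pos.2 hx)) using 1
    simp only [reflectDensity, PoissonControl.reflect]; ring
  deriv_flux x hx := by
    convert! (hasDerivAt_reflect hx (h.deriv_flux _ (inv_pos.2 hx))).neg using 1
    simp only [reflectDensity, PoissonControl.reflect]; ring

theorem IncSolution.reflect (h : IncSolution s m q f v) :
    DecSolution (reflectDensity s) (reflectDensity m) q (reflect f)
      (fun x => - reflect v x) where
  toFluxSolution := h.toFluxSolution.reflect
  pos _ hx := h.pos _ (inv_pos.2 hx)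
  flux_neg _ hx := neg_neg_of_pos (h.flux_pos _ (inv_pos.2 hx))

theorem DecSolution.reflect (h : DecSolution s m q f v) :
    IncSolution (reflectDensity s) (reflectDensity m) q (reflect f)
      (fun x => - reflect v x) where
  toFluxSolution := h.toFluxSolution.reflect
  pos _ hx := h.pos _ (inv_pos.2 hx)
  flux_pos _ hx := neg_pos_of_neg (h.flux_neg _ (inv_pos.2 hx))

theorem FluxSolution.continuousOn (h : FluxSolution s m q ρ f v) : ContinuousOn f (Ioi 0) :=
  fun x hx => (h.deriv_fun x hx).continuousAt.continuousWithinAt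

end Basic

/-! ### Boundary behaviour of the fundamental solutions -/

section Boundary

variable {s m : ℝ → ℝ} {q : ℝ} {f v : ℝ → ℝ} {x : ℝ}

theorem one_pos_of_mem_interior_Ici (hx : x ∈ interior (Ici (1 : ℝ))) : 1 < x := by
  simpa using hx

theorem pos_of_mem_Ici_one (hx : x ∈ Ici (1 : ℝ)) : 0 < x := lt_of_lt_of_le one_pos hx

theorem primitive_nonneg {F M : ℝ → ℝ} (hF : ∀ x, 0 < x → 0 < F x) (hM : M 1 = 0)
    (hM' : ∀ x, 0 < x → HasDerivAt M (F x) x) (hx : 1 ≤ x) : 0 ≤ M x := by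
  have h := monotoneOn_of_hasDerivAt (convex_Ici (1 : ℝ))
    (fun x hx => hM' x (pos_of_mem_Ici_one hx))
    (fun x hx => (hF x (pos_of_mem_Ici_one (interior_subset hx))).le)
  simpa [hM] using h self_mem_Ici hx hx

theorem exists_iterated_primitive {F G : ℝ → ℝ} (hF : ContinuousOn F (Ioi 0))
    (hG : ContinuousOn G (Ioi 0)) : ∃ M E : ℝ → ℝ, M 1 = 0 ∧
      (∀ x, 0 < x → HasDerivAt M (G x) x) ∧ ∀ x, 0 < x → HasDerivAt E (F x * M x) x := by
  obtain ⟨M, hM, hM'⟩ := exists_primitive hG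
  obtain ⟨E, -, hE'⟩ := exists_primitive (F := fun x => F x * M x)
    (hF.mul fun x hx => (hM' x hx).continuousAt.continuousWithinAt)
  exact ⟨M, E, hM, hM', hE'⟩

theorem IncSolution.strictMonoOn (hN : NaturalPair s m) (h : IncSolution s m q f v) :
    StrictMonoOn f (Ioi 0) :=
  strictMonoOn_of_hasDerivAt (convex_Ioi 0) h.deriv_fun fun x hx => by
    have hx := interior_subset hx
    exact mul_pos (h.flux_pos x hx) (hN.s_pos x hx)

theorem DecSolution.strictAntiOn (hN : NaturalPair s m) (h : DecSolution s m q f v) :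
    StrictAntiOn f (Ioi 0) :=
  strictAntiOn_of_hasDerivAt (convex_Ioi 0) h.deriv_fun fun x hx => by
    have hx := interior_subset hx
    exact mul_neg_of_neg_of_pos (h.flux_neg x hx) (hN.s_pos x hx)

theorem FluxSolution.strictMonoOn_flux (hN : NaturalPair s m) (hq : 0 < q)
    (h : FluxSolution s m q 0 f v) (hf : ∀ x, 0 < x → 0 < f x) : StrictMonoOn v (Ioi 0) :=
  strictMonoOn_of_hasDerivAt (convex_Ioi 0) h.deriv_flux fun x hx => by
    have hx := interior_subset hx
    have := hf x hx
    have := hN.m_pos x hx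
    simp only [Pi.zero_apply, add_zero]
    positivity

/-- Since f ≥ f(1) beyond 1, the flux gains at least q f(1) M, and a second integration gives f ≥ q
f(1) E + const. That infinity is not exit means that E diverges. -/
theorem IncSolution.tendsto_atTop (hN : NaturalPair s m) (hq : 0 < q)
    (h : IncSolution s m q f v) : Tendsto f atTop atTop := by
  obtain ⟨M, E, hM, hM', hE'⟩ := exists_iterated_primitive hN.s_cont hN.m_cont
  have hE := hN.exit_top M E hM hM' hE'
  have hf1 := h.pos 1 one_pos
  have h1 : MonotoneOn (fun x => v x - q * f 1 * M x) (Ici 1) := by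
    refine monotoneOn_of_hasDerivAt (convex_Ici 1) (fun x hx =>
      (h.deriv_flux x (pos_of_mem_Ici_one hx)).sub
        ((hM' x (pos_of_mem_Ici_one hx)).const_mul _)) fun x hx => ?_
    have hx' := pos_of_mem_Ici_one (interior_subset hx)
    have h2 := (h.strictMonoOn hN).monotoneOn (mem_Ioi.2 one_pos) hx'
      (one_pos_of_mem_interior_Ici hx).le
    have h3 := mul_nonneg (mul_nonneg hq.le (sub_nonneg.2 h2)) (hN.m_pos x hx').le
    simp only [Pi.zero_apply]
    linarith
  have h2 : MonotoneOn (fun x => f x - q * f 1 * E x) (Ici 1) := by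
    refine monotoneOn_of_hasDerivAt (convex_Ici 1) (fun x hx =>
      (h.deriv_fun x (pos_of_mem_Ici_one hx)).sub
        ((hE' x (pos_of_mem_Ici_one hx)).const_mul _)) fun x hx => ?_
    have hx' := interior_subset hx
    have h3 := h1 self_mem_Ici hx' hx'
    simp only [hM] at h3
    have h4 := h.flux_pos 1 one_pos
    have h5 : 0 ≤ (v x - q * f 1 * M x) * s x :=
      mul_nonneg (by linarith) (hN.s_pos x (pos_of_mem_Ici_one hx')).le
    linarith
  refine tendsto_atTop_mono' _ ?_ ((tendsto_atTop_add_const_right _ (f 1 - q * f 1 * E 1)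
    (hE.const_mul_atTop (mul_pos hq hf1))))
  filter_upwards [eventually_ge_atTop 1] with x hx
  have := h2 self_mem_Ici hx hx
  simp only at this
  linarith

/-- The same two integrations in the other order: f gains at least v(1) M, then v gains at least q
v(1) E, and E diverges because infinity is not entrance. -/
theorem IncSolution.flux_tendsto_atTop (hN : NaturalPair s m) (hq : 0 < q)
    (h : IncSolution s m q f v) : Tendsto v atTop atTop := by
  obtain ⟨M, E, hM, hM', hE'⟩ := exists_iterated_primitive hN.m_cont hN.s_cont
  have hE := hN.entrance_top M E hM hM' hE'
  have hv1 := h.flux_pos 1 one_pos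
  have h1 : MonotoneOn (fun x => f x - v 1 * M x) (Ici 1) := by
    refine monotoneOn_of_hasDerivAt (convex_Ici 1) (fun x hx =>
      (h.deriv_fun x (pos_of_mem_Ici_one hx)).sub
        ((hM' x (pos_of_mem_Ici_one hx)).const_mul _)) fun x hx => ?_
    have hx' := pos_of_mem_Ici_one (interior_subset hx)
    have h2 := (h.strictMonoOn_flux hN hq h.pos).monotoneOn (mem_Ioi.2 one_pos) hx'
      (one_pos_of_mem_interior_Ici hx).le
    have h3 := mul_nonneg (sub_nonneg.2 h2) (hN.s_pos x hx').le
    linarith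
  have h2 : MonotoneOn (fun x => v x - q * v 1 * E x) (Ici 1) := by
    refine monotoneOn_of_hasDerivAt (convex_Ici 1) (fun x hx =>
      (h.deriv_flux x (pos_of_mem_Ici_one hx)).sub
        ((hE' x (pos_of_mem_Ici_one hx)).const_mul _)) fun x hx => ?_
    have hx' := interior_subset hx
    have h3 := h1 self_mem_Ici hx' hx'
    simp only [hM] at h3
    have h4 := h.pos 1 one_pos
    have h5 : 0 ≤ q * (f x - v 1 * M x) * m x :=
      mul_nonneg (mul_nonneg hq.le (by linarith)) (hN.m_pos x (pos_of_mem_Ici_one hx')).le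
    simp only [Pi.zero_apply]
    linarith
  refine tendsto_atTop_mono' _ ?_ ((tendsto_atTop_add_const_right _ (v 1 - q * v 1 * E 1)
    (hE.const_mul_atTop (mul_pos hq hv1))))
  filter_upwards [eventually_ge_atTop 1] with x hx
  have := h2 self_mem_Ici hx hx
  simp only at this
  linarith

/-- The flux increases to a limit l ≤ 0. If l < 0, then -q l E diverges, although the monotone
combination below bounds it, because q f M - v ≥ 0. -/
theorem DecSolution.flux_tendsto_zero (hN : NaturalPair s m) (hq : 0 < q)
    (h : DecSolution s m q f v) : Tendsto v atTop (𝓝 0) := by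
  obtain ⟨l, hl, hl'⟩ := exists_tendsto_atTop_of_monotoneOn (f := v) (a := 1) (c := 0)
    ((h.strictMonoOn_flux hN hq h.pos).monotoneOn.mono fun x hx => pos_of_mem_Ici_one hx)
    (fun x hx => (h.flux_neg x (pos_of_mem_Ici_one hx)).le)
  have hl0 : l ≤ 0 := le_of_tendsto hl (by
    filter_upwards [eventually_ge_atTop 1] with x hx using
      (h.flux_neg x (pos_of_mem_Ici_one hx)).le)
  rcases hl0.eq_or_lt with rfl | hneg
  · exact hl
  exfalso
  obtain ⟨M, E, hM, hM', hE'⟩ := exists_iterated_primitive hN.s_cont hN.m_cont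
  have hE := hN.exit_top M E hM hM' hE'
  -- The terms with f m cancel in the derivative, which leaves q (v - l) s M; this is nonpositive
  -- because v ≤ l.
  have h1 : AntitoneOn (fun x => q * (f x * M x) - v x - q * l * E x) (Ici 1) := by
    refine antitoneOn_of_hasDerivAt (convex_Ici 1) (fun x hx =>
      ((((h.deriv_fun x (pos_of_mem_Ici_one hx)).mul
        (hM' x (pos_of_mem_Ici_one hx))).const_mul q).sub
        (h.deriv_flux x (pos_of_mem_Ici_one hx))).sub
        ((hE' x (pos_of_mem_Ici_one hx)).const_mul _)) fun x hx => ?_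
    have hx' := interior_subset hx
    have hx0 := pos_of_mem_Ici_one hx'
    have h3 : 0 ≤ q * (l - v x) * (s x * M x) := mul_nonneg (mul_nonneg hq.le
      (sub_nonneg.2 (hl' x hx'))) (mul_nonneg (hN.s_pos x hx0).le
      (primitive_nonneg hN.m_pos hM hM' hx'))
    simp only [Pi.zero_apply]
    linarith
  have h2 := (hE.const_mul_atTop (mul_pos hq (neg_pos.2 hneg))).eventually_gt_atTop
    (q * (f 1 * M 1) - v 1 - q * l * E 1)
  obtain ⟨x, hx, hx1⟩ := (h2.and (eventually_ge_atTop 1)).exists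
  have h3 := h1 self_mem_Ici hx1 hx1
  have hx0 := pos_of_mem_Ici_one hx1
  have h4 := mul_nonneg hq.le (mul_nonneg (h.pos x hx0).le
    (primitive_nonneg hN.m_pos hM hM' hx1))
  have h5 := h.flux_neg x hx0
  simp only at h3
  linarith

/-- Dual argument: a positive limit l of f would make q l E bounded above, although infinity is not
entrance. -/
theorem DecSolution.tendsto_zero (hN : NaturalPair s m) (hq : 0 < q)
    (h : DecSolution s m q f v) : Tendsto f atTop (𝓝 0) := by
  obtain ⟨l, hl, hl'⟩ := exists_tendsto_atTop_of_antitoneOn (f := f) (a := 1) (c := 0)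
    ((h.strictAntiOn hN).antitoneOn.mono fun x hx => pos_of_mem_Ici_one hx)
    (fun x hx => (h.pos x (pos_of_mem_Ici_one hx)).le)
  have hl0 : 0 ≤ l := ge_of_tendsto hl (by
    filter_upwards [eventually_ge_atTop 1] with x hx using (h.pos x (pos_of_mem_Ici_one hx)).le)
  rcases hl0.eq_or_lt with rfl | hpos
  · exact hl
  exfalso
  obtain ⟨M, E, hM, hM', hE'⟩ := exists_iterated_primitive hN.m_cont hN.s_cont
  have hE := hN.entrance_top M E hM hM' hE'
  have h1 : MonotoneOn (fun x => v x * M x - f x - q * l * E x) (Ici 1) := by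
    refine monotoneOn_of_hasDerivAt (convex_Ici 1) (fun x hx =>
      (((h.deriv_flux x (pos_of_mem_Ici_one hx)).mul (hM' x (pos_of_mem_Ici_one hx))).sub
        (h.deriv_fun x (pos_of_mem_Ici_one hx))).sub
        ((hE' x (pos_of_mem_Ici_one hx)).const_mul _)) fun x hx => ?_
    have hx' := interior_subset hx
    have hx0 := pos_of_mem_Ici_one hx'
    have h3 : 0 ≤ q * (f x - l) * (m x * M x) := mul_nonneg (mul_nonneg hq.le
      (sub_nonneg.2 (hl' x hx'))) (mul_nonneg (hN.m_pos x hx0).le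
      (primitive_nonneg hN.s_pos hM hM' hx'))
    simp only [Pi.zero_apply]
    linarith
  have h2 := (hE.const_mul_atTop (mul_pos hq hpos)).eventually_gt_atTop
    (-(v 1 * M 1 - f 1 - q * l * E 1))
  obtain ⟨x, hx, hx1⟩ := (h2.and (eventually_ge_atTop 1)).exists
  have h3 := h1 self_mem_Ici hx1 hx1
  have hx0 := pos_of_mem_Ici_one hx1
  have h4 := mul_nonneg (neg_nonneg.2 (h.flux_neg x hx0).le)
    (primitive_nonneg hN.s_pos hM hM' hx1)
  have h5 := h.pos x hx0
  simp only at h3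
  linarith

/-- The flux is a primitive of q f m and tends to zero, so the tail integral converges. -/
theorem DecSolution.integrableOn (hN : NaturalPair s m) (hq : 0 < q)
    (h : DecSolution s m q f v) (hx : 0 < x) : IntegrableOn (fun y => f y * m y) (Ioi x) := by
  have h1 : IntegrableOn (fun y => (q * f y + (0 : ℝ → ℝ) y) * m y) (Ioi x) :=
    integrableOn_Ioi_deriv_of_nonneg'
    (fun y hy => h.deriv_flux y (lt_of_lt_of_le hx hy)) (fun y hy => by
      have hy : 0 < y := lt_trans hx hy
      have := h.pos y hy
      have := hN.m_pos y hy
      simp only [Pi.zero_apply, add_zero]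
      positivity) (h.flux_tendsto_zero hN hq)
  refine IntegrableOn.congr_fun (Integrable.const_mul h1 q⁻¹) (fun y _ => ?_) measurableSet_Ioi
  simp only [Pi.zero_apply]
  field_simp
  simp

theorem DecSolution.integral_eq (hN : NaturalPair s m) (hq : 0 < q)
    (h : DecSolution s m q f v) (hx : 0 < x) : q * ∫ y in Ioi x, f y * m y = - v x := by
  have h2 := integral_Ioi_of_tendsto_zero h.deriv_flux
    (IntegrableOn.congr_fun (Integrable.const_mul (h.integrableOn hN hq hx) q) (fun y _ => by
      simp only [Pi.zero_apply]; ring) measurableSet_Ioi) hx (h.flux_tendsto_zero hN hq)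
  rw [← h2, ← integral_const_mul]
  exact setIntegral_congr_fun measurableSet_Ioi fun y _ => by simp only [Pi.zero_apply]; ring

theorem DecSolution.tendsto_zero_atTop (hN : NaturalPair s m) (hq : 0 < q)
    (h : DecSolution s m q f v) : Tendsto f (𝓝[>] 0) atTop :=
  tendsto_of_tendsto_reflect (h.reflect.tendsto_atTop hN.reflect hq)

theorem DecSolution.flux_zero_atBot (hN : NaturalPair s m) (hq : 0 < q)
    (h : DecSolution s m q f v) : Tendsto v (𝓝[>] 0) atBot := by
  refine tendsto_of_tendsto_reflect ?_
  have := tendsto_neg_atTop_atBot.comp (h.reflect.flux_tendsto_atTop hN.reflect hq)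
  refine this.congr fun x => by simp

theorem IncSolution.tendsto_zero (hN : NaturalPair s m) (hq : 0 < q)
    (h : IncSolution s m q f v) : Tendsto f (𝓝[>] 0) (𝓝 0) :=
  tendsto_of_tendsto_reflect (h.reflect.tendsto_zero hN.reflect hq)

theorem IncSolution.flux_tendsto_zero (hN : NaturalPair s m) (hq : 0 < q)
    (h : IncSolution s m q f v) : Tendsto v (𝓝[>] 0) (𝓝 0) := by
  refine tendsto_of_tendsto_reflect ?_
  have := (h.reflect.flux_tendsto_zero hN.reflect hq).neg
  simpa using this

theorem reflect_mul_reflectDensity (f m : ℝ → ℝ) :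
    (fun y => reflect f y * reflectDensity m y) = reflectDensity fun y => f y * m y := by
  funext y; simp only [reflect, reflectDensity]; ring

theorem IncSolution.integrableOn (hN : NaturalPair s m) (hq : 0 < q)
    (h : IncSolution s m q f v) (hx : 0 < x) : IntegrableOn (fun y => f y * m y) (Ioc 0 x) := by
  have := h.reflect.integrableOn hN.reflect hq (inv_pos.2 hx)
  rw [reflect_mul_reflectDensity, integrableOn_Ioi_reflectDensity (inv_pos.2 hx)] at this
  simpa using this

theorem IncSolution.integral_eq (hN : NaturalPair s m) (hq : 0 < q)
    (h : IncSolution s m q f v) (hx : 0 < x) : q * ∫ y in Ioc 0 x, f y * m y = v x := by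
  have := h.reflect.integral_eq hN.reflect hq (inv_pos.2 hx)
  rw [reflect_mul_reflectDensity, integral_Ioi_reflectDensity (inv_pos.2 hx)] at this
  simpa [PoissonControl.reflect] using this

end Boundary

/-! ### Wronskians and transversality -/

section Wronskian

variable {s m : ℝ → ℝ} {q r : ℝ} {φ v ψ u φq vq ψq uq h η ρ : ℝ → ℝ} {x : ℝ}

/-- The product v η s occurs twice and cancels; only the difference of the two rates and the source
remain. -/
theorem FluxSolution.hasDerivAt_wronskian (hf : FluxSolution s m q 0 φ v)
    (hh : FluxSolution s m r ρ h η) (hx : 0 < x) :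
    HasDerivAt (fun x => v x * h x - η x * φ x) (((q - r) * h x - ρ x) * φ x * m x) x := by
  convert! ((hf.deriv_flux x hx).mul (hh.deriv_fun x hx)).sub
    ((hh.deriv_flux x hx).mul (hf.deriv_fun x hx)) using 1
  simp only [Pi.zero_apply]
  ring

theorem eq_of_hasDerivAt_zero {f : ℝ → ℝ} (hf : ∀ x, 0 < x → HasDerivAt f 0 x) {y : ℝ} (hx : 0 < x)
    (hy : 0 < y) : f x = f y := by
  have h1 := monotoneOn_of_hasDerivAt (convex_Ioi (0 : ℝ)) (f := f) (f' := fun _ => 0) hf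
    fun _ _ => le_rfl
  have h2 := antitoneOn_of_hasDerivAt (convex_Ioi (0 : ℝ)) (f := f) (f' := fun _ => 0) hf
    fun _ _ => le_rfl
  rcases le_total x y with h | h
  · exact le_antisymm (h1 hx hy h) (h2 hx hy h)
  · exact le_antisymm (h2 hy hx h) (h1 hy hx h)

/-- Transversality at infinity. Since h is increasing, -v h = q h ∫_x^∞ φ m is at most q ∫_x^∞ h φ
m, which tends to zero, so η φ tends to -l ≥ 0. A positive limit would bound the logarithmic
derivative of φ so strongly that log φ stays bounded below, contradicting φ → 0. -/
theorem DecSolution.eq_zero_of_wronskian_tendsto (hN : NaturalPair s m) (hq : 0 < q)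
    (hφ : DecSolution s m q φ v) (hh : ∀ x, 0 < x → HasDerivAt h (η x * s x) x)
    (hpos : ∀ x, 0 < x → 0 ≤ h x) (hη : ∀ x, 0 < x → 0 ≤ η x)
    (hi : ∀ x, 0 < x → IntegrableOn (fun y => h y * φ y * m y) (Ioi x)) {l : ℝ}
    (hl : Tendsto (fun x => v x * h x - η x * φ x) atTop (𝓝 l)) : l = 0 := by
  have hc : ContinuousOn h (Ioi 0) := fun x hx => (hh x hx).continuousAt.continuousWithinAt
  have hcont : ContinuousOn (fun y => h y * φ y * m y) (Ioi 0) :=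
    (hc.mul hφ.continuousOn).mul hN.m_cont
  have hmono : MonotoneOn h (Ioi 0) := monotoneOn_of_hasDerivAt (convex_Ioi 0) hh fun x hx => by
    have hx := interior_subset hx
    exact mul_nonneg (hη x hx) (hN.s_pos x hx).le
  have hT : Tendsto (fun x => ∫ y in Ioi x, h y * φ y * m y) atTop (𝓝 0) :=
    tendsto_integral_Ioi_zero tendsto_id
  have hle : ∀ x, 0 < x → -(v x * h x) ≤ q * ∫ y in Ioi x, h y * φ y * m y := by
    intro x hx
    have h1 : h x * ∫ y in Ioi x, φ y * m y ≤ ∫ y in Ioi x, h y * φ y * m y := by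
      rw [← integral_const_mul]
      refine setIntegral_mono_on ((hφ.integrableOn hN hq hx).const_mul _) (hi x hx)
        measurableSet_Ioi fun y hy => ?_
      have hy' : 0 < y := lt_trans hx hy
      rw [mul_assoc]
      exact mul_le_mul_of_nonneg_right (hmono hx hy' (le_of_lt hy))
        (mul_pos (hφ.pos y hy') (hN.m_pos y hy')).le
    have h2 := hφ.integral_eq hN hq hx
    calc -(v x * h x) = q * (h x * ∫ y in Ioi x, φ y * m y) := by
          linear_combination (-h x) * h2
      _ ≤ _ := mul_le_mul_of_nonneg_left h1 hq.le
  have hvh : Tendsto (fun x => -(v x * h x)) atTop (𝓝 0) := by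
    refine squeeze_zero' ?_ ?_ (by simpa using hT.const_mul q)
    · filter_upwards [eventually_gt_atTop 0] with x hx
      exact neg_nonneg.2 (mul_nonpos_of_nonpos_of_nonneg (hφ.flux_neg x hx).le (hpos x hx))
    · filter_upwards [eventually_gt_atTop 0] with x hx using hle x hx
  have hηφ : Tendsto (fun x => η x * φ x) atTop (𝓝 (-l)) := by
    have := (hvh.add hl).neg
    simp only [zero_add] at this
    exact this.congr fun x => by ring
  have hl0 : 0 ≤ -l := ge_of_tendsto hηφ (by
    filter_upwards [eventually_gt_atTop 0] with x hx using
      mul_nonneg (hη x hx) (hφ.pos x hx).le)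
  by_contra hne
  have hα : 0 < -l := lt_of_le_of_ne hl0 fun h => hne (by linarith)
  obtain ⟨X, hX⟩ := ((hηφ.eventually (lt_mem_nhds (half_lt_self hα))).and
    (eventually_gt_atTop 0)).exists_forall_of_atTop
  have hX0 : 0 < X := (hX X le_rfl).2
  -- The derivative is -(v s / φ) (η φ + l / 2), nonnegative beyond X. The first two terms of the
  -- function tend to zero and the last to minus infinity.
  have hmon : MonotoneOn (fun x => -(v x * h x) - q * (∫ y in Ioi x, h y * φ y * m y) +
      -l / 2 * Real.log (φ x)) (Ici X) := by
    refine monotoneOn_of_hasDerivAt (convex_Ici X) (fun x hx => by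
      have hx0 : 0 < x := lt_of_lt_of_le hX0 hx
      exact ((((hφ.deriv_flux x hx0).mul (hh x hx0)).neg).sub
        ((hasDerivAt_integral_Ioi hcont hi hx0).const_mul q)).add
        (((hφ.deriv_fun x hx0).log (hφ.pos x hx0).ne').const_mul _)) fun x hx => ?_
    have hx := interior_subset hx
    have hx0 : 0 < x := lt_of_lt_of_le hX0 hx
    have h1 := (hX x hx).1
    have h2 : 0 ≤ -(v x) * s x / φ x * (η x * φ x - -l / 2) :=
      mul_nonneg (div_nonneg (mul_nonneg (neg_nonneg.2 (hφ.flux_neg x hx0).le)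
        (hN.s_pos x hx0).le) (hφ.pos x hx0).le) (sub_nonneg.2 h1.le)
    have h3 := (hφ.pos x hx0).ne'
    refine h2.trans_eq ?_
    simp only [Pi.zero_apply]
    field_simp
    ring
  have hlog : Tendsto (fun x => Real.log (φ x)) atTop atBot :=
    Real.tendsto_log_nhdsGT_zero.comp (tendsto_nhdsWithin_iff.2 ⟨hφ.tendsto_zero hN hq, by
      filter_upwards [eventually_gt_atTop 0] with x hx using hφ.pos x hx⟩)
  have hbot := (hvh.sub (hT.const_mul q)).add_atBot (hlog.const_mul_atBot (half_pos hα))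
  obtain ⟨x, hx, hxX⟩ := ((hbot.eventually_lt_atBot (-(v X * h X) -
    q * (∫ y in Ioi X, h y * φ y * m y) + -l / 2 * Real.log (φ X))).and
    (eventually_ge_atTop X)).exists
  exact absurd (hmon self_mem_Ici hxX hxX) (not_le.2 hx)


/-- Positivity of h makes the Wronskian monotone, so the existence of its limit already gives
integrability. -/
theorem integral_wronskian_of_tendsto (hrq : r < q) (hm : ∀ x, 0 < x → 0 < m x)
    (hφq : DecSolution s m q φq vq) (hh : FluxSolution s m r 0 h η) (hpos : ∀ x, 0 < x → 0 < h x)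
    {l : ℝ} (hl : Tendsto (fun x => vq x * h x - η x * φq x) atTop (𝓝 l)) (hx : 0 < x) :
    IntegrableOn (fun y => h y * φq y * m y) (Ioi x) := by
  have h1 := integrableOn_Ioi_deriv_of_nonneg' (a := x)
    (fun y hy => hφq.toFluxSolution.hasDerivAt_wronskian hh (lt_of_lt_of_le hx hy))
    (fun y hy => by
      have hy : 0 < y := lt_trans hx hy
      have := hpos y hy
      have := hφq.pos y hy
      have := hm y hy
      have := sub_pos.2 hrq
      simp only [Pi.zero_apply, sub_zero]
      positivity) hl
  refine IntegrableOn.congr_fun (Integrable.const_mul h1 (q - r)⁻¹) (fun y _ => ?_)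
    measurableSet_Ioi
  have := (sub_pos.2 hrq).ne'
  simp only [Pi.zero_apply]
  field_simp
  simp

theorem integral_wronskian_of_tendsto_zero (hrq : r < q) (hm : ∀ x, 0 < x → 0 < m x)
    (hφq : DecSolution s m q φq vq) (hh : FluxSolution s m r 0 h η) (hpos : ∀ x, 0 < x → 0 < h x)
    (hl : Tendsto (fun x => vq x * h x - η x * φq x) atTop (𝓝 0)) (hx : 0 < x) :
    (q - r) * ∫ y in Ioi x, h y * φq y * m y = η x * φq x - vq x * h x := by
  have h1 := integral_wronskian_of_tendsto hrq hm hφq hh hpos hl hx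
  have h2 := integral_Ioi_of_tendsto_zero (x := x)
    (fun y hy => hφq.toFluxSolution.hasDerivAt_wronskian hh hy)
    (IntegrableOn.congr_fun (Integrable.const_mul h1 (q - r)) (fun y _ => by
      simp only [Pi.zero_apply]; ring) measurableSet_Ioi) hx hl
  rw [← neg_sub (vq x * h x), ← h2, ← integral_const_mul]
  exact setIntegral_congr_fun measurableSet_Ioi fun y _ => by simp only [Pi.zero_apply]; ring

theorem wronskian_dec_tendsto (hN : NaturalPair s m) (hr : 0 < r) (hq : 0 < q)
    (hφ : DecSolution s m r φ v) (hφq : DecSolution s m q φq vq) :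
    Tendsto (fun x => vq x * φ x - v x * φq x) atTop (𝓝 0) := by
  simpa using ((hφq.flux_tendsto_zero hN hq).mul (hφ.tendsto_zero hN hr)).sub
    ((hφ.flux_tendsto_zero hN hr).mul (hφq.tendsto_zero hN hq))

/-- The Wronskian is increasing and negative, so it has a limit; the limit gives integrability of ψ
φ_q m, and transversality then forces the limit to be zero. -/
theorem wronskian_inc_tendsto (hN : NaturalPair s m) (hr : 0 < r) (hrq : r < q)
    (hψ : IncSolution s m r ψ u) (hφq : DecSolution s m q φq vq) :
    Tendsto (fun x => vq x * ψ x - u x * φq x) atTop (𝓝 0) := by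
  have hmono : MonotoneOn (fun x => vq x * ψ x - u x * φq x) (Ici 1) :=
    monotoneOn_of_hasDerivAt (convex_Ici 1) (fun x hx =>
      hφq.toFluxSolution.hasDerivAt_wronskian hψ.toFluxSolution (pos_of_mem_Ici_one hx))
      fun x hx => by
        have hx := pos_of_mem_Ici_one (interior_subset hx)
        have := hψ.pos x hx
        have := hφq.pos x hx
        have := hN.m_pos x hx
        have := sub_pos.2 hrq
        simp only [Pi.zero_apply, sub_zero]
        positivity
  obtain ⟨l, hl, -⟩ := exists_tendsto_atTop_of_monotoneOn (c := 0) hmono fun x hx => by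
    have hx := pos_of_mem_Ici_one hx
    have h1 := mul_neg_of_neg_of_pos (hφq.flux_neg x hx) (hψ.pos x hx)
    have h2 := mul_pos (hψ.flux_pos x hx) (hφq.pos x hx)
    linarith
  have := hφq.eq_zero_of_wronskian_tendsto hN (hr.trans hrq) hψ.deriv_fun
    (fun x hx => (hψ.pos x hx).le) (fun x hx => (hψ.flux_pos x hx).le)
    (fun x hx => integral_wronskian_of_tendsto hrq hN.m_pos hφq hψ.toFluxSolution hψ.pos hl hx) hl
  rwa [this] at hl

end Wronskian

/-! ### The Green operator -/

/-- `B⁻¹ (φ(x) ∫_0^x θ ψ m dy + ψ(x) ∫_x^∞ θ φ m dy)`. -/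
noncomputable def greenFun (m φ ψ : ℝ → ℝ) (B : ℝ) (θ : ℝ → ℝ) (x : ℝ) : ℝ :=
  (φ x * (∫ y in Ioc 0 x, θ y * ψ y * m y) + ψ x * ∫ y in Ioi x, θ y * φ y * m y) / B

/-- The scale derivative of `greenFun`, for scale derivatives `v` and `u` of `φ` and `ψ`. -/
noncomputable def greenFlux (m φ ψ v u : ℝ → ℝ) (B : ℝ) (θ : ℝ → ℝ) (x : ℝ) : ℝ :=
  (v x * (∫ y in Ioc 0 x, θ y * ψ y * m y) + u x * ∫ y in Ioi x, θ y * φ y * m y) / B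

/-- A pair of fundamental solutions with Wronskian `B`. -/
structure FundamentalPair (s m : ℝ → ℝ) (r : ℝ) (φ ψ v u : ℝ → ℝ) (B : ℝ) : Prop where
  dec : DecSolution s m r φ v
  inc : IncSolution s m r ψ u
  wronskian : ∀ x, 0 < x → u x * φ x - v x * ψ x = B
  B_pos : 0 < B

/-- `θ` is continuous on `(0, ∞)` and integrable against the Green kernel. -/
structure GreenIntegrable (m φ ψ θ : ℝ → ℝ) : Prop where
  cont : ContinuousOn θ (Ioi 0)
  int_zero : ∀ x, 0 < x → IntegrableOn (fun y => θ y * ψ y * m y) (Ioc 0 x)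
  int_top : ∀ x, 0 < x → IntegrableOn (fun y => θ y * φ y * m y) (Ioi x)

section Green

variable {s m : ℝ → ℝ} {q r B : ℝ} {φ v ψ u φq vq ψq uq θ θ' h η ρ : ℝ → ℝ} {x : ℝ}

theorem exists_fundamentalPair (hφ : DecSolution s m r φ v) (hψ : IncSolution s m r ψ u) :
    ∃ B, FundamentalPair s m r φ ψ v u B := by
  refine ⟨u 1 * φ 1 - v 1 * ψ 1, hφ, hψ, fun x hx => ?_, ?_⟩
  · refine eq_of_hasDerivAt_zero (f := fun x => u x * φ x - v x * ψ x) (fun x hx => ?_) hx one_pos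
    convert! hψ.toFluxSolution.hasDerivAt_wronskian hφ.toFluxSolution hx using 1
    simp
  · have h1 := mul_pos (hψ.flux_pos 1 one_pos) (hφ.pos 1 one_pos)
    have h2 := mul_neg_of_neg_of_pos (hφ.flux_neg 1 one_pos) (hψ.pos 1 one_pos)
    linarith

theorem FundamentalPair.reflect (hF : FundamentalPair s m r φ ψ v u B) :
    FundamentalPair (reflectDensity s) (reflectDensity m) r (reflect ψ) (reflect φ)
      (fun x => - reflect u x) (fun x => - reflect v x) B where
  dec := hF.inc.reflect
  inc := hF.dec.reflect
  wronskian x hx := by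
    rw [← hF.wronskian _ (inv_pos.2 hx)]
    simp only [PoissonControl.reflect]; ring
  B_pos := hF.B_pos

theorem reflect_mul_mul (f g m : ℝ → ℝ) :
    (fun y => reflect f y * reflect g y * reflectDensity m y) =
      reflectDensity fun y => f y * g y * m y := by
  funext y; simp only [reflect, reflectDensity]; ring

theorem GreenIntegrable.reflect (hθ : GreenIntegrable m φ ψ θ) :
    GreenIntegrable (reflectDensity m) (reflect ψ) (reflect φ) (reflect θ) where
  cont := continuousOn_reflect hθ.cont
  int_zero x hx := by
    rw [reflect_mul_mul, integrableOn_Ioc_reflectDensity hx]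
    exact hθ.int_top _ (inv_pos.2 hx)
  int_top x hx := by
    rw [reflect_mul_mul, integrableOn_Ioi_reflectDensity hx]
    exact hθ.int_zero _ (inv_pos.2 hx)

theorem greenFun_reflect (hx : 0 < x) :
    greenFun (reflectDensity m) (reflect ψ) (reflect φ) B (reflect θ) x =
      greenFun m φ ψ B θ x⁻¹ := by
  simp only [greenFun]
  rw [reflect_mul_mul, reflect_mul_mul, integral_Ioc_reflectDensity hx,
    integral_Ioi_reflectDensity hx]
  simp only [reflect]; ring

theorem greenFlux_reflect (hx : 0 < x) :
    greenFlux (reflectDensity m) (reflect ψ) (reflect φ) (fun x => - reflect u x)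
      (fun x => - reflect v x) B (reflect θ) x = - greenFlux m φ ψ v u B θ x⁻¹ := by
  simp only [greenFlux]
  rw [reflect_mul_mul, reflect_mul_mul, integral_Ioc_reflectDensity hx,
    integral_Ioi_reflectDensity hx]
  simp only [reflect]; ring

theorem GreenIntegrable.abs (hN : NaturalPair s m) (hF : FundamentalPair s m r φ ψ v u B)
    (hθ : GreenIntegrable m φ ψ θ) : GreenIntegrable m φ ψ (fun y => |θ y|) where
  cont := hθ.cont.abs
  int_zero x hx := IntegrableOn.congr_fun (Integrable.abs (hθ.int_zero x hx)) (fun y hy => by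
    simp only [abs_mul, abs_of_pos (hF.inc.pos y hy.1), abs_of_pos (hN.m_pos y hy.1)])
    measurableSet_Ioc
  int_top x hx := IntegrableOn.congr_fun (Integrable.abs (hθ.int_top x hx)) (fun y hy => by
    have hy : 0 < y := lt_trans hx hy
    simp only [abs_mul, abs_of_pos (hF.dec.pos y hy), abs_of_pos (hN.m_pos y hy)])
    measurableSet_Ioi

theorem GreenIntegrable.add (hθ : GreenIntegrable m φ ψ θ) (hθ' : GreenIntegrable m φ ψ θ') :
    GreenIntegrable m φ ψ (fun y => θ y + θ' y) where
  cont := hθ.cont.add hθ'.cont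
  int_zero x hx := ((hθ.int_zero x hx).add (hθ'.int_zero x hx)).congr_fun (fun y _ => by
    simp only [Pi.add_apply]; ring) measurableSet_Ioc
  int_top x hx := ((hθ.int_top x hx).add (hθ'.int_top x hx)).congr_fun (fun y _ => by
    simp only [Pi.add_apply]; ring) measurableSet_Ioi

theorem GreenIntegrable.const_mul (c : ℝ) (hθ : GreenIntegrable m φ ψ θ) :
    GreenIntegrable m φ ψ (fun y => c * θ y) where
  cont := continuousOn_const.mul hθ.cont
  int_zero x hx := IntegrableOn.congr_fun (Integrable.const_mul (hθ.int_zero x hx) c)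
    (fun y _ => by ring) measurableSet_Ioc
  int_top x hx := IntegrableOn.congr_fun (Integrable.const_mul (hθ.int_top x hx) c)
    (fun y _ => by ring) measurableSet_Ioi

theorem greenFun_add (hθ : GreenIntegrable m φ ψ θ) (hθ' : GreenIntegrable m φ ψ θ')
    (hx : 0 < x) : greenFun m φ ψ B (fun y => θ y + θ' y) x =
      greenFun m φ ψ B θ x + greenFun m φ ψ B θ' x := by
  simp only [greenFun, add_mul]
  rw [integral_add (hθ.int_zero x hx) (hθ'.int_zero x hx),
    integral_add (hθ.int_top x hx) (hθ'.int_top x hx)]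
  ring

theorem greenFun_const_mul (c : ℝ) :
    greenFun m φ ψ B (fun y => c * θ y) x = c * greenFun m φ ψ B θ x := by
  simp only [greenFun, mul_assoc, integral_const_mul]
  ring

theorem GreenIntegrable.cont_inc (hN : NaturalPair s m) (hF : FundamentalPair s m r φ ψ v u B)
    (hθ : GreenIntegrable m φ ψ θ) : ContinuousOn (fun y => θ y * ψ y * m y) (Ioi 0) :=
  (hθ.cont.mul hF.inc.continuousOn).mul hN.m_cont

theorem GreenIntegrable.cont_dec (hN : NaturalPair s m) (hF : FundamentalPair s m r φ ψ v u B)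
    (hθ : GreenIntegrable m φ ψ θ) : ContinuousOn (fun y => θ y * φ y * m y) (Ioi 0) :=
  (hθ.cont.mul hF.dec.continuousOn).mul hN.m_cont

theorem GreenIntegrable.deriv_zero (hN : NaturalPair s m) (hF : FundamentalPair s m r φ ψ v u B)
    (hθ : GreenIntegrable m φ ψ θ) (hx : 0 < x) :
    HasDerivAt (fun x => ∫ y in Ioc 0 x, θ y * ψ y * m y) (θ x * ψ x * m x) x :=
  hasDerivAt_integral_Ioc (hθ.cont_inc hN hF) hθ.int_zero hx

theorem GreenIntegrable.deriv_top (hN : NaturalPair s m) (hF : FundamentalPair s m r φ ψ v u B)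
    (hθ : GreenIntegrable m φ ψ θ) (hx : 0 < x) :
    HasDerivAt (fun x => ∫ y in Ioi x, θ y * φ y * m y) (-(θ x * φ x * m x)) x :=
  hasDerivAt_integral_Ioi (hθ.cont_dec hN hF) hθ.int_top hx

/-- Variation of constants: the boundary terms of the two integrals cancel in the derivative of the
function, and in that of the flux they combine to the Wronskian, which is B. -/
theorem greenFun_fluxSolution (hN : NaturalPair s m) (hF : FundamentalPair s m r φ ψ v u B)
    (hθ : GreenIntegrable m φ ψ θ) :
    FluxSolution s m r (fun x => - θ x) (greenFun m φ ψ B θ) (greenFlux m φ ψ v u B θ) where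
  deriv_fun x hx := by
    convert! (((hF.dec.deriv_fun x hx).mul (hθ.deriv_zero hN hF hx)).add
      ((hF.inc.deriv_fun x hx).mul (hθ.deriv_top hN hF hx))).div_const B using 1
    simp only [greenFlux]; ring
  deriv_flux x hx := by
    convert! (((hF.dec.deriv_flux x hx).mul (hθ.deriv_zero hN hF hx)).add
      ((hF.inc.deriv_flux x hx).mul (hθ.deriv_top hN hF hx))).div_const B using 1
    have hB := hF.B_pos.ne'
    simp only [greenFun, Pi.zero_apply]
    have := hF.wronskian x hx
    field_simp
    rw [← this]
    ring

/-- The combination eliminates one of the two integrals, and the constant Wronskian cancels B. This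
identity and the next remove the Green function from the closed forms of H and Q. -/
theorem inc_mul_greenFlux_sub (hF : FundamentalPair s m r φ ψ v u B) (hx : 0 < x) :
    ψ x * greenFlux m φ ψ v u B θ x - u x * greenFun m φ ψ B θ x =
      - ∫ y in Ioc 0 x, θ y * ψ y * m y := by
  have hB := hF.B_pos.ne'
  have := hF.wronskian x hx
  simp only [greenFlux, greenFun]
  field_simp
  rw [← this]
  ring

theorem dec_mul_greenFlux_sub (hF : FundamentalPair s m r φ ψ v u B) (hx : 0 < x) :
    φ x * greenFlux m φ ψ v u B θ x - v x * greenFun m φ ψ B θ x =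
      ∫ y in Ioi x, θ y * φ y * m y := by
  have hB := hF.B_pos.ne'
  have := hF.wronskian x hx
  simp only [greenFlux, greenFun]
  field_simp
  rw [← this]
  ring

theorem abs_greenFun_le (hN : NaturalPair s m) (hF : FundamentalPair s m r φ ψ v u B)
    (hx : 0 < x) : |greenFun m φ ψ B θ x| ≤ greenFun m φ ψ B (fun y => |θ y|) x := by
  have h1 : |∫ y in Ioc 0 x, θ y * ψ y * m y| ≤ ∫ y in Ioc 0 x, |θ y| * ψ y * m y := by
    refine abs_integral_le_integral_abs.trans_eq (setIntegral_congr_fun measurableSet_Ioc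
      fun y hy => ?_)
    simp only [abs_mul, abs_of_pos (hF.inc.pos y hy.1), abs_of_pos (hN.m_pos y hy.1)]
  have h2 : |∫ y in Ioi x, θ y * φ y * m y| ≤ ∫ y in Ioi x, |θ y| * φ y * m y := by
    refine abs_integral_le_integral_abs.trans_eq (setIntegral_congr_fun measurableSet_Ioi
      fun y hy => ?_)
    have hy : 0 < y := lt_trans hx hy
    simp only [abs_mul, abs_of_pos (hF.dec.pos y hy), abs_of_pos (hN.m_pos y hy)]
  simp only [greenFun, abs_div, abs_of_pos hF.B_pos]
  refine div_le_div_of_nonneg_right ((abs_add_le _ _).trans (add_le_add ?_ ?_)) hF.B_pos.le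
  · rw [abs_mul, abs_of_pos (hF.dec.pos x hx)]
    exact mul_le_mul_of_nonneg_left h1 (hF.dec.pos x hx).le
  · rw [abs_mul, abs_of_pos (hF.inc.pos x hx)]
    exact mul_le_mul_of_nonneg_left h2 (hF.inc.pos x hx).le

/-- The Wronskian of the two decreasing solutions has a sign, so φ_q / φ is decreasing, and on a
tail |θ| φ_q is dominated by a constant multiple of |θ| φ. -/
theorem integrableOn_mul_dec_of_lt (hN : NaturalPair s m) (hr : 0 < r) (hrq : r < q)
    (hF : FundamentalPair s m r φ ψ v u B) (hφq : DecSolution s m q φq vq)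
    (hθ : GreenIntegrable m φ ψ θ) (hx : 0 < x) :
    IntegrableOn (fun y => θ y * φq y * m y) (Ioi x) := by
  have hanti : AntitoneOn (fun x => φq x / φ x) (Ioi 0) := by
    refine antitoneOn_of_hasDerivAt (convex_Ioi 0) (fun x hx =>
      (hφq.deriv_fun x hx).div (hF.dec.deriv_fun x hx) (hF.dec.pos x hx).ne') fun x hx => ?_
    have hx : 0 < x := interior_subset hx
    have h1 := integral_wronskian_of_tendsto_zero hrq hN.m_pos hφq hF.dec.toFluxSolution
      hF.dec.pos (wronskian_dec_tendsto hN hr (hr.trans hrq) hF.dec hφq) hx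
    have h2 : 0 ≤ ∫ y in Ioi x, φ y * φq y * m y :=
      setIntegral_nonneg measurableSet_Ioi fun y hy => by
        have hy : 0 < y := lt_trans hx hy
        exact (mul_pos (mul_pos (hF.dec.pos y hy) (hφq.pos y hy)) (hN.m_pos y hy)).le
    have h3 : 0 ≤ (v x * φq x - vq x * φ x) * s x := by
      rw [← h1]
      exact mul_nonneg (mul_nonneg (sub_pos.2 hrq).le h2) (hN.s_pos x hx).le
    refine div_nonpos_of_nonpos_of_nonneg ?_ (sq_nonneg _)
    linarith
  refine Integrable.mono' (g := fun y => φq x / φ x * (|θ y| * φ y * m y))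
    (Integrable.const_mul ((hθ.abs hN hF).int_top x hx) _)
    ((((hθ.cont.mul hφq.continuousOn).mul hN.m_cont).mono
      (Ioi_subset_Ioi hx.le)).aestronglyMeasurable measurableSet_Ioi) ?_
  refine (ae_restrict_iff' measurableSet_Ioi).2 (Eventually.of_forall fun y hy => ?_)
  have hy0 : 0 < y := lt_trans hx hy
  have h1 := hanti hx hy0 (le_of_lt hy)
  simp only at h1
  rw [div_le_iff₀ (hF.dec.pos y hy0)] at h1
  rw [Real.norm_eq_abs, abs_mul, abs_mul, abs_of_pos (hφq.pos y hy0), abs_of_pos (hN.m_pos y hy0)]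
  calc |θ y| * φq y * m y ≤ |θ y| * (φq x / φ x * φ y) * m y :=
        mul_le_mul_of_nonneg_right (mul_le_mul_of_nonneg_left h1 (abs_nonneg _))
          (hN.m_pos y hy0).le
    _ = _ := by ring

/-- The expression expands to (W(φ_q, φ) A + W(φ_q, ψ) C) / B with A = ∫_0^x θ ψ m and C = ∫_x^∞ θ φ
m. Both Wronskians and C tend to zero, but A may grow. Monotonicity of ψ and φ gives |A| ≤ A1 + (ψ /
φ) C1, and |W(φ_q, φ)| ψ / φ is dominated by |W(φ_q, ψ)|. -/
theorem greenFun_wronskian_tendsto (hN : NaturalPair s m) (hr : 0 < r) (hrq : r < q)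
    (hF : FundamentalPair s m r φ ψ v u B) (hφq : DecSolution s m q φq vq)
    (hθ : GreenIntegrable m φ ψ θ) :
    Tendsto (fun x => vq x * greenFun m φ ψ B θ x - greenFlux m φ ψ v u B θ x * φq x) atTop
      (𝓝 0) := by
  have hZφ := wronskian_dec_tendsto hN hr (hr.trans hrq) hF.dec hφq
  have hZψ := wronskian_inc_tendsto hN hr hrq hF.inc hφq
  have hC : Tendsto (fun x => ∫ y in Ioi x, θ y * φ y * m y) atTop (𝓝 0) :=
    tendsto_integral_Ioi_zero tendsto_id
  have habs := hθ.abs hN hF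
  set A1 := ∫ y in Ioc 0 1, |θ y| * ψ y * m y with hA1
  set C1 := ∫ y in Ioi 1, |θ y| * φ y * m y with hC1
  have key : Tendsto (fun x => (vq x * φ x - v x * φq x) * ∫ y in Ioc 0 x, θ y * ψ y * m y)
      atTop (𝓝 0) := by
    refine squeeze_zero_norm' (a := fun x => (-(vq x * φ x - v x * φq x)) * A1 +
      (-(vq x * ψ x - u x * φq x)) * C1) ?_
      (by simpa using (hZφ.neg.mul_const A1).add (hZψ.neg.mul_const C1))
    filter_upwards [eventually_ge_atTop 1] with x hx1
    have hx : 0 < x := pos_of_mem_Ici_one hx1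
    have h1 := integral_wronskian_of_tendsto_zero hrq hN.m_pos hφq hF.dec.toFluxSolution
      hF.dec.pos hZφ hx
    have h2 : 0 ≤ ∫ y in Ioi x, φ y * φq y * m y :=
      setIntegral_nonneg measurableSet_Ioi fun y hy => by
        have hy : 0 < y := lt_trans hx hy
        exact (mul_pos (mul_pos (hF.dec.pos y hy) (hφq.pos y hy)) (hN.m_pos y hy)).le
    have h3 : 0 ≤ v x * φq x - vq x * φ x := by
      rw [← h1]; exact mul_nonneg (sub_pos.2 hrq).le h2
    have hφx := hF.dec.pos x hx
    have hψx := hF.inc.pos x hx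
    have h4 : |∫ y in Ioc 0 x, θ y * ψ y * m y| ≤ A1 + ψ x / φ x * C1 := by
      have h5 : |∫ y in Ioc 0 x, θ y * ψ y * m y| ≤ ∫ y in Ioc 0 x, |θ y| * ψ y * m y := by
        refine abs_integral_le_integral_abs.trans_eq (setIntegral_congr_fun measurableSet_Ioc
          fun y hy => ?_)
        simp only [abs_mul, abs_of_pos (hF.inc.pos y hy.1), abs_of_pos (hN.m_pos y hy.1)]
      refine h5.trans ?_
      rw [integral_Ioc_add_interval (habs.cont_inc hN hF) habs.int_zero one_pos hx]
      refine add_le_add le_rfl ?_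
      rw [intervalIntegral.integral_of_le hx1]
      have h6 : ∫ y in Ioc 1 x, ψ x / φ x * (|θ y| * φ y * m y) ≤ ψ x / φ x * C1 := by
        rw [integral_const_mul]
        refine mul_le_mul_of_nonneg_left (setIntegral_mono_set (habs.int_top 1 one_pos) ?_
          (Eventually.of_forall fun y hy => hy.1)) (div_pos hψx hφx).le
        refine (ae_restrict_iff' measurableSet_Ioi).2 (Eventually.of_forall fun y hy => ?_)
        have hy : 0 < y := lt_trans one_pos hy
        exact mul_nonneg (mul_nonneg (abs_nonneg _) (hF.dec.pos y hy).le) (hN.m_pos y hy).le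
      refine le_trans (setIntegral_mono_on ?_ ?_ measurableSet_Ioc fun y hy => ?_) h6
      · exact (habs.int_zero x hx).mono_set (Ioc_subset_Ioc_left zero_le_one)
      · exact Integrable.const_mul ((habs.int_top 1 one_pos).mono_set fun y hy => hy.1) _
      · have hy0 : 0 < y := lt_trans one_pos hy.1
        have h7 : ψ y ≤ ψ x / φ x * φ y := by
          rw [div_mul_eq_mul_div, le_div_iff₀ hφx]
          exact mul_le_mul ((hF.inc.strictMonoOn hN).monotoneOn hy0 hx hy.2)
            ((hF.dec.strictAntiOn hN).antitoneOn hy0 hx hy.2) hφx.le hψx.le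
        calc |θ y| * ψ y * m y ≤ |θ y| * (ψ x / φ x * φ y) * m y :=
              mul_le_mul_of_nonneg_right (mul_le_mul_of_nonneg_left h7 (abs_nonneg _))
                (hN.m_pos y hy0).le
          _ = _ := by ring
    have hC1' : 0 ≤ C1 := setIntegral_nonneg measurableSet_Ioi fun y hy => by
      have hy : 0 < y := lt_trans one_pos hy
      exact mul_nonneg (mul_nonneg (abs_nonneg _) (hF.dec.pos y hy).le) (hN.m_pos y hy).le
    have h8 : (v x * φq x - vq x * φ x) * (ψ x / φ x) ≤ u x * φq x - vq x * ψ x := by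
      have h9 : v x * φq x - vq x * φ x ≤ -(vq x * φ x) := by
        have := mul_neg_of_neg_of_pos (hF.dec.flux_neg x hx) (hφq.pos x hx); linarith
      calc _ ≤ -(vq x * φ x) * (ψ x / φ x) :=
            mul_le_mul_of_nonneg_right h9 (div_pos hψx hφx).le
        _ = -(vq x * ψ x) := by field_simp
        _ ≤ _ := by
            have := mul_pos (hF.inc.flux_pos x hx) (hφq.pos x hx); linarith
    rw [Real.norm_eq_abs, abs_mul, abs_sub_comm, abs_of_nonneg h3]
    calc _ ≤ (v x * φq x - vq x * φ x) * (A1 + ψ x / φ x * C1) :=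
          mul_le_mul_of_nonneg_left h4 h3
      _ = (v x * φq x - vq x * φ x) * A1 +
          (v x * φq x - vq x * φ x) * (ψ x / φ x) * C1 := by ring
      _ ≤ (v x * φq x - vq x * φ x) * A1 + (u x * φq x - vq x * ψ x) * C1 :=
          add_le_add le_rfl (mul_le_mul_of_nonneg_right h8 hC1')
      _ = _ := by ring
  have := (key.add (hZψ.mul hC)).div_const B
  simp only [mul_zero, add_zero, zero_div] at this
  refine this.congr fun x => ?_
  simp only [greenFun, greenFlux]
  ring

theorem greenFun_wronskian_deriv (hN : NaturalPair s m) (hF : FundamentalPair s m r φ ψ v u B)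
    (hφq : DecSolution s m q φq vq) (hθ : GreenIntegrable m φ ψ θ) (hx : 0 < x) :
    HasDerivAt (fun x => vq x * greenFun m φ ψ B θ x - greenFlux m φ ψ v u B θ x * φq x)
      (((q - r) * greenFun m φ ψ B θ x + θ x) * φq x * m x) x := by
  convert! hφq.toFluxSolution.hasDerivAt_wronskian (greenFun_fluxSolution hN hF hθ) hx using 1
  simp

/-- For |θ| the Wronskian has a nonnegative derivative and a finite limit, so this derivative is
integrable; it controls the Green function of |θ|, which dominates that of θ. -/
theorem integrableOn_greenFun_mul_dec (hN : NaturalPair s m) (hr : 0 < r) (hrq : r < q)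
    (hF : FundamentalPair s m r φ ψ v u B) (hφq : DecSolution s m q φq vq)
    (hθ : GreenIntegrable m φ ψ θ) (hx : 0 < x) :
    IntegrableOn (fun y => greenFun m φ ψ B θ y * φq y * m y) (Ioi x) := by
  have hqr := sub_pos.2 hrq
  have habs := hθ.abs hN hF
  have h0 : ∀ y, 0 < y → 0 ≤ greenFun m φ ψ B (fun y => |θ y|) y := fun y hy =>
    (abs_nonneg _).trans (abs_greenFun_le hN hF hy)
  have h1 := integrableOn_Ioi_deriv_of_nonneg' (a := x)
    (fun y hy => greenFun_wronskian_deriv hN hF hφq habs (lt_of_lt_of_le hx hy))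
    (fun y hy => by
      have hy : 0 < y := lt_trans hx hy
      have := h0 y hy
      have := hφq.pos y hy
      have := hN.m_pos y hy
      positivity) (greenFun_wronskian_tendsto hN hr hrq hF hφq habs)
  refine Integrable.mono' (Integrable.const_mul h1 (q - r)⁻¹)
    (((((greenFun_fluxSolution hN hF hθ).continuousOn.mul hφq.continuousOn).mul hN.m_cont).mono
      (Ioi_subset_Ioi hx.le)).aestronglyMeasurable measurableSet_Ioi) ?_
  refine (ae_restrict_iff' measurableSet_Ioi).2 (Eventually.of_forall fun y hy => ?_)
  have hy : 0 < y := lt_trans hx hy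
  have h2 := hφq.pos y hy
  have h3 := hN.m_pos y hy
  rw [Real.norm_eq_abs, abs_mul, abs_mul, abs_of_pos h2, abs_of_pos h3, mul_assoc, mul_assoc,
    ← mul_assoc (q - r)⁻¹]
  refine mul_le_mul_of_nonneg_right ?_ (mul_pos h2 h3).le
  rw [le_inv_mul_iff₀ hqr]
  have h4 := mul_le_mul_of_nonneg_left (abs_greenFun_le (θ := θ) hN hF hy) hqr.le
  have := abs_nonneg (θ y)
  linarith

/-- The resolvent equation in integrated form, from integrating the derivative of the Wronskian of
φ_q and the Green function up to infinity. -/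
theorem integral_greenFun_mul_dec (hN : NaturalPair s m) (hr : 0 < r) (hrq : r < q)
    (hF : FundamentalPair s m r φ ψ v u B) (hφq : DecSolution s m q φq vq)
    (hθ : GreenIntegrable m φ ψ θ) (hx : 0 < x) :
    (q - r) * ∫ y in Ioi x, greenFun m φ ψ B θ y * φq y * m y =
      greenFlux m φ ψ v u B θ x * φq x - vq x * greenFun m φ ψ B θ x -
        ∫ y in Ioi x, θ y * φq y * m y := by
  have h1 := integrableOn_greenFun_mul_dec hN hr hrq hF hφq hθ hx
  have h2 := integrableOn_mul_dec_of_lt hN hr hrq hF hφq hθ hx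
  have h3 := integral_Ioi_of_tendsto_zero (x := x)
    (fun y hy => greenFun_wronskian_deriv hN hF hφq hθ hy)
    (((Integrable.const_mul h1 (q - r)).add h2).congr (Eventually.of_forall fun y => by
      simp only [Pi.add_apply]; ring)) hx (greenFun_wronskian_tendsto hN hr hrq hF hφq hθ)
  have h4 : ∫ y in Ioi x, ((q - r) * greenFun m φ ψ B θ y + θ y) * φq y * m y =
      (q - r) * (∫ y in Ioi x, greenFun m φ ψ B θ y * φq y * m y) +
        ∫ y in Ioi x, θ y * φq y * m y := by
    rw [← integral_const_mul, ← integral_add (Integrable.const_mul h1 (q - r)) h2]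
    exact setIntegral_congr_fun measurableSet_Ioi fun y _ => by ring
  linarith

/-! ### The mirrored statements at `0` -/

theorem wronskian_zero_inc_integral (hN : NaturalPair s m) (hr : 0 < r) (hrq : r < q)
    (hψ : IncSolution s m r ψ u) (hψq : IncSolution s m q ψq uq) (hx : 0 < x) :
    (q - r) * ∫ y in Ioc 0 x, ψ y * ψq y * m y = uq x * ψ x - u x * ψq x := by
  have h := integral_wronskian_of_tendsto_zero hrq hN.reflect.m_pos hψq.reflect
    hψ.reflect.toFluxSolution hψ.reflect.pos (wronskian_dec_tendsto hN.reflect hr (hr.trans hrq)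
      hψ.reflect hψq.reflect) (inv_pos.2 hx)
  rw [reflect_mul_mul, integral_Ioi_reflectDensity (inv_pos.2 hx)] at h
  simp only [inv_inv, reflect] at h
  linarith

theorem wronskian_zero_dec_integral (hN : NaturalPair s m) (hr : 0 < r) (hrq : r < q)
    (hφ : DecSolution s m r φ v) (hψq : IncSolution s m q ψq uq) (hx : 0 < x) :
    (q - r) * ∫ y in Ioc 0 x, φ y * ψq y * m y = uq x * φ x - v x * ψq x := by
  have h := integral_wronskian_of_tendsto_zero hrq hN.reflect.m_pos hψq.reflect
    hφ.reflect.toFluxSolution hφ.reflect.pos (wronskian_inc_tendsto hN.reflect hr hrq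
      hφ.reflect hψq.reflect) (inv_pos.2 hx)
  rw [reflect_mul_mul, integral_Ioi_reflectDensity (inv_pos.2 hx)] at h
  simp only [inv_inv, reflect] at h
  linarith

theorem integrableOn_mul_inc_of_lt (hN : NaturalPair s m) (hr : 0 < r) (hrq : r < q)
    (hF : FundamentalPair s m r φ ψ v u B) (hψq : IncSolution s m q ψq uq)
    (hθ : GreenIntegrable m φ ψ θ) (hx : 0 < x) :
    IntegrableOn (fun y => θ y * ψq y * m y) (Ioc 0 x) := by
  have h := integrableOn_mul_dec_of_lt hN.reflect hr hrq hF.reflect hψq.reflect hθ.reflect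
    (inv_pos.2 hx)
  rw [reflect_mul_mul, integrableOn_Ioi_reflectDensity (inv_pos.2 hx)] at h
  simpa using h

theorem integral_greenFun_mul_inc (hN : NaturalPair s m) (hr : 0 < r) (hrq : r < q)
    (hF : FundamentalPair s m r φ ψ v u B) (hψq : IncSolution s m q ψq uq)
    (hθ : GreenIntegrable m φ ψ θ) (hx : 0 < x) :
    (q - r) * ∫ y in Ioc 0 x, greenFun m φ ψ B θ y * ψq y * m y =
      uq x * greenFun m φ ψ B θ x - greenFlux m φ ψ v u B θ x * ψq x -
        ∫ y in Ioc 0 x, θ y * ψq y * m y := by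
  have hx' := inv_pos.2 hx
  have h := integral_greenFun_mul_dec hN.reflect hr hrq hF.reflect hψq.reflect hθ.reflect hx'
  have e : ∫ y in Ioi x⁻¹, greenFun (reflectDensity m) (reflect ψ) (reflect φ) B (reflect θ) y *
      reflect ψq y * reflectDensity m y =
      ∫ y in Ioi x⁻¹, reflectDensity (fun y => greenFun m φ ψ B θ y * ψq y * m y) y := by
    refine setIntegral_congr_fun measurableSet_Ioi fun y hy => ?_
    simp only [greenFun_reflect (lt_trans hx' hy), reflect, reflectDensity]
    ring
  rw [e, greenFun_reflect hx', greenFlux_reflect hx', reflect_mul_mul,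
    integral_Ioi_reflectDensity hx', integral_Ioi_reflectDensity hx'] at h
  simp only [inv_inv, reflect] at h
  linarith

end Green

/-! ### The identity function -/

section Identity

variable {s m : ℝ → ℝ} {r B : ℝ} {φ v ψ u w η : ℝ → ℝ} {x : ℝ}

theorem flux_id_mul_scale (hid : FluxSolution s m r (fun x => - w x) (fun x => x) η) (hx : 0 < x) :
    η x * s x = 1 := (hid.deriv_fun x hx).unique (hasDerivAt_id' x)

theorem flux_id_pos (hN : NaturalPair s m)
    (hid : FluxSolution s m r (fun x => - w x) (fun x => x) η) (hx : 0 < x) : 0 < η x := by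
  have h1 := flux_id_mul_scale hid hx
  have h2 := hN.s_pos x hx
  by_contra h
  have := mul_nonpos_of_nonpos_of_nonneg (not_lt.1 h) h2.le
  linarith

/-- The Wronskian of φ and the identity plus the tail integral is constant. The constant is the
limit of that Wronskian at infinity, which is zero by transversality. -/
theorem dec_wronskian_id (hN : NaturalPair s m) (hr : 0 < r)
    (hF : FundamentalPair s m r φ ψ v u B)
    (hid : FluxSolution s m r (fun x => - w x) (fun x => x) η)
    (hw : GreenIntegrable m φ ψ w) (hI : GreenIntegrable m φ ψ fun x => x) (hx : 0 < x) :
    η x * φ x - v x * x = ∫ y in Ioi x, w y * φ y * m y := by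
  have hconst : ∀ y, 0 < y → v y * y - η y * φ y + ∫ z in Ioi y, w z * φ z * m z =
      v x * x - η x * φ x + ∫ z in Ioi x, w z * φ z * m z := fun y hy => by
    refine eq_of_hasDerivAt_zero (f := fun y => v y * y - η y * φ y +
      ∫ z in Ioi y, w z * φ z * m z) (fun z hz => ?_) hy hx
    convert! (hF.dec.toFluxSolution.hasDerivAt_wronskian hid hz).add (hw.deriv_top hN hF hz) using 1
    ring
  set l := v x * x - η x * φ x + ∫ z in Ioi x, w z * φ z * m z with hl
  have hT : Tendsto (fun x => ∫ y in Ioi x, w y * φ y * m y) atTop (𝓝 0) :=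
    tendsto_integral_Ioi_zero tendsto_id
  have hlim : Tendsto (fun y => v y * y - η y * φ y) atTop (𝓝 l) := by
    have := hT.const_sub l
    rw [sub_zero] at this
    refine this.congr' ?_
    filter_upwards [eventually_gt_atTop 0] with y hy
    rw [← hconst y hy]; ring
  have h0 : l = 0 := hF.dec.eq_zero_of_wronskian_tendsto hN hr hid.deriv_fun
    (fun y hy => hy.le) (fun y hy => (flux_id_pos hN hid hy).le) hI.int_top hlim
  linarith

/-- Here the constant is a limit at zero; since x u vanishes there, η ψ tends to some α ≥ 0. If α >
0, then η s = 1 bounds s / ψ near zero, hence also the derivative u s / ψ of log ψ, whereas log ψ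
tends to minus infinity. -/
theorem inc_wronskian_id (hN : NaturalPair s m) (hr : 0 < r)
    (hF : FundamentalPair s m r φ ψ v u B)
    (hid : FluxSolution s m r (fun x => - w x) (fun x => x) η)
    (hw : GreenIntegrable m φ ψ w) (hx : 0 < x) :
    u x * x - η x * ψ x = ∫ y in Ioc 0 x, w y * ψ y * m y := by
  have hconst : ∀ y, 0 < y → u y * y - η y * ψ y - ∫ z in Ioc 0 y, w z * ψ z * m z =
      u x * x - η x * ψ x - ∫ z in Ioc 0 x, w z * ψ z * m z := fun y hy => by
    refine eq_of_hasDerivAt_zero (f := fun y => u y * y - η y * ψ y -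
      ∫ z in Ioc 0 y, w z * ψ z * m z) (fun z hz => ?_) hy hx
    convert! (hF.inc.toFluxSolution.hasDerivAt_wronskian hid hz).sub
      (hw.deriv_zero hN hF hz) using 1
    ring
  set l := u x * x - η x * ψ x - ∫ z in Ioc 0 x, w z * ψ z * m z with hl
  have hT : Tendsto (fun x => ∫ y in Ioc 0 x, w y * ψ y * m y) (𝓝[>] 0) (𝓝 0) := by
    refine tendsto_of_tendsto_reflect ?_
    have : Tendsto (fun x => ∫ y in Ioi x, reflectDensity (fun y => w y * ψ y * m y) y) atTop
      (𝓝 0) := tendsto_integral_Ioi_zero tendsto_id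
    refine this.congr' ?_
    filter_upwards [eventually_gt_atTop 0] with y hy
    rw [integral_Ioi_reflectDensity hy, reflect]
  have hu0 := hF.inc.flux_tendsto_zero hN hr
  have hid0 : Tendsto (fun x : ℝ => x) (𝓝[>] 0) (𝓝 0) := tendsto_nhdsWithin_of_tendsto_nhds tendsto_id
  have hlim : Tendsto (fun y => η y * ψ y) (𝓝[>] 0) (𝓝 (-l)) := by
    have := ((hu0.mul hid0).sub hT).sub_const l
    simp only [mul_zero, sub_zero, zero_sub] at this
    refine this.congr' ?_
    filter_upwards [self_mem_nhdsWithin] with y hy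
    rw [← hconst y hy]; ring
  suffices h0 : l = 0 by linarith
  have hl0 : 0 ≤ -l := ge_of_tendsto hlim (by
    filter_upwards [self_mem_nhdsWithin] with y hy using
      (mul_pos (flux_id_pos hN hid hy) (hF.inc.pos y hy)).le)
  by_contra hne
  have hα : 0 < -l := lt_of_le_of_ne hl0 fun h => hne (by linarith)
  obtain ⟨δ, hδ, hδ'⟩ := mem_nhdsGT_iff_exists_Ioc_subset.1
    ((hlim.eventually (lt_mem_nhds (half_lt_self hα))).and
      (hu0.eventually (gt_mem_nhds one_pos)))
  have hδ0 : 0 < δ := hδ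
  have hanti : AntitoneOn (fun y => Real.log (ψ y) - 2 / -l * y) (Ioc 0 δ) := by
    refine antitoneOn_of_hasDerivAt (convex_Ioc 0 δ) (fun y hy =>
      ((hF.inc.deriv_fun y hy.1).log (hF.inc.pos y hy.1).ne').sub
        ((hasDerivAt_id' y).const_mul _)) fun y hy => ?_
    have hy := interior_subset hy
    obtain ⟨h1, h2⟩ := hδ' hy
    have h3 := flux_id_mul_scale hid hy.1
    have h4 := hF.inc.pos y hy.1
    have h5 := hN.s_pos y hy.1
    have h6 := hF.inc.flux_pos y hy.1
    have h7 : s y / ψ y ≤ 2 / -l := by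
      rw [div_le_div_iff₀ h4 hα]
      have : s y * (-l / 2) ≤ s y * (η y * ψ y) := mul_le_mul_of_nonneg_left h1.le h5.le
      have h8 : s y * (η y * ψ y) = ψ y := by
        rw [← mul_assoc, mul_comm (s y), h3, one_mul]
      linarith
    have h9 : u y * s y / ψ y ≤ 2 / -l := by
      rw [mul_div_assoc]
      exact (mul_le_of_le_one_left (div_pos h5 h4).le h2.le).trans h7
    linarith
  have hlog : Tendsto (fun x => Real.log (ψ x)) (𝓝[>] 0) atBot :=
    Real.tendsto_log_nhdsGT_zero.comp (tendsto_nhdsWithin_iff.2 ⟨hF.inc.tendsto_zero hN hr, by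
      filter_upwards [self_mem_nhdsWithin] with x hx using hF.inc.pos x hx⟩)
  have hbot := hlog.atBot_add (hid0.const_mul (2 / -l)).neg
  obtain ⟨y, hy, hyδ⟩ := ((hbot.eventually_lt_atBot (Real.log (ψ δ) - 2 / -l * δ)).and
    (Ioc_mem_nhdsGT hδ0)).exists
  have := hanti hyδ ⟨hδ0, le_rfl⟩ hyδ.2
  simp only at this
  linarith

/-- `x = R_r w (x)` for `w(x) = r x - μ(x)`. -/
theorem greenFun_eq_id (hN : NaturalPair s m) (hr : 0 < r)
    (hF : FundamentalPair s m r φ ψ v u B)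
    (hid : FluxSolution s m r (fun x => - w x) (fun x => x) η)
    (hw : GreenIntegrable m φ ψ w) (hI : GreenIntegrable m φ ψ fun x => x) (hx : 0 < x) :
    greenFun m φ ψ B w x = x := by
  have hB := hF.B_pos.ne'
  rw [greenFun, ← dec_wronskian_id hN hr hF hid hw hI hx, ← inc_wronskian_id hN hr hF hid hw hx,
    div_eq_iff hB, ← hF.wronskian x hx]
  ring

/-- If w(x) < 0, then w ≤ w(x) on (0, x], and since the flux of φ diverges at zero, ∫_y^∞ w φ m
would tend to minus infinity as y → 0. But this integral equals η φ - v y > 0. -/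
theorem nonneg_of_monotoneOn (hN : NaturalPair s m) (hr : 0 < r)
    (hF : FundamentalPair s m r φ ψ v u B)
    (hid : FluxSolution s m r (fun x => - w x) (fun x => x) η)
    (hw : GreenIntegrable m φ ψ w) (hI : GreenIntegrable m φ ψ fun x => x)
    (hmono : MonotoneOn w (Ioi 0)) (hx : 0 < x) : 0 ≤ w x := by
  by_contra! hneg
  have h1 : MonotoneOn (fun y => (∫ z in Ioi y, w z * φ z * m z) + w x / r * v y) (Ioc 0 x) := by
    refine monotoneOn_of_hasDerivAt (convex_Ioc 0 x) (fun y hy =>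
      (hw.deriv_top hN hF hy.1).add ((hF.dec.deriv_flux y hy.1).const_mul _)) fun y hy => ?_
    have hy := interior_subset hy
    have h2 := mul_nonneg (mul_nonneg (sub_nonneg.2 (hmono hy.1 hx hy.2))
      (hF.dec.pos y hy.1).le) (hN.m_pos y hy.1).le
    refine h2.trans_eq ?_
    simp only [Pi.zero_apply]
    field_simp
    ring
  have h2 := (hF.dec.flux_zero_atBot hN hr).const_mul_atBot_of_neg (div_neg_of_neg_of_pos hneg hr)
  obtain ⟨y, hy, hyx⟩ := ((h2.eventually_gt_atTop
    ((∫ z in Ioi x, w z * φ z * m z) + w x / r * v x)).and (Ioc_mem_nhdsGT hx)).exists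
  have h3 := h1 hyx ⟨hx, le_rfl⟩ hyx.2
  have h4 := dec_wronskian_id hN hr hF hid hw hI hyx.1
  have h5 := mul_pos (flux_id_pos hN hid hyx.1) (hF.dec.pos y hyx.1)
  have h6 := mul_neg_of_neg_of_pos (hF.dec.flux_neg y hyx.1) hyx.1
  simp only at h3
  linarith

/-- If the integral converged, P(x) = x v - r ∫_0^x y φ m would be a primitive of v with a finite
limit at zero, and x v would tend to zero. Now η φ - x v = ∫_x^∞ w φ m ≥ c > 0 near zero, so η φ ≥ c
/ 2 and s / φ ≤ 2 / c there. Hence (log φ)' = v s / φ ≥ (2 / c) P', which bounds log φ above near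
zero, against φ → ∞. -/
theorem not_integrableOn_id_mul_dec (hN : NaturalPair s m) (hr : 0 < r)
    (hF : FundamentalPair s m r φ ψ v u B)
    (hid : FluxSolution s m r (fun x => - w x) (fun x => x) η)
    (hw : GreenIntegrable m φ ψ w) (hI : GreenIntegrable m φ ψ fun x => x)
    (hmono : MonotoneOn w (Ioi 0)) : ¬ IntegrableOn (fun y => y * φ y * m y) (Ioc 0 1) := by
  intro hint
  have hcont : ContinuousOn (fun y => y * φ y * m y) (Ioi 0) :=
    (continuousOn_id.mul hF.dec.continuousOn).mul hN.m_cont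
  have hint' : ∀ x, 0 < x → IntegrableOn (fun y => y * φ y * m y) (Ioc 0 x) := fun x hx =>
    integrableOn_Ioc_of_continuousOn hcont one_pos hint hx
  have hP' : ∀ x, 0 < x → HasDerivAt (fun x => x * v x - r * ∫ y in Ioc 0 x, y * φ y * m y)
      (v x) x := fun x hx => by
    convert! ((hasDerivAt_id' x).mul (hF.dec.deriv_flux x hx)).sub
      ((hasDerivAt_integral_Ioc hcont hint' hx).const_mul r) using 1
    simp only [Pi.zero_apply]; ring
  have hT : Tendsto (fun x => ∫ y in Ioc 0 x, y * φ y * m y) (𝓝[>] 0) (𝓝 0) := by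
    refine tendsto_of_tendsto_reflect ?_
    have : Tendsto (fun x => ∫ y in Ioi x, reflectDensity (fun y => y * φ y * m y) y) atTop
      (𝓝 0) := tendsto_integral_Ioi_zero tendsto_id
    refine this.congr' ?_
    filter_upwards [eventually_gt_atTop 0] with y hy
    rw [integral_Ioi_reflectDensity hy, reflect]
  have hlog0 := Real.tendsto_log_nhdsGT_zero
  set P : ℝ → ℝ := fun x => x * v x - r * ∫ y in Ioc 0 x, y * φ y * m y with hPdef
  have hPanti : AntitoneOn P (Ioi 0) := antitoneOn_of_hasDerivAt (convex_Ioi 0) hP'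
    fun x hx => (hF.dec.flux_neg x (interior_subset hx)).le
  have hPneg : ∀ x, 0 < x → P x ≤ 0 := fun x hx => by
    have h1 := mul_neg_of_pos_of_neg hx (hF.dec.flux_neg x hx)
    have h2 : 0 ≤ ∫ y in Ioc 0 x, y * φ y * m y := setIntegral_nonneg measurableSet_Ioc
      fun y hy => (mul_pos (mul_pos hy.1 (hF.dec.pos y hy.1)) (hN.m_pos y hy.1)).le
    have := mul_nonneg hr.le h2
    simp only [hPdef]; linarith
  obtain ⟨l, hl, -⟩ := exists_tendsto_atTop_of_monotoneOn (f := reflect P) (a := 1) (c := 0)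
    (fun x hx y hy hxy => hPanti (inv_pos.2 (pos_of_mem_Ici_one hy))
      (inv_pos.2 (pos_of_mem_Ici_one hx)) (inv_anti₀ (pos_of_mem_Ici_one hx) hxy))
    (fun x hx => hPneg _ (inv_pos.2 (pos_of_mem_Ici_one hx)))
  have hPl : Tendsto P (𝓝[>] 0) (𝓝 l) := tendsto_of_tendsto_reflect hl
  have hxv : Tendsto (fun x => x * v x) (𝓝[>] 0) (𝓝 l) := by
    have := hPl.add (hT.const_mul r)
    simp only [mul_zero, add_zero] at this
    exact this.congr fun x => by simp only [hPdef]; ring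
  -- Otherwise v < l / (2 y) near zero, and its primitive P would diverge logarithmically.
  have hl0 : l = 0 := by
    have hle : l ≤ 0 := le_of_tendsto hPl (by
      filter_upwards [self_mem_nhdsWithin] with x hx using hPneg x hx)
    by_contra hne
    have hneg : l < 0 := lt_of_le_of_ne hle hne
    obtain ⟨δ, hδ, hδ'⟩ := mem_nhdsGT_iff_exists_Ioc_subset.1
      (hxv.eventually (gt_mem_nhds (show l < l / 2 by linarith)))
    have hδ0 : 0 < δ := hδ
    have hanti : AntitoneOn (fun y => P y - l / 2 * Real.log y) (Ioc 0 δ) := by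
      refine antitoneOn_of_hasDerivAt (convex_Ioc 0 δ) (fun y hy =>
        (hP' y hy.1).sub ((Real.hasDerivAt_log hy.1.ne').const_mul _)) fun y hy => ?_
      have hy := interior_subset hy
      have h1 : y * v y < l / 2 := hδ' hy
      rw [sub_nonpos, ← div_eq_mul_inv, le_div_iff₀ hy.1]
      linarith
    have hbot := hPl.add_atBot (hlog0.const_mul_atBot (show 0 < -(l / 2) by linarith))
    obtain ⟨y, hy, hyδ⟩ := ((hbot.eventually_lt_atBot (P δ - l / 2 * Real.log δ)).and
      (Ioc_mem_nhdsGT hδ0)).exists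
    have := hanti hyδ ⟨hδ0, le_rfl⟩ hyδ.2
    simp only at this
    linarith
  subst hl0
  have hVanti : AntitoneOn (fun x => ∫ y in Ioi x, w y * φ y * m y) (Ioi 0) :=
    antitoneOn_of_hasDerivAt (convex_Ioi 0) (fun x hx => hw.deriv_top hN hF hx) fun x hx => by
      have hx := interior_subset hx
      exact neg_nonpos.2 (mul_nonneg (mul_nonneg (nonneg_of_monotoneOn hN hr hF hid hw hI hmono hx)
        (hF.dec.pos x hx).le) (hN.m_pos x hx).le)
  set c := ∫ y in Ioi 1, w y * φ y * m y with hc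
  have hc0 : 0 < c := by
    rw [hc, ← dec_wronskian_id hN hr hF hid hw hI one_pos]
    have h5 := mul_pos (flux_id_pos hN hid one_pos) (hF.dec.pos 1 one_pos)
    have h6 := hF.dec.flux_neg 1 one_pos
    linarith
  obtain ⟨δ, hδ, hδ'⟩ := mem_nhdsGT_iff_exists_Ioc_subset.1
    ((hxv.eventually (lt_mem_nhds (show -(c / 2) < 0 by linarith))).and
      (Ioc_mem_nhdsGT (one_pos (α := ℝ))))
  have hδ0 : 0 < δ := hδ
  have hmon : MonotoneOn (fun y => Real.log (φ y) - 2 / c * P y) (Ioc 0 δ) := by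
    refine monotoneOn_of_hasDerivAt (convex_Ioc 0 δ) (fun y hy =>
      ((hF.dec.deriv_fun y hy.1).log (hF.dec.pos y hy.1).ne').sub
        ((hP' y hy.1).const_mul _)) fun y hy => ?_
    have hy := interior_subset hy
    obtain ⟨h1, h2⟩ := hδ' hy
    have h3 := flux_id_mul_scale hid hy.1
    have h4 := hF.dec.pos y hy.1
    have h5 := hN.s_pos y hy.1
    have h6 := hF.dec.flux_neg y hy.1
    have h10 : c ≤ η y * φ y - v y * y := by
      rw [dec_wronskian_id hN hr hF hid hw hI hy.1]
      exact hVanti hy.1 (mem_Ioi.2 one_pos) h2.2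
    have h7 : s y / φ y ≤ 2 / c := by
      rw [div_le_div_iff₀ h4 hc0]
      have : s y * (c / 2) ≤ s y * (η y * φ y) := mul_le_mul_of_nonneg_left (by linarith) h5.le
      have h8 : s y * (η y * φ y) = φ y := by
        rw [← mul_assoc, mul_comm (s y), h3, one_mul]
      linarith
    have h9 := mul_nonneg (neg_nonneg.2 h6.le) (sub_nonneg.2 h7)
    refine h9.trans_eq ?_
    ring
  have hlog : Tendsto (fun x => Real.log (φ x)) (𝓝[>] 0) atTop :=
    Real.tendsto_log_atTop.comp (hF.dec.tendsto_zero_atTop hN hr)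
  have htop := hlog.atTop_add (hPl.const_mul (2 / c)).neg
  obtain ⟨y, hy, hyδ⟩ := ((htop.eventually_gt_atTop (Real.log (φ δ) - 2 / c * P δ)).and
    (Ioc_mem_nhdsGT hδ0)).exists
  have := hmon hyδ ⟨hδ0, le_rfl⟩ hyδ.2
  simp only at this
  linarith

end Identity

/-! ### The fixed-point argument -/

section FixedPoint

variable {Hψ Hφ Qψ Qφ : ℝ → ℝ} {xt xh : ℝ}

/-- Continuity, monotonicity and range conditions under which `fixedPointMap` is well behaved. -/
structure CrossingData (Hψ Hφ Qψ Qφ : ℝ → ℝ) (xt xh : ℝ) : Prop where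
  xt_pos : 0 < xt
  lt : xt < xh
  Hψ_cont : ContinuousOn Hψ (Ioi 0)
  Hφ_cont : ContinuousOn Hφ (Ioi 0)
  Qψ_cont : ContinuousOn Qψ (Ioi 0)
  Hψ_mono : StrictMonoOn Hψ (Ioc 0 xt)
  Hφ_anti : StrictAntiOn Hφ (Ioc 0 xt)
  Qψ_anti : StrictAntiOn Qψ (Ici xh)
  Qφ_mono : StrictMonoOn Qφ (Ici xh)
  Hψ_pos : ∀ x ∈ Ioc 0 xt, 0 < Hψ x
  Qψ_nonpos : ∃ b ∈ Ici xh, Qψ b ≤ 0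
  ψ_le : Hψ xt ≤ Qψ xh
  Hφ_unbdd : ∀ N, ∃ ε ∈ Ioc 0 xt, N ≤ Hφ ε
  φ_le : Hφ xt ≤ Qφ xh
  combination : ∀ x₀, 0 < x₀ → ∃ k : ℝ,
    Hψ x₀ + k * Hφ x₀ < Qψ x₀ + k * Qφ x₀ ∧
    (x₀ ≤ xh → StrictAntiOn (fun x => Qψ x + k * Qφ x) (Ici xh)) ∧
    (xt ≤ x₀ → StrictAntiOn (fun x => Hψ x + k * Hφ x) (Ioc 0 xt)) ∧
    MonotoneOn (fun x => Hψ x + k * Hφ x) (Icc xt x₀) ∧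
    MonotoneOn (fun x => Qψ x + k * Qφ x) (Icc x₀ xh)

theorem CrossingData.xh_pos (h : CrossingData Hψ Hφ Qψ Qφ xt xh) : 0 < xh := h.xt_pos.trans h.lt

theorem CrossingData.mem_image_Qψ (h : CrossingData Hψ Hφ Qψ Qφ xt xh) {x : ℝ}
    (hx : x ∈ Ioc 0 xt) : Hψ x ∈ Qψ '' Ici xh := by
  obtain ⟨b, hb, hb0⟩ := h.Qψ_nonpos
  have h1 : Hψ x ≤ Qψ xh := (h.Hψ_mono.monotoneOn hx ⟨h.xt_pos, le_rfl⟩ hx.2).trans h.ψ_le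
  obtain ⟨y, hy, hy'⟩ := intermediate_value_Icc' hb
    (h.Qψ_cont.mono fun y hy => lt_of_lt_of_le h.xh_pos hy.1)
    ⟨hb0.trans (h.Hψ_pos x hx).le, h1⟩
  exact ⟨y, hy.1, hy'⟩

theorem CrossingData.mem_image_Hφ (h : CrossingData Hψ Hφ Qψ Qφ xt xh) {y : ℝ}
    (hy : y ∈ Ici xh) : Qφ y ∈ Hφ '' Ioc 0 xt := by
  obtain ⟨ε, hε, hε'⟩ := h.Hφ_unbdd (Qφ y)
  obtain ⟨z, hz, hz'⟩ := intermediate_value_Icc' hε.2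
    (h.Hφ_cont.mono fun y hy => lt_of_lt_of_le hε.1 hy.1)
    ⟨h.φ_le.trans (h.Qφ_mono.monotoneOn self_mem_Ici hy hy), hε'⟩
  exact ⟨z, ⟨lt_of_lt_of_le hε.1 hz.1, hz.2⟩, hz'⟩

/-- Use the combination attached to x₀ = b, respectively x₀ = a. If a ≥ xt, the H-combination does
not decrease from a to b, yet at b it lies strictly below the Q-combination, whose value there is
that of the H-combination at a. The other bound is symmetric. -/
theorem CrossingData.lt_and_lt_of_solvesPair (h : CrossingData Hψ Hφ Qψ Qφ xt xh) {a b : ℝ}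
    (hab : SolvesPair Hψ Hφ Qψ Qφ a b) : a < xt ∧ xh < b := by
  obtain ⟨ha, hlt, h1, h2⟩ := hab
  constructor
  · by_contra! hle
    obtain ⟨k, hk, -, -, hm, -⟩ := h.combination b (ha.trans hlt)
    have := hm ⟨hle, hlt.le⟩ ⟨hle.trans hlt.le, le_rfl⟩ hlt.le
    simp only [h1, h2] at this
    linarith
  · by_contra! hle
    obtain ⟨k, hk, -, -, -, hm⟩ := h.combination a ha
    have := hm ⟨le_rfl, hlt.le.trans hle⟩ ⟨hlt.le, hle⟩ hlt.le
    simp only [← h1, ← h2] at this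
    linarith

/-- With the combination attached to xt, both sides are strictly decreasing. If a < a', the
ψ-equation forces b' < b, so the H-combination drops while the Q-combination rises, although the
equations equate them at both solutions. -/
theorem CrossingData.fst_le_of_solvesPair (h : CrossingData Hψ Hφ Qψ Qφ xt xh) {a b a' b' : ℝ}
    (hab : SolvesPair Hψ Hφ Qψ Qφ a b) (hab' : SolvesPair Hψ Hφ Qψ Qφ a' b') : a' ≤ a := by
  by_contra! hlt
  obtain ⟨h1, h2⟩ := h.lt_and_lt_of_solvesPair hab
  obtain ⟨h1', h2'⟩ := h.lt_and_lt_of_solvesPair hab'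
  obtain ⟨ha, -, e1, e2⟩ := hab
  obtain ⟨ha', -, e1', e2'⟩ := hab'
  obtain ⟨k, -, hQ, hH, -, -⟩ := h.combination xt h.xt_pos
  have i1 := h.Hψ_mono ⟨ha, h1.le⟩ ⟨ha', h1'.le⟩ hlt
  rw [e1, e1', h.Qψ_anti.lt_iff_gt (mem_Ici.2 h2.le) (mem_Ici.2 h2'.le)] at i1
  have i2 := hQ h.lt.le (mem_Ici.2 h2'.le) (mem_Ici.2 h2.le) i1
  have i3 := hH le_rfl ⟨ha, h1.le⟩ ⟨ha', h1'.le⟩ hlt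
  simp only [e1, e2, e1', e2'] at i2 i3
  linarith

theorem CrossingData.eq_of_solvesPair (h : CrossingData Hψ Hφ Qψ Qφ xt xh) {a b a' b' : ℝ}
    (hab : SolvesPair Hψ Hφ Qψ Qφ a b) (hab' : SolvesPair Hψ Hφ Qψ Qφ a' b') :
    a = a' ∧ b = b' := by
  have ha : a = a' := le_antisymm (h.fst_le_of_solvesPair hab' hab)
    (h.fst_le_of_solvesPair hab hab')
  refine ⟨ha, h.Qψ_anti.injOn (mem_Ici.2 (h.lt_and_lt_of_solvesPair hab).2.le)
    (mem_Ici.2 (h.lt_and_lt_of_solvesPair hab').2.le) ?_⟩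
  rw [← hab.2.2.1, ← hab'.2.2.1, ha]

theorem CrossingData.conclusion (h : CrossingData Hψ Hφ Qψ Qφ xt xh) {K : ℝ → ℝ}
    (hK : K = fixedPointMap Hψ Hφ Qψ Qφ xt xh) :
    (∃! p : ℝ × ℝ, SolvesPair Hψ Hφ Qψ Qφ p.1 p.2) ∧
    FixedPointMapWellDefined Hψ Hφ Qψ Qφ xt xh ∧
    MapsTo K (Ioc 0 xt) (Ioc 0 xt) ∧
    StrictMonoOn K (Ioc 0 xt) ∧
    ∃ a ∈ Ioc 0 xt, K a = a ∧ (∀ x ∈ Ioc 0 xt, K x = x → x = a) ∧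
      ∃ b ∈ Ici xh, b = Function.invFunOn Qψ (Ici xh) (Hψ a) ∧
        SolvesPair Hψ Hφ Qψ Qφ a b := by
  set β : ℝ → ℝ := fun x => Function.invFunOn Qψ (Ici xh) (Hψ x) with hβ
  have hKβ : ∀ x, K x = Function.invFunOn Hφ (Ioc 0 xt) (Qφ (β x)) := fun x => by
    rw [hK]; rfl
  have β_mem : ∀ x ∈ Ioc 0 xt, β x ∈ Ici xh := fun x hx =>
    Function.invFunOn_mem (h.mem_image_Qψ hx)
  have β_eq : ∀ x ∈ Ioc 0 xt, Qψ (β x) = Hψ x := fun x hx =>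
    Function.invFunOn_eq (h.mem_image_Qψ hx)
  have K_mem : ∀ x ∈ Ioc 0 xt, K x ∈ Ioc 0 xt := fun x hx => by
    rw [hKβ]; exact Function.invFunOn_mem (h.mem_image_Hφ (β_mem x hx))
  have K_eq : ∀ x ∈ Ioc 0 xt, Hφ (K x) = Qφ (β x) := fun x hx => by
    rw [hKβ]; exact Function.invFunOn_eq (h.mem_image_Hφ (β_mem x hx))
  have K_mono : StrictMonoOn K (Ioc 0 xt) := fun x hx y hy hxy => by
    have h1 := h.Hψ_mono hx hy hxy
    rw [← β_eq x hx, ← β_eq y hy, h.Qψ_anti.lt_iff_gt (β_mem x hx) (β_mem y hy)] at h1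
    have h2 := h.Qφ_mono (β_mem y hy) (β_mem x hx) h1
    rwa [← K_eq x hx, ← K_eq y hy, h.Hφ_anti.lt_iff_gt (K_mem y hy) (K_mem x hx)] at h2
  have solves : ∀ x ∈ Ioc 0 xt, K x = x → SolvesPair Hψ Hφ Qψ Qφ x (β x) := fun x hx hKx =>
    ⟨hx.1, lt_of_le_of_lt hx.2 (lt_of_lt_of_le h.lt (β_mem x hx)), (β_eq x hx).symm, by
      have := K_eq x hx
      rwa [hKx] at this⟩
  obtain ⟨a, ha, hKa⟩ : ∃ a ∈ Ioc 0 xt, K a = a := by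
    obtain ⟨b, hb, hb0⟩ := h.Qψ_nonpos
    obtain ⟨ε, hε, hε'⟩ := h.Hφ_unbdd (Qφ b)
    -- A point b with Qψ b ≤ 0 bounds β from above; this bounds Qφ ∘ β, and so keeps K away from
    -- zero.
    have hKε : ∀ x ∈ Ioc 0 xt, ε < K x := fun x hx => by
      have h1 : Qψ b < Qψ (β x) := by
        rw [β_eq x hx]; exact hb0.trans_lt (h.Hψ_pos x hx)
      rw [h.Qψ_anti.lt_iff_gt hb (β_mem x hx)] at h1
      have h2 := (h.Qφ_mono (β_mem x hx) hb h1).trans_le hε'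
      rwa [← K_eq x hx, h.Hφ_anti.lt_iff_gt (K_mem x hx) hε] at h2
    -- Knaster–Tarski argument: for an increasing map the supremum of the points with x ≤ K x is
    -- fixed, so continuity of K is not needed. The lower bound ε supplies a first member.
    set S : Set ℝ := {x | x ∈ Ioc 0 xt ∧ ε ≤ x ∧ x ≤ K x} with hS
    have hεS : ε ∈ S := ⟨hε, le_rfl, (hKε ε hε).le⟩
    have hbdd : BddAbove S := ⟨xt, fun x hx => hx.1.2⟩
    have h1 : ε ≤ sSup S := le_csSup hbdd hεS
    have h2 : sSup S ≤ xt := csSup_le ⟨ε, hεS⟩ fun x hx => hx.1.2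
    have hmem : sSup S ∈ Ioc 0 xt := ⟨lt_of_lt_of_le hε.1 h1, h2⟩
    have h3 : sSup S ≤ K (sSup S) := csSup_le ⟨ε, hεS⟩ fun x hx =>
      hx.2.2.trans (K_mono.monotoneOn hx.1 hmem (le_csSup hbdd hx))
    have h4 : K (sSup S) ∈ S := ⟨K_mem _ hmem, (hKε _ hmem).le,
      K_mono.monotoneOn hmem (K_mem _ hmem) h3⟩
    exact ⟨sSup S, hmem, le_antisymm (le_csSup hbdd h4) h3⟩
  have hsol := solves a ha hKa
  refine ⟨⟨(a, β a), hsol, fun p hp => ?_⟩, ⟨h.Hψ_mono.injOn, h.Hφ_anti.injOn, h.Qψ_anti.injOn,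
    h.Qφ_mono.injOn, fun x hx => h.mem_image_Qψ hx, fun _ _ y hy _ => h.mem_image_Hφ hy⟩,
    K_mem, K_mono, a, ha, hKa, fun x hx hKx => (h.eq_of_solvesPair (solves x hx hKx) hsol).1,
    β a, β_mem a ha, rfl, hsol⟩
  obtain ⟨h1, h2⟩ := h.eq_of_solvesPair hp hsol
  exact Prod.ext h1 h2

end FixedPoint

/-! ### The functionals `L` and `K` -/

section Functionals

variable {s m : ℝ → ℝ} {q r : ℝ} {φ v ψ u θ θ' : ℝ → ℝ} {x xs x₀ : ℝ}

/-- The derivative of the integral and that of the flux contribute opposite terms q θ φ m, so only v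
θ' survives. -/
theorem hasDerivAt_dec_functional (hN : NaturalPair s m) (hφ : DecSolution s m q φ v)
    (hθ : ∀ x, 0 < x → HasDerivAt θ (θ' x) x)
    (hi : ∀ x, 0 < x → IntegrableOn (fun y => θ y * φ y * m y) (Ioi x)) (hx : 0 < x) :
    HasDerivAt (fun x => q * (∫ y in Ioi x, θ y * φ y * m y) + v x * θ x) (v x * θ' x) x := by
  have hc : ContinuousOn θ (Ioi 0) := fun x hx => (hθ x hx).continuousAt.continuousWithinAt
  convert! ((hasDerivAt_integral_Ioi ((hc.mul hφ.continuousOn).mul hN.m_cont) hi hx).const_mul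
    q).add ((hφ.deriv_flux x hx).mul (hθ x hx)) using 1
  simp only [Pi.zero_apply, Pi.mul_apply]
  ring

theorem hasDerivAt_inc_functional (hN : NaturalPair s m) (hψ : IncSolution s m q ψ u)
    (hθ : ∀ x, 0 < x → HasDerivAt θ (θ' x) x)
    (hi : ∀ x, 0 < x → IntegrableOn (fun y => θ y * ψ y * m y) (Ioc 0 x)) (hx : 0 < x) :
    HasDerivAt (fun x => q * (∫ y in Ioc 0 x, θ y * ψ y * m y) - u x * θ x) (-(u x * θ' x)) x := by
  have hc : ContinuousOn θ (Ioi 0) := fun x hx => (hθ x hx).continuousAt.continuousWithinAt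
  convert! ((hasDerivAt_integral_Ioc ((hc.mul hψ.continuousOn).mul hN.m_cont) hi hx).const_mul
    q).sub ((hψ.deriv_flux x hx).mul (hθ x hx)) using 1
  simp only [Pi.zero_apply, Pi.mul_apply]
  ring

/-- On constants the functional vanishes, because q ∫_x^∞ φ m = -v(x); the bound compares θ with the
constant θ(x). -/
theorem dec_functional_nonpos (hN : NaturalPair s m) (hq : 0 < q) (hφ : DecSolution s m q φ v)
    (hi : IntegrableOn (fun y => θ y * φ y * m y) (Ioi x)) (hx : 0 < x)
    (h : ∀ y, x < y → θ y ≤ θ x) : q * (∫ y in Ioi x, θ y * φ y * m y) + v x * θ x ≤ 0 := by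
  have h1 : ∫ y in Ioi x, θ y * φ y * m y ≤ ∫ y in Ioi x, θ x * (φ y * m y) :=
    setIntegral_mono_on hi (Integrable.const_mul (hφ.integrableOn hN hq hx) _)
      measurableSet_Ioi fun y hy => by
        have hy0 : 0 < y := lt_trans hx hy
        rw [mul_assoc]
        exact mul_le_mul_of_nonneg_right (h y hy) (mul_pos (hφ.pos y hy0) (hN.m_pos y hy0)).le
  rw [integral_const_mul] at h1
  have h2 := mul_le_mul_of_nonneg_left h1 hq.le
  have h3 := hφ.integral_eq hN hq hx
  calc _ ≤ θ x * (q * ∫ y in Ioi x, φ y * m y) + v x * θ x := by linarith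
    _ = 0 := by rw [h3]; ring

theorem inc_functional_nonpos (hN : NaturalPair s m) (hq : 0 < q) (hψ : IncSolution s m q ψ u)
    (hi : IntegrableOn (fun y => θ y * ψ y * m y) (Ioc 0 x)) (hx : 0 < x)
    (h : ∀ y, 0 < y → y ≤ x → θ y ≤ θ x) :
    q * (∫ y in Ioc 0 x, θ y * ψ y * m y) - u x * θ x ≤ 0 := by
  have h1 : ∫ y in Ioc 0 x, θ y * ψ y * m y ≤ ∫ y in Ioc 0 x, θ x * (ψ y * m y) :=
    setIntegral_mono_on hi (Integrable.const_mul (hψ.integrableOn hN hq hx) _)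
      measurableSet_Ioc fun y hy => by
        rw [mul_assoc]
        exact mul_le_mul_of_nonneg_right (h y hy.1 hy.2)
          (mul_pos (hψ.pos y hy.1) (hN.m_pos y hy.1)).le
  rw [integral_const_mul] at h1
  have h2 := mul_le_mul_of_nonneg_left h1 hq.le
  have h3 := hψ.integral_eq hN hq hx
  calc _ ≤ θ x * (q * ∫ y in Ioc 0 x, ψ y * m y) - u x * θ x := by linarith
    _ = 0 := by rw [h3]; ring

theorem dec_functional_neg (hN : NaturalPair s m) (hq : 0 < q) (hφ : DecSolution s m q φ v)
    (hθ : ∀ x, 0 < x → HasDerivAt θ (θ' x) x)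
    (hi : ∀ x, 0 < x → IntegrableOn (fun y => θ y * φ y * m y) (Ioi x)) (hx : 0 < x)
    (h : ∀ y, x < y → θ' y < 0) : q * (∫ y in Ioi x, θ y * φ y * m y) + v x * θ x < 0 := by
  have hpos : ∀ y ∈ Ici x, 0 < y := fun y hy => lt_of_lt_of_le hx hy
  have h1 := strictMonoOn_of_hasDerivAt (convex_Ici x)
    (fun y hy => hasDerivAt_dec_functional hN hφ hθ hi (hpos y hy)) fun y hy => by
      rw [interior_Ici] at hy
      exact mul_pos_of_neg_of_neg (hφ.flux_neg y (lt_trans hx hy)) (h y hy)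
  -- Any point beyond x serves: the functional is strictly larger there than at x, and still
  -- nonpositive.
  have h2 := h1 self_mem_Ici (mem_Ici.2 (by linarith : x ≤ x + 1)) (by linarith)
  refine h2.trans_le (dec_functional_nonpos hN hq hφ (hi _ (by linarith)) (by linarith) ?_)
  have h3 := antitoneOn_of_hasDerivAt (convex_Ici x) (fun y hy => hθ y (hpos y hy)) fun y hy => by
    rw [interior_Ici] at hy
    exact (h y hy).le
  exact fun y hy => h3 (mem_Ici.2 (by linarith)) (mem_Ici.2 (by linarith)) hy.le

theorem inc_functional_neg (hN : NaturalPair s m) (hq : 0 < q) (hψ : IncSolution s m q ψ u)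
    (hθ : ∀ x, 0 < x → HasDerivAt θ (θ' x) x)
    (hi : ∀ x, 0 < x → IntegrableOn (fun y => θ y * ψ y * m y) (Ioc 0 x)) (hx : 0 < x)
    (h : ∀ y, 0 < y → y < x → 0 < θ' y) :
    q * (∫ y in Ioc 0 x, θ y * ψ y * m y) - u x * θ x < 0 := by
  have h1 := strictAntiOn_of_hasDerivAt (convex_Ioc 0 x)
    (fun y hy => hasDerivAt_inc_functional hN hψ hθ hi hy.1) fun y hy => by
      rw [interior_Ioc] at hy
      exact neg_neg_of_pos (mul_pos (hψ.flux_pos y hy.1) (h y hy.1 hy.2))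
  have hx2 : x / 2 ∈ Ioc 0 x := ⟨by linarith, by linarith⟩
  have h2 := h1 hx2 ⟨hx, le_rfl⟩ (by linarith)
  refine h2.trans_le (inc_functional_nonpos hN hq hψ (hi _ hx2.1) hx2.1 ?_)
  have h3 := monotoneOn_of_hasDerivAt (convex_Ioc 0 x) (fun y hy => hθ y hy.1) fun y hy => by
    rw [interior_Ioc] at hy
    exact (h y hy.1 hy.2).le
  exact fun y hy hy' => h3 ⟨hy, hy'.trans hx2.2⟩ hx2 hy'

/-- `θ` has derivative `θ'`, positive on `(0, xs)` and negative on `(xs, ∞)`. -/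
structure PeakAt (θ θ' : ℝ → ℝ) (xs : ℝ) : Prop where
  deriv : ∀ x, 0 < x → HasDerivAt θ (θ' x) x
  nonneg : 0 ≤ xs
  pos : ∀ x, 0 < x → x < xs → 0 < θ' x
  neg : ∀ x, xs < x → θ' x < 0

theorem PeakAt.strictMonoOn (h : PeakAt θ θ' xs) : StrictMonoOn θ (Ioc 0 xs) :=
  strictMonoOn_of_hasDerivAt (convex_Ioc 0 xs) (fun x hx => h.deriv x hx.1) fun x hx => by
    rw [interior_Ioc] at hx
    exact h.pos x hx.1 hx.2

/-- The derivative v θ' makes the functional strictly decreasing up to the peak, and from the peak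
on it is negative. So a root lies strictly before the peak and is the only sign change. -/
theorem PeakAt.dec_functional_sign (h : PeakAt θ θ' xs) (hN : NaturalPair s m) (hq : 0 < q)
    (hφ : DecSolution s m q φ v)
    (hi : ∀ x, 0 < x → IntegrableOn (fun y => θ y * φ y * m y) (Ioi x)) (hx₀ : 0 < x₀)
    (h0 : q * (∫ y in Ioi x₀, θ y * φ y * m y) + v x₀ * θ x₀ = 0) :
    x₀ < xs ∧ (∀ x, 0 < x → x < x₀ → 0 < q * (∫ y in Ioi x, θ y * φ y * m y) + v x * θ x) ∧
      ∀ x, x₀ < x → q * (∫ y in Ioi x, θ y * φ y * m y) + v x * θ x < 0 := by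
  have hneg : ∀ x, 0 < x → xs ≤ x → q * (∫ y in Ioi x, θ y * φ y * m y) + v x * θ x < 0 :=
    fun x hx hxs => dec_functional_neg hN hq hφ h.deriv hi hx fun y hy => h.neg y (by linarith)
  have hlt : x₀ < xs := by
    by_contra! hle
    have := hneg x₀ hx₀ hle
    linarith
  have hanti := strictAntiOn_of_hasDerivAt (convex_Ioc 0 xs)
    (fun y hy => hasDerivAt_dec_functional hN hφ h.deriv hi hy.1) fun y hy => by
      rw [interior_Ioc] at hy
      exact mul_neg_of_neg_of_pos (hφ.flux_neg y hy.1) (h.pos y hy.1 hy.2)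
  refine ⟨hlt, fun x hx hxx => ?_, fun x hx => ?_⟩
  · have := hanti ⟨hx, by linarith⟩ ⟨hx₀, hlt.le⟩ hxx
    simp only at this
    linarith
  · rcases le_total xs x with hle | hle
    · exact hneg x (hx₀.trans hx) hle
    · have := hanti ⟨hx₀, hlt.le⟩ ⟨hx₀.trans hx, hle⟩ hx
      simp only at this
      linarith

/-- The functional is negative up to the peak and strictly increasing afterwards. The peak cannot be
at zero: θ would then be decreasing everywhere and the functional nonnegative and strictly
increasing, which leaves no root. -/
theorem PeakAt.inc_functional_sign (h : PeakAt θ θ' xs) (hN : NaturalPair s m) (hq : 0 < q)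
    (hψ : IncSolution s m q ψ u)
    (hi : ∀ x, 0 < x → IntegrableOn (fun y => θ y * ψ y * m y) (Ioc 0 x)) (hx₀ : 0 < x₀)
    (h0 : q * (∫ y in Ioc 0 x₀, θ y * ψ y * m y) - u x₀ * θ x₀ = 0) :
    0 < xs ∧ xs < x₀ ∧
      (∀ x, 0 < x → x < x₀ → q * (∫ y in Ioc 0 x, θ y * ψ y * m y) - u x * θ x < 0) ∧
      ∀ x, x₀ < x → 0 < q * (∫ y in Ioc 0 x, θ y * ψ y * m y) - u x * θ x := by
  have hneg : ∀ x, 0 < x → x ≤ xs → q * (∫ y in Ioc 0 x, θ y * ψ y * m y) - u x * θ x < 0 :=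
    fun x hx hxs => inc_functional_neg hN hq hψ h.deriv hi hx
      fun y hy hy' => h.pos y hy (by linarith)
  have hlt : xs < x₀ := by
    by_contra! hle
    have := hneg x₀ hx₀ hle
    linarith
  have hmono := strictMonoOn_of_hasDerivAt (D := Ici xs ∩ Ioi 0)
    ((convex_Ici xs).inter (convex_Ioi 0))
    (fun y hy => hasDerivAt_inc_functional hN hψ h.deriv hi hy.2) fun y hy => by
      rw [interior_inter, interior_Ici, interior_Ioi] at hy
      exact neg_pos_of_neg (mul_neg_of_pos_of_neg (hψ.flux_pos y hy.2) (h.neg y hy.1))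
  have hxs : 0 < xs := by
    refine lt_of_le_of_ne h.nonneg fun h00 => ?_
    have h1 : AntitoneOn θ (Ioi 0) := antitoneOn_of_hasDerivAt (convex_Ioi 0) h.deriv
      fun y hy => (h.neg y (by rw [← h00]; exact interior_subset hy)).le
    have hx2 : 0 < x₀ / 2 := by linarith
    have h2 := inc_functional_nonpos (θ := fun y => - θ y) hN hq hψ
      ((hi _ hx2).neg.congr (Eventually.of_forall fun y => by
        simp only [Pi.neg_apply]; ring)) hx2
      fun y hy hy' => neg_le_neg (h1 hy hx2 hy')
    simp only [neg_mul, integral_neg] at h2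
    have h3 := hmono ⟨mem_Ici.2 (by linarith), hx2⟩ ⟨hlt.le, hx₀⟩
      (by linarith : x₀ / 2 < x₀)
    simp only at h3
    linarith
  refine ⟨hxs, hlt, fun x hx hxx => ?_, fun x hx => ?_⟩
  · rcases le_total x xs with hle | hle
    · exact hneg x hx hle
    · have := hmono ⟨hle, hx⟩ ⟨hlt.le, hx₀⟩ hxx
      simp only at this
      linarith
  · have := hmono ⟨hlt.le, hx₀⟩ ⟨(hlt.trans hx).le, hx₀.trans hx⟩ hx
    simp only at this
    linarith

end Functionals

/-! ### Derivatives of `Q` and `H` in closed form -/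

section ClosedForm

variable {s m : ℝ → ℝ} {q r : ℝ} {h η W I J θ φq vq ψq uq : ℝ → ℝ} {x : ℝ}

/-- The derivative of η / v_q and those of the two integrals share the factor q η φ_q - r v_q h, and
the remaining terms assemble into q I + v_q θ. The whole sign analysis rests on this factorisation.
-/
theorem hasDerivAt_upper (hφq : DecSolution s m q φq vq) (hh : FluxSolution s m r 0 h η)
    (hW : HasDerivAt W (-(θ x * h x * m x)) x) (hI : HasDerivAt I (-(θ x * φq x * m x)) x)
    (hx : 0 < x) :
    HasDerivAt (fun x => (r * W x - q * (η x / vq x) * I x) / (q - r))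
      (m x * (q * η x * φq x - r * vq x * h x) * (q * I x + vq x * θ x) /
        ((q - r) * vq x ^ 2)) x := by
  have hv := (hφq.flux_neg x hx).ne
  convert! ((hW.const_mul r).sub ((((hh.deriv_flux x hx).div (hφq.deriv_flux x hx) hv).const_mul
    q).mul hI)).div_const (q - r) using 1
  simp only [Pi.zero_apply, Pi.div_apply, add_zero]
  rw [mul_comm (q - r), ← div_div]
  congr 1
  field_simp
  ring

theorem hasDerivAt_lower (hψq : IncSolution s m q ψq uq) (hh : FluxSolution s m r 0 h η)
    (hW : HasDerivAt W (-(θ x * h x * m x)) x) (hJ : HasDerivAt J (θ x * ψq x * m x) x)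
    (hx : 0 < x) :
    HasDerivAt (fun x => (r * W x + q * (η x / uq x) * J x) / (q - r))
      (m x * (r * uq x * h x - q * η x * ψq x) * (q * J x - uq x * θ x) /
        ((q - r) * uq x ^ 2)) x := by
  have hv := (hψq.flux_pos x hx).ne'
  convert! ((hW.const_mul r).add ((((hh.deriv_flux x hx).div (hψq.deriv_flux x hx) hv).const_mul
    q).mul hJ)).div_const (q - r) using 1
  simp only [Pi.zero_apply, Pi.div_apply, add_zero]
  rw [mul_comm (q - r), ← div_div]
  congr 1
  field_simp
  ring

end ClosedForm

/-! ### Verification of the crossing conditions -/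

section Crossing

variable {s m : ℝ → ℝ} {r q B : ℝ} {φ ψ v u φq vq ψq uq w η θd θd' θu θu' : ℝ → ℝ}
  {δ xd xu xt xh x k : ℝ}

/-- Through the Wronskian integral, the coefficient is q - r times the functional K of ψ itself,
which is negative because ψ is increasing. -/
theorem inc_coefficient_neg (hN : NaturalPair s m) (hr : 0 < r) (hrq : r < q)
    (hψ : IncSolution s m r ψ u) (hψq : IncSolution s m q ψq uq) (hx : 0 < x) :
    r * uq x * ψ x - q * u x * ψq x < 0 := by
  have hi : ∀ x, 0 < x → IntegrableOn (fun y => ψ y * ψq y * m y) (Ioc 0 x) := fun x hx => by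
    have h := integral_wronskian_of_tendsto hrq hN.reflect.m_pos hψq.reflect
      hψ.reflect.toFluxSolution hψ.reflect.pos (wronskian_dec_tendsto hN.reflect hr (hr.trans hrq)
        hψ.reflect hψq.reflect) (inv_pos.2 hx)
    rw [reflect_mul_mul, integrableOn_Ioi_reflectDensity (inv_pos.2 hx)] at h
    simpa using h
  have h1 := inc_functional_neg hN (hr.trans hrq) hψq hψ.deriv_fun hi hx
    fun y hy _ => mul_pos (hψ.flux_pos y hy) (hN.s_pos y hy)
  have h2 := wronskian_zero_inc_integral hN hr hrq hψ hψq hx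
  have h3 := mul_neg_of_pos_of_neg (sub_pos.2 hrq) h1
  linear_combination h3 - q * h2

/-- Likewise q - r times the functional L of the decreasing function φ. -/
theorem dec_coefficient_neg (hN : NaturalPair s m) (hr : 0 < r) (hrq : r < q)
    (hφ : DecSolution s m r φ v) (hφq : DecSolution s m q φq vq) (hx : 0 < x) :
    q * v x * φq x - r * vq x * φ x < 0 := by
  have hZ := wronskian_dec_tendsto hN hr (hr.trans hrq) hφ hφq
  have h1 := dec_functional_neg hN (hr.trans hrq) hφq hφ.deriv_fun
    (fun x hx => integral_wronskian_of_tendsto hrq hN.m_pos hφq hφ.toFluxSolution hφ.pos hZ hx) hx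
    fun y hy => mul_neg_of_neg_of_pos (hφ.flux_neg y (hx.trans hy)) (hN.s_pos y (hx.trans hy))
  have h2 := integral_wronskian_of_tendsto_zero hrq hN.m_pos hφq hφ.toFluxSolution hφ.pos hZ hx
  have h3 := mul_neg_of_pos_of_neg (sub_pos.2 hrq) h1
  linear_combination h3 - q * h2

/-- The analytic content of the assumptions on the control problem. -/
structure ControlData (s m : ℝ → ℝ) (r q : ℝ) (φ ψ v u : ℝ → ℝ) (B : ℝ) (φq vq ψq uq w η : ℝ → ℝ)
    (θd θd' θu θu' : ℝ → ℝ) (δ xd xu xt xh : ℝ) : Prop where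
  natural : NaturalPair s m
  r_pos : 0 < r
  r_lt : r < q
  pair : FundamentalPair s m r φ ψ v u B
  dec : DecSolution s m q φq vq
  inc : IncSolution s m q ψq uq
  flux_id : FluxSolution s m r (fun x => - w x) (fun x => x) η
  green_w : GreenIntegrable m φ ψ w
  green_id : GreenIntegrable m φ ψ fun x => x
  w_mono : MonotoneOn w (Ioi 0)
  green_d : GreenIntegrable m φ ψ θd
  green_u : GreenIntegrable m φ ψ θu
  peak_d : PeakAt θd θd' xd
  peak_u : PeakAt θu θu' xu
  δ_pos : 0 < δ
  diff : ∀ x, 0 < x → θd x = θu x + δ * w x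
  xt_pos : 0 < xt
  lt : xt < xh
  root_u : q * (∫ y in Ioc 0 xt, θu y * ψq y * m y) - uq xt * θu xt = 0
  root_d : q * (∫ y in Ioi xh, θd y * φq y * m y) + vq xh * θd xh = 0
  nonneg_zero : ∀ᶠ x in 𝓝[>] 0, 0 ≤ θu x
  slope : 0 < xu → ∃ l c, 0 < c ∧ Tendsto θu (𝓝[>] 0) (𝓝 l) ∧ ∀ᶠ x in 𝓝[>] 0, l + c * x ≤ θu x
  atBot : Tendsto θd atTop atBot

/-- Closed form of `H(ψ_r, g_u; x)`. -/
noncomputable def lowerPsi (m : ℝ → ℝ) (r q : ℝ) (ψ u ψq uq θ : ℝ → ℝ) (x : ℝ) : ℝ :=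
  (r * (-∫ y in Ioc 0 x, θ y * ψ y * m y) +
    q * (u x / uq x) * ∫ y in Ioc 0 x, θ y * ψq y * m y) / (q - r)

/-- Closed form of `H(φ_r, g_u; x)`. -/
noncomputable def lowerPhi (m : ℝ → ℝ) (r q : ℝ) (φ v ψq uq θ : ℝ → ℝ) (x : ℝ) : ℝ :=
  (r * (∫ y in Ioi x, θ y * φ y * m y) +
    q * (v x / uq x) * ∫ y in Ioc 0 x, θ y * ψq y * m y) / (q - r)

/-- Closed form of `Q(g_d, ψ_r; x)`. -/
noncomputable def upperPsi (m : ℝ → ℝ) (r q : ℝ) (ψ u φq vq θ : ℝ → ℝ) (x : ℝ) : ℝ :=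
  (r * (-∫ y in Ioc 0 x, θ y * ψ y * m y) -
    q * (u x / vq x) * ∫ y in Ioi x, θ y * φq y * m y) / (q - r)

/-- Closed form of `Q(g_d, φ_r; x)`. -/
noncomputable def upperPhi (m : ℝ → ℝ) (r q : ℝ) (φ v φq vq θ : ℝ → ℝ) (x : ℝ) : ℝ :=
  (r * (∫ y in Ioi x, θ y * φ y * m y) -
    q * (v x / vq x) * ∫ y in Ioi x, θ y * φq y * m y) / (q - r)

namespace ControlData

variable (D : ControlData s m r q φ ψ v u B φq vq ψq uq w η θd θd' θu θu' δ xd xu xt xh)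
include D

theorem q_pos : 0 < q := D.r_pos.trans D.r_lt

theorem qr_pos : 0 < q - r := sub_pos.2 D.r_lt

theorem int_inc (x : ℝ) (hx : 0 < x) : IntegrableOn (fun y => θu y * ψq y * m y) (Ioc 0 x) :=
  integrableOn_mul_inc_of_lt D.natural D.r_pos D.r_lt D.pair D.inc D.green_u hx

theorem int_dec (x : ℝ) (hx : 0 < x) : IntegrableOn (fun y => θd y * φq y * m y) (Ioi x) :=
  integrableOn_mul_dec_of_lt D.natural D.r_pos D.r_lt D.pair D.dec D.green_d hx

theorem sign_u : 0 < xu ∧ xu < xt ∧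
      (∀ x, 0 < x → x < xt → q * (∫ y in Ioc 0 x, θu y * ψq y * m y) - uq x * θu x < 0) ∧
      ∀ x, xt < x → 0 < q * (∫ y in Ioc 0 x, θu y * ψq y * m y) - uq x * θu x :=
  D.peak_u.inc_functional_sign D.natural D.q_pos D.inc D.int_inc D.xt_pos D.root_u

theorem xh_pos : 0 < xh := D.xt_pos.trans D.lt

theorem sign_d : xh < xd ∧
      (∀ x, 0 < x → x < xh → 0 < q * (∫ y in Ioi x, θd y * φq y * m y) + vq x * θd x) ∧
      ∀ x, xh < x → q * (∫ y in Ioi x, θd y * φq y * m y) + vq x * θd x < 0 :=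
  D.peak_d.dec_functional_sign D.natural D.q_pos D.dec D.int_dec D.xh_pos D.root_d

theorem deriv_lowerPsi (hx : 0 < x) : HasDerivAt (lowerPsi m r q ψ u ψq uq θu)
    (m x * (r * uq x * ψ x - q * u x * ψq x) *
      (q * (∫ y in Ioc 0 x, θu y * ψq y * m y) - uq x * θu x) / ((q - r) * uq x ^ 2)) x :=
  hasDerivAt_lower D.inc D.pair.inc.toFluxSolution
    (D.green_u.deriv_zero D.natural D.pair hx).neg
    (hasDerivAt_integral_Ioc ((D.green_u.cont.mul D.inc.continuousOn).mul D.natural.m_cont)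
      D.int_inc hx) hx

theorem deriv_lowerPhi (hx : 0 < x) : HasDerivAt (lowerPhi m r q φ v ψq uq θu)
    (m x * (r * uq x * φ x - q * v x * ψq x) *
      (q * (∫ y in Ioc 0 x, θu y * ψq y * m y) - uq x * θu x) / ((q - r) * uq x ^ 2)) x :=
  hasDerivAt_lower D.inc D.pair.dec.toFluxSolution
    (D.green_u.deriv_top D.natural D.pair hx)
    (hasDerivAt_integral_Ioc ((D.green_u.cont.mul D.inc.continuousOn).mul D.natural.m_cont)
      D.int_inc hx) hx

theorem deriv_upperPsi (hx : 0 < x) : HasDerivAt (upperPsi m r q ψ u φq vq θd)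
    (m x * (q * u x * φq x - r * vq x * ψ x) *
      (q * (∫ y in Ioi x, θd y * φq y * m y) + vq x * θd x) / ((q - r) * vq x ^ 2)) x :=
  hasDerivAt_upper D.dec D.pair.inc.toFluxSolution
    (D.green_d.deriv_zero D.natural D.pair hx).neg
    (hasDerivAt_integral_Ioi ((D.green_d.cont.mul D.dec.continuousOn).mul D.natural.m_cont)
      D.int_dec hx) hx

theorem deriv_upperPhi (hx : 0 < x) : HasDerivAt (upperPhi m r q φ v φq vq θd)
    (m x * (q * v x * φq x - r * vq x * φ x) *
      (q * (∫ y in Ioi x, θd y * φq y * m y) + vq x * θd x) / ((q - r) * vq x ^ 2)) x :=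
  hasDerivAt_upper D.dec D.pair.dec.toFluxSolution
    (D.green_d.deriv_top D.natural D.pair hx)
    (hasDerivAt_integral_Ioi ((D.green_d.cont.mul D.dec.continuousOn).mul D.natural.m_cont)
      D.int_dec hx) hx

theorem lower_den_pos (hx : 0 < x) : 0 < (q - r) * uq x ^ 2 :=
  mul_pos D.qr_pos (pow_pos (D.inc.flux_pos x hx) 2)

theorem upper_den_pos (hx : 0 < x) : 0 < (q - r) * vq x ^ 2 :=
  mul_pos D.qr_pos (sq_pos_iff.2 (D.dec.flux_neg x hx).ne)

theorem phi_lower_coefficient_pos (hx : 0 < x) : 0 < r * uq x * φ x - q * v x * ψq x := by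
  have h1 := mul_pos (mul_pos D.r_pos (D.inc.flux_pos x hx)) (D.pair.dec.pos x hx)
  have h2 := mul_pos (mul_pos D.q_pos (neg_pos.2 (D.pair.dec.flux_neg x hx))) (D.inc.pos x hx)
  linarith

theorem psi_upper_coefficient_pos (hx : 0 < x) : 0 < q * u x * φq x - r * vq x * ψ x := by
  have h1 := mul_pos (mul_pos D.q_pos (D.pair.inc.flux_pos x hx)) (D.dec.pos x hx)
  have h2 := mul_pos (mul_pos D.r_pos (neg_pos.2 (D.dec.flux_neg x hx))) (D.pair.inc.pos x hx)
  linarith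

theorem lowerPsi_strictMonoOn : StrictMonoOn (lowerPsi m r q ψ u ψq uq θu) (Ioc 0 xt) :=
  strictMonoOn_of_hasDerivAt (convex_Ioc 0 xt) (fun x hx => D.deriv_lowerPsi hx.1) fun x hx => by
    rw [interior_Ioc] at hx
    exact div_pos (mul_pos_of_neg_of_neg (mul_neg_of_pos_of_neg (D.natural.m_pos x hx.1)
      (inc_coefficient_neg D.natural D.r_pos D.r_lt D.pair.inc D.inc hx.1))
      (D.sign_u.2.2.1 x hx.1 hx.2)) (D.lower_den_pos hx.1)

theorem lowerPhi_strictAntiOn : StrictAntiOn (lowerPhi m r q φ v ψq uq θu) (Ioc 0 xt) :=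
  strictAntiOn_of_hasDerivAt (convex_Ioc 0 xt) (fun x hx => D.deriv_lowerPhi hx.1) fun x hx => by
    rw [interior_Ioc] at hx
    exact div_neg_of_neg_of_pos (mul_neg_of_pos_of_neg (mul_pos (D.natural.m_pos x hx.1)
      (D.phi_lower_coefficient_pos hx.1)) (D.sign_u.2.2.1 x hx.1 hx.2)) (D.lower_den_pos hx.1)

theorem upperPsi_strictAntiOn : StrictAntiOn (upperPsi m r q ψ u φq vq θd) (Ici xh) :=
  strictAntiOn_of_hasDerivAt (convex_Ici xh)
    (fun x hx => D.deriv_upperPsi (lt_of_lt_of_le D.xh_pos hx)) fun x hx => by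
    rw [interior_Ici] at hx
    have hx0 : 0 < x := D.xh_pos.trans hx
    exact div_neg_of_neg_of_pos (mul_neg_of_pos_of_neg (mul_pos (D.natural.m_pos x hx0)
      (D.psi_upper_coefficient_pos hx0)) (D.sign_d.2.2 x hx)) (D.upper_den_pos hx0)

theorem upperPhi_strictMonoOn : StrictMonoOn (upperPhi m r q φ v φq vq θd) (Ici xh) :=
  strictMonoOn_of_hasDerivAt (convex_Ici xh)
    (fun x hx => D.deriv_upperPhi (lt_of_lt_of_le D.xh_pos hx)) fun x hx => by
    rw [interior_Ici] at hx
    have hx0 : 0 < x := D.xh_pos.trans hx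
    exact div_pos (mul_pos_of_neg_of_neg (mul_neg_of_pos_of_neg (D.natural.m_pos x hx0)
      (dec_coefficient_neg D.natural D.r_pos D.r_lt D.pair.dec D.dec hx0))
      (D.sign_d.2.2 x hx)) (D.upper_den_pos hx0)

theorem integral_zero_diff (hx : 0 < x) : ∫ y in Ioc 0 x, θd y * ψ y * m y =
    (∫ y in Ioc 0 x, θu y * ψ y * m y) + δ * ∫ y in Ioc 0 x, w y * ψ y * m y := by
  rw [← integral_const_mul, ← integral_add (D.green_u.int_zero x hx)
    (Integrable.const_mul (D.green_w.int_zero x hx) δ)]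
  refine setIntegral_congr_fun measurableSet_Ioc fun y hy => ?_
  simp only [D.diff y hy.1]
  ring

theorem integral_top_diff (hx : 0 < x) : ∫ y in Ioi x, θd y * φ y * m y =
    (∫ y in Ioi x, θu y * φ y * m y) + δ * ∫ y in Ioi x, w y * φ y * m y := by
  rw [← integral_const_mul, ← integral_add (D.green_u.int_top x hx)
    (Integrable.const_mul (D.green_w.int_top x hx) δ)]
  refine setIntegral_congr_fun measurableSet_Ioi fun y hy => ?_
  simp only [D.diff y (lt_trans hx hy)]
  ring

/-- At a root of the q-functional the ψ_q integral can be eliminated; what remains is an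
r-functional free of ψ_q, which makes the endpoint values at the two roots comparable. -/
theorem lowerPsi_xt : lowerPsi m r q ψ u ψq uq θu xt =
    -(r * (∫ y in Ioc 0 xt, θu y * ψ y * m y) - u xt * θu xt) / (q - r) := by
  have h := D.root_u
  have h1 := (D.inc.flux_pos xt D.xt_pos).ne'
  rw [lowerPsi]
  congr 1
  field_simp
  linear_combination (u xt) * h

theorem lowerPhi_xt : lowerPhi m r q φ v ψq uq θu xt =
    (r * (∫ y in Ioi xt, θu y * φ y * m y) + v xt * θu xt) / (q - r) := by
  have h := D.root_u
  have h1 := (D.inc.flux_pos xt D.xt_pos).ne'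
  rw [lowerPhi]
  congr 1
  field_simp
  linear_combination (v xt) * h

theorem upperPsi_xh : upperPsi m r q ψ u φq vq θd xh =
    -(r * (∫ y in Ioc 0 xh, θd y * ψ y * m y) - u xh * θd xh) / (q - r) := by
  have h := D.root_d
  have h1 := (D.dec.flux_neg xh D.xh_pos).ne
  rw [upperPsi]
  congr 1
  field_simp
  linear_combination (-u xh) * h

theorem upperPhi_xh : upperPhi m r q φ v φq vq θd xh =
    (r * (∫ y in Ioi xh, θd y * φ y * m y) + v xh * θd xh) / (q - r) := by
  have h := D.root_d
  have h1 := (D.dec.flux_neg xh D.xh_pos).ne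
  rw [upperPhi]
  congr 1
  field_simp
  linear_combination (-v xh) * h

/-- The r-functional K of θ_d decreases from xt to xh, since the peak of θ_d lies beyond xh. At xt
it exceeds that of θ_u by δ times the functional of the increasing w, which is nonpositive. -/
theorem lowerPsi_le_upperPsi :
    lowerPsi m r q ψ u ψq uq θu xt ≤ upperPsi m r q ψ u φq vq θd xh := by
  rw [D.lowerPsi_xt, D.upperPsi_xh]
  refine div_le_div_of_nonneg_right (neg_le_neg ?_) D.qr_pos.le
  have h1 := antitoneOn_of_hasDerivAt (convex_Ioc 0 xd)
    (fun y hy => hasDerivAt_inc_functional D.natural D.pair.inc D.peak_d.deriv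
      D.green_d.int_zero hy.1) fun y hy => by
      rw [interior_Ioc] at hy
      exact neg_nonpos.2 (mul_pos (D.pair.inc.flux_pos y hy.1) (D.peak_d.pos y hy.1 hy.2)).le
  have h2 := h1 ⟨D.xt_pos, (D.lt.trans D.sign_d.1).le⟩ ⟨D.xh_pos, D.sign_d.1.le⟩ D.lt.le
  have h3 := inc_functional_nonpos D.natural D.r_pos D.pair.inc (D.green_w.int_zero xt D.xt_pos)
    D.xt_pos fun y hy hy' => D.w_mono hy D.xt_pos hy'
  have h4 := D.integral_zero_diff D.xt_pos
  have h5 := D.diff xt D.xt_pos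
  simp only at h2
  rw [h4, h5] at h2
  have h6 := mul_nonpos_of_nonneg_of_nonpos D.δ_pos.le h3
  linarith

/-- Here θ_u is past its peak on [xt, xh], so its r-functional L increases from xt to xh; the
exchange of θ_u for θ_d takes place at xh, where the functional L of w is nonnegative. -/
theorem lowerPhi_le_upperPhi :
    lowerPhi m r q φ v ψq uq θu xt ≤ upperPhi m r q φ v φq vq θd xh := by
  rw [D.lowerPhi_xt, D.upperPhi_xh]
  refine div_le_div_of_nonneg_right ?_ D.qr_pos.le
  have h1 := monotoneOn_of_hasDerivAt (convex_Ici xt)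
    (fun y hy => hasDerivAt_dec_functional D.natural D.pair.dec D.peak_u.deriv
      D.green_u.int_top (lt_of_lt_of_le D.xt_pos hy)) fun y hy => by
      rw [interior_Ici] at hy
      exact (mul_pos_of_neg_of_neg (D.pair.dec.flux_neg y (D.xt_pos.trans hy))
        (D.peak_u.neg y (D.sign_u.2.1.trans hy))).le
  have h2 := h1 self_mem_Ici (mem_Ici.2 D.lt.le) D.lt.le
  have h3 := dec_functional_nonpos (θ := fun y => - w y) D.natural D.r_pos D.pair.dec
    ((D.green_w.int_top xh D.xh_pos).neg.congr (Eventually.of_forall fun y => by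
      simp only [Pi.neg_apply]; ring)) D.xh_pos
    fun y hy => neg_le_neg (D.w_mono D.xh_pos (D.xh_pos.trans hy) hy.le)
  simp only [neg_mul, integral_neg] at h3
  have h4 := D.integral_top_diff D.xh_pos
  have h5 := D.diff xh D.xh_pos
  simp only at h2
  rw [h4, h5]
  have h6 := mul_nonpos_of_nonneg_of_nonpos D.δ_pos.le h3
  linarith

/-- By monotonicity a lower bound by a vanishing quantity near zero suffices: there θ_u ≥ 0 makes
the ψ_q term nonnegative, and the ψ term tends to zero. -/
theorem lowerPsi_pos (hx : x ∈ Ioc 0 xt) : 0 < lowerPsi m r q ψ u ψq uq θu x := by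
  -- Passing through x / 2 makes the weak bound obtained from the limit strict.
  have hx2 : x / 2 ∈ Ioc 0 xt := ⟨half_pos hx.1, by linarith [hx.1, hx.2]⟩
  refine lt_of_le_of_lt ?_ (D.lowerPsi_strictMonoOn hx2 hx (half_lt_self hx.1))
  have hT : Tendsto (fun x => ∫ y in Ioc 0 x, θu y * ψ y * m y) (𝓝[>] 0) (𝓝 0) := by
    refine tendsto_of_tendsto_reflect ?_
    have : Tendsto (fun x => ∫ y in Ioi x, reflectDensity (fun y => θu y * ψ y * m y) y) atTop
      (𝓝 0) := tendsto_integral_Ioi_zero tendsto_id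
    refine this.congr' ?_
    filter_upwards [eventually_gt_atTop 0] with y hy
    rw [integral_Ioi_reflectDensity hy, reflect]
  have hlim : Tendsto (fun x => (r * (-∫ y in Ioc 0 x, θu y * ψ y * m y)) / (q - r))
      (𝓝[>] 0) (𝓝 0) := by
    simpa using (hT.neg.const_mul r).div_const (q - r)
  refine le_of_tendsto hlim ?_
  obtain ⟨ε, hε, hε'⟩ := mem_nhdsGT_iff_exists_Ioc_subset.1 D.nonneg_zero
  filter_upwards [Ioc_mem_nhdsGT hx2.1, Ioc_mem_nhdsGT (mem_Ioi.1 hε)] with y hy hyε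
  refine le_trans ?_ (D.lowerPsi_strictMonoOn.monotoneOn ⟨hy.1, hy.2.trans hx2.2⟩ hx2 hy.2)
  refine div_le_div_of_nonneg_right (le_add_of_nonneg_right ?_) D.qr_pos.le
  refine mul_nonneg (mul_nonneg D.q_pos.le (div_pos (D.pair.inc.flux_pos y hy.1)
    (D.inc.flux_pos y hy.1)).le) (setIntegral_nonneg measurableSet_Ioc fun z hz => ?_)
  exact mul_nonneg (mul_nonneg (hε' ⟨hz.1, hz.2.trans hyε.2⟩) (D.inc.pos z hz.1).le)
    (D.natural.m_pos z hz.1).le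

/-- Beyond xh the sign of L bounds (q - r) Q_ψ above by minus the r-functional K of θ_d. Past the
peak this is at most a constant plus u(xd) θ_d, since u increases and θ_d' < 0; and θ_d tends to
minus infinity. -/
theorem exists_upperPsi_nonpos : ∃ b ∈ Ici xh, upperPsi m r q ψ u φq vq θd b ≤ 0 := by
  have hxd : 0 < xd := D.xh_pos.trans D.sign_d.1
  have hanti : AntitoneOn (fun x => -(r * (∫ y in Ioc 0 x, θd y * ψ y * m y) - u x * θd x) -
      u xd * θd x) (Ici xd) := by
    refine antitoneOn_of_hasDerivAt (convex_Ici xd) (fun y hy =>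
      (hasDerivAt_inc_functional D.natural D.pair.inc D.peak_d.deriv D.green_d.int_zero
        (lt_of_lt_of_le hxd hy)).neg.sub
        ((D.peak_d.deriv y (lt_of_lt_of_le hxd hy)).const_mul _)) fun y hy => ?_
    rw [interior_Ici] at hy
    have h1 := (D.pair.inc.strictMonoOn_flux D.natural D.r_pos D.pair.inc.pos).monotoneOn hxd
      (mem_Ioi.2 (hxd.trans hy)) (le_of_lt hy)
    have h2 := mul_nonpos_of_nonneg_of_nonpos (sub_nonneg.2 h1) (D.peak_d.neg y hy).le
    linarith
  obtain ⟨b, hb, hbx⟩ := (((D.atBot.const_mul_atBot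
    (D.pair.inc.flux_pos xd hxd)).eventually_le_atBot
    (-(-(r * (∫ y in Ioc 0 xd, θd y * ψ y * m y) - u xd * θd xd) -
      u xd * θd xd))).and (eventually_ge_atTop xd)).exists
  have hb0 : 0 < b := lt_of_lt_of_le hxd hbx
  have hbh : xh < b := lt_of_lt_of_le D.sign_d.1 hbx
  have h1 := hanti self_mem_Ici hbx hbx
  simp only at h1
  refine ⟨b, hbh.le, div_nonpos_of_nonpos_of_nonneg ?_ D.qr_pos.le⟩
  have h2 := D.sign_d.2.2 b hbh
  have h3 := D.dec.flux_neg b hb0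
  have h4 := D.pair.inc.flux_pos b hb0
  have h5 : 0 ≤ u b / vq b * (q * (∫ y in Ioi b, θd y * φq y * m y) + vq b * θd b) :=
    mul_nonneg_of_nonpos_of_nonpos (div_neg_of_pos_of_neg h4 h3).le h2.le
  have h6 : u b / vq b * (vq b * θd b) = u b * θd b := by
    field_simp [h3.ne]
  rw [mul_add, h6] at h5
  linarith

theorem integral_id_unbounded {ε : ℝ} (hε : 0 < ε) (N : ℝ) :
    ∃ x₀, 0 < x₀ ∧ x₀ < ε ∧ N < ∫ y in Ioc x₀ ε, y * φ y * m y := by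
  have hcont : ContinuousOn (fun y => y * φ y * m y) (Ioi 0) :=
    (continuousOn_id.mul D.pair.dec.continuousOn).mul D.natural.m_cont
  by_contra! hle
  refine not_integrableOn_id_mul_dec D.natural D.r_pos D.pair D.flux_id D.green_w D.green_id
    D.w_mono (integrableOn_Ioc_of_continuousOn hcont hε ?_ one_pos)
  -- The denominator n + 2 keeps the points strictly below ε, even for n = 0.
  have ha : ∀ n : ℕ, 0 < ε / (n + 2) ∧ ε / (n + 2) < ε := fun n =>
    ⟨by positivity, div_lt_self hε (by have : (0 : ℝ) ≤ n := n.cast_nonneg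
                                       linarith)⟩
  refine integrableOn_Ioc_of_intervalIntegral_norm_bounded_left (l := (atTop : Filter ℕ)) (I := N)
    (a := fun n : ℕ => ε / (n + 2)) (fun n => ?_) ?_ (Eventually.of_forall fun n => ?_)
  · exact (intervalIntegrable_iff_integrableOn_Ioc_of_le (ha n).2.le).1
      (intervalIntegrable_of_continuousOn hcont (ha n).1 hε)
  · exact Tendsto.div_atTop tendsto_const_nhds
      (tendsto_atTop_add_const_right _ _ tendsto_natCast_atTop_atTop)
  · refine le_trans (le_of_eq (setIntegral_congr_fun measurableSet_Ioc fun y hy => ?_))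
      (hle _ (ha n).1 (ha n).2)
    have hy0 : 0 < y := (ha n).1.trans hy.1
    exact Real.norm_of_nonneg (mul_pos (mul_pos hy0 (D.pair.dec.pos y hy0))
      (D.natural.m_pos y hy0)).le

/-- The sign of K bounds (q - r) H_φ below by r ∫_x^∞ θ φ m + v θ. Splitting at ε turns this into r
∫_x^ε (θ(y) - θ(x)) φ m plus terms that stay bounded as x → 0. The slope condition gives θ(y) - θ(x)
≥ c y - (θ(x) - l), and ∫ y φ m diverges at zero. -/
theorem lowerPhi_unbounded (N : ℝ) : ∃ ε ∈ Ioc 0 xt, N ≤ lowerPhi m r q φ v ψq uq θu ε := by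
  obtain ⟨hxu, hxut, hsign, -⟩ := D.sign_u
  obtain ⟨l, c, hc, hl, hslope⟩ := D.slope hxu
  obtain ⟨ε₁, hε₁, hε₁'⟩ := mem_nhdsGT_iff_exists_Ioc_subset.1 hslope
  have hε₁ : 0 < ε₁ := hε₁
  set ε := min ε₁ xu with hεdef
  have hε : 0 < ε := lt_min hε₁ hxu
  have hεxu : ε ≤ xu := min_le_right _ _
  -- R is the size of ∫ y φ m that outweighs the bounded terms. The summand 1 pays for the error
  -- (θ(x) - l) r Φ, which falls below 1 once x is chosen close to zero, after x₀.
  set R := (N * (q - r) - (v ε * θu ε + r * ∫ y in Ioi ε, θu y * φ y * m y) + 1) / (r * c) with hR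
  obtain ⟨x₀, hx₀, hx₀ε, hx₀N⟩ := D.integral_id_unbounded hε R
  set Φ := ∫ y in Ioc x₀ ε, φ y * m y with hΦ
  have hlim : Tendsto (fun x => (θu x - l) * (r * Φ)) (𝓝[>] 0) (𝓝 0) := by
    simpa using (hl.sub_const l).mul_const (r * Φ)
  obtain ⟨x, hx1, hx⟩ := ((hlim.eventually (gt_mem_nhds one_pos)).and
    (Ioc_mem_nhdsGT hx₀)).exists
  have hx0 : 0 < x := hx.1
  have hxε : x < ε := lt_of_le_of_lt hx.2 hx₀ε
  have hxt : x < xt := hxε.trans_le (hεxu.trans hxut.le)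
  refine ⟨x, ⟨hx0, hxt.le⟩, ?_⟩
  rw [lowerPhi, le_div_iff₀ D.qr_pos]
  have hv := D.pair.dec.flux_neg x hx0
  have hu := D.inc.flux_pos x hx0
  -- comparison with the functional for `r`
  have h1 : v x * θu x ≤ q * (v x / uq x) * ∫ y in Ioc 0 x, θu y * ψq y * m y := by
    have h2 := mul_nonneg_of_nonpos_of_nonpos (div_neg_of_neg_of_pos hv hu).le
      (hsign x hx0 hxt).le
    have h3 : v x / uq x * (uq x * θu x) = v x * θu x := by field_simp
    rw [mul_sub, h3] at h2
    linarith
  have hsplit : ∀ F : ℝ → ℝ, IntegrableOn F (Ioi x) →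
      ∫ y in Ioi x, F y = (∫ y in Ioc x ε, F y) + ∫ y in Ioi ε, F y := fun F hF => by
    rw [← Ioc_union_Ioi_eq_Ioi hxε.le]
    exact setIntegral_union Ioc_disjoint_Ioi_same measurableSet_Ioi
      (hF.mono_set Ioc_subset_Ioi_self) (hF.mono_set (Ioi_subset_Ioi hxε.le))
  have hφx := D.pair.dec.integrableOn D.natural D.r_pos hx0
  have hθx := D.green_u.int_top x hx0
  have h4 : v x = v ε - r * ∫ y in Ioc x ε, φ y * m y := by
    have e1 := D.pair.dec.integral_eq D.natural D.r_pos hx0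
    have e2 := D.pair.dec.integral_eq D.natural D.r_pos hε
    rw [hsplit _ hφx] at e1
    linarith
  have hmono := D.peak_u.strictMonoOn.monotoneOn
  have hint1 : IntegrableOn (fun y => (θu y - θu x) * (φ y * m y)) (Ioc x ε) :=
    ((hθx.mono_set Ioc_subset_Ioi_self).sub (Integrable.const_mul
      (hφx.mono_set Ioc_subset_Ioi_self) (θu x))).congr (Eventually.of_forall fun y => by
        simp only [Pi.sub_apply]; ring)
  have h5 : ∫ y in Ioc x ε, (θu y - θu x) * (φ y * m y) =
      (∫ y in Ioc x ε, θu y * φ y * m y) - θu x * ∫ y in Ioc x ε, φ y * m y := by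
    rw [← integral_const_mul, ← integral_sub (hθx.mono_set Ioc_subset_Ioi_self)
      (Integrable.const_mul (hφx.mono_set Ioc_subset_Ioi_self) (θu x))]
    exact setIntegral_congr_fun measurableSet_Ioc fun y _ => by ring
  have hpos : ∀ y, 0 < y → 0 < φ y * m y := fun y hy =>
    mul_pos (D.pair.dec.pos y hy) (D.natural.m_pos y hy)
  have h6 : ∫ y in Ioc x₀ ε, (θu y - θu x) * (φ y * m y) ≤
      ∫ y in Ioc x ε, (θu y - θu x) * (φ y * m y) := by
    refine setIntegral_mono_set hint1 ?_ (Eventually.of_forall (Ioc_subset_Ioc_left hx.2))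
    refine (ae_restrict_iff' measurableSet_Ioc).2 (Eventually.of_forall fun y hy => ?_)
    have hy0 : 0 < y := hx0.trans hy.1
    exact mul_nonneg (sub_nonneg.2 (hmono ⟨hx0, hxε.le.trans hεxu⟩ ⟨hy0, hy.2.trans hεxu⟩ hy.1.le))
      (hpos y hy0).le
  have hsub : Ioc x₀ ε ⊆ Ioc x ε := Ioc_subset_Ioc_left hx.2
  have hφi : IntegrableOn (fun y => φ y * m y) (Ioc x₀ ε) :=
    hφx.mono_set (hsub.trans Ioc_subset_Ioi_self)
  have hidi : IntegrableOn (fun y => y * φ y * m y) (Ioc x₀ ε) :=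
    (D.green_id.int_top x hx0).mono_set (hsub.trans Ioc_subset_Ioi_self)
  have h7 : c * (∫ y in Ioc x₀ ε, y * φ y * m y) - (θu x - l) * Φ ≤
      ∫ y in Ioc x₀ ε, (θu y - θu x) * (φ y * m y) := by
    rw [hΦ, ← integral_const_mul, ← integral_const_mul,
      ← integral_sub (Integrable.const_mul hidi c) (Integrable.const_mul hφi _)]
    refine setIntegral_mono_on ((Integrable.const_mul hidi c).sub (Integrable.const_mul hφi _))
      (hint1.mono_set hsub) measurableSet_Ioc fun y hy => ?_
    have hy0 : 0 < y := hx₀.trans hy.1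
    have h8 : l + c * y ≤ θu y := hε₁' ⟨hy0, hy.2.trans (min_le_left _ _)⟩
    have h9 := mul_le_mul_of_nonneg_right h8 (hpos y hy0).le
    linarith
  have h10 : v ε * θu ε ≤ v ε * θu x :=
    mul_le_mul_of_nonpos_left (hmono ⟨hx0, hxε.le.trans hεxu⟩ ⟨hε, hεxu⟩ hxε.le)
      (D.pair.dec.flux_neg ε hε).le
  have h11 := hsplit _ hθx
  rw [hR, div_lt_iff₀ (mul_pos D.r_pos hc)] at hx₀N
  have h12 := mul_le_mul_of_nonneg_left (h7.trans (h6.trans_eq h5)) D.r_pos.le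
  have h13 : v x * θu x = v ε * θu x - r * (θu x * ∫ y in Ioc x ε, φ y * m y) := by
    rw [h4]; ring
  rw [h11]
  linarith

/-- For `h = ψ + k φ` with `h'(x₀) = 0`: signs of `H(h, g_u; ·)'` and `Q(g_d, h; ·)'`, and the
comparison at `x₀`. -/
theorem combination {x₀ : ℝ} (hx₀ : 0 < x₀) : ∃ k : ℝ,
    lowerPsi m r q ψ u ψq uq θu x₀ + k * lowerPhi m r q φ v ψq uq θu x₀ <
      upperPsi m r q ψ u φq vq θd x₀ + k * upperPhi m r q φ v φq vq θd x₀ ∧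
    (x₀ ≤ xh → StrictAntiOn (fun x => upperPsi m r q ψ u φq vq θd x +
      k * upperPhi m r q φ v φq vq θd x) (Ici xh)) ∧
    (xt ≤ x₀ → StrictAntiOn (fun x => lowerPsi m r q ψ u ψq uq θu x +
      k * lowerPhi m r q φ v ψq uq θu x) (Ioc 0 xt)) ∧
    MonotoneOn (fun x => lowerPsi m r q ψ u ψq uq θu x +
      k * lowerPhi m r q φ v ψq uq θu x) (Icc xt x₀) ∧
    MonotoneOn (fun x => upperPsi m r q ψ u φq vq θd x +
      k * upperPhi m r q φ v φq vq θd x) (Icc x₀ xh) := by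
  have hu0 := D.pair.inc.flux_pos x₀ hx₀
  have hv0 := D.pair.dec.flux_neg x₀ hx₀
  -- This k > 0 makes the scale derivative u + k v of h = ψ + k φ vanish at x₀; as u + k v is
  -- strictly increasing, h decreases before x₀ and increases after it.
  set k := u x₀ / (-v x₀) with hk
  have hkpos : 0 < k := div_pos hu0 (neg_pos.2 hv0)
  have hk0 : u x₀ + k * v x₀ = 0 := by
    rw [hk]; field_simp [hv0.ne]; ring
  have hη : StrictMonoOn (fun x => u x + k * v x) (Ioi 0) := fun x hx y hy hxy => by
    have h1 := D.pair.inc.strictMonoOn_flux D.natural D.r_pos D.pair.inc.pos hx hy hxy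
    have h2 := D.pair.dec.strictMonoOn_flux D.natural D.r_pos D.pair.dec.pos hx hy hxy
    have h3 := mul_lt_mul_of_pos_left h2 hkpos
    simp only
    linarith
  have hhpos : ∀ x, 0 < x → 0 < ψ x + k * φ x := fun x hx =>
    add_pos (D.pair.inc.pos x hx) (mul_pos hkpos (D.pair.dec.pos x hx))
  have hL : ∀ x, 0 < x → x ≤ x₀ → 0 < (r * uq x * ψ x - q * u x * ψq x) +
      k * (r * uq x * φ x - q * v x * ψq x) := fun x hx hxx => by
    have h1 := hη.monotoneOn hx hx₀ hxx
    simp only [hk0] at h1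
    have h2 := mul_pos (mul_pos D.r_pos (D.inc.flux_pos x hx)) (hhpos x hx)
    have h3 := mul_nonneg (mul_nonneg D.q_pos.le (D.inc.pos x hx).le) (neg_nonneg.2 h1)
    linarith
  have hU : ∀ x, 0 < x → x₀ ≤ x → 0 < (q * u x * φq x - r * vq x * ψ x) +
      k * (q * v x * φq x - r * vq x * φ x) := fun x hx hxx => by
    have h1 := hη.monotoneOn hx₀ hx hxx
    simp only [hk0] at h1
    have h2 := mul_pos (mul_pos D.r_pos (neg_pos.2 (D.dec.flux_neg x hx))) (hhpos x hx)
    have h3 := mul_nonneg (mul_nonneg D.q_pos.le (D.dec.pos x hx).le) h1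
    linarith
  have dL : ∀ x, 0 < x → HasDerivAt (fun x => lowerPsi m r q ψ u ψq uq θu x +
      k * lowerPhi m r q φ v ψq uq θu x) (m x * ((r * uq x * ψ x - q * u x * ψq x) +
      k * (r * uq x * φ x - q * v x * ψq x)) *
      (q * (∫ y in Ioc 0 x, θu y * ψq y * m y) - uq x * θu x) / ((q - r) * uq x ^ 2)) x :=
    fun x hx => by
      convert! (D.deriv_lowerPsi hx).add ((D.deriv_lowerPhi hx).const_mul k) using 1
      ring
  have dU : ∀ x, 0 < x → HasDerivAt (fun x => upperPsi m r q ψ u φq vq θd x +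
      k * upperPhi m r q φ v φq vq θd x) (m x * ((q * u x * φq x - r * vq x * ψ x) +
      k * (q * v x * φq x - r * vq x * φ x)) *
      (q * (∫ y in Ioi x, θd y * φq y * m y) + vq x * θd x) / ((q - r) * vq x ^ 2)) x :=
    fun x hx => by
      convert! (D.deriv_upperPsi hx).add ((D.deriv_upperPhi hx).const_mul k) using 1
      ring
  refine ⟨k, ?_, fun hle => ?_, fun hle => ?_, ?_, ?_⟩
  -- As h'(x₀) = 0, the ψ_q and φ_q integrals drop out, and the Wronskian formulas for the identity
  -- give Q - H = r δ η(x₀) h(x₀) / (q - r) > 0.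
  · have h1 := D.integral_zero_diff hx₀
    have h2 := D.integral_top_diff hx₀
    have h3 := dec_wronskian_id D.natural D.r_pos D.pair D.flux_id D.green_w D.green_id hx₀
    have h4 := inc_wronskian_id D.natural D.r_pos D.pair D.flux_id D.green_w hx₀
    have hδ : 0 < δ * (η x₀ * (ψ x₀ + k * φ x₀)) :=
      mul_pos D.δ_pos (mul_pos (flux_id_pos D.natural D.flux_id hx₀) (hhpos x₀ hx₀))
    have key : ∀ a b : ℝ, a / (q - r) + k * (b / (q - r)) = (a + k * b) / (q - r) :=
      fun a b => by ring
    rw [lowerPsi, lowerPhi, upperPsi, upperPhi, key, key, div_lt_div_iff_of_pos_right D.qr_pos, h1, h2, ← h3, ← h4]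
    have hu' : u x₀ = -(k * v x₀) := by linarith
    have h5 := mul_pos D.r_pos hδ
    have h6 : u x₀ / uq x₀ = -(k * (v x₀ / uq x₀)) := by rw [hu']; ring
    have h7 : u x₀ / vq x₀ = -(k * (v x₀ / vq x₀)) := by rw [hu']; ring
    rw [h6, h7, hu']
    linarith
  · refine strictAntiOn_of_hasDerivAt (convex_Ici xh)
      (fun x hx => dU x (lt_of_lt_of_le D.xh_pos hx)) fun x hx => ?_
    rw [interior_Ici] at hx
    have hx0 : 0 < x := D.xh_pos.trans hx
    exact div_neg_of_neg_of_pos (mul_neg_of_pos_of_neg (mul_pos (D.natural.m_pos x hx0)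
      (hU x hx0 (hle.trans (le_of_lt hx)))) (D.sign_d.2.2 x hx)) (D.upper_den_pos hx0)
  · refine strictAntiOn_of_hasDerivAt (convex_Ioc 0 xt) (fun x hx => dL x hx.1) fun x hx => ?_
    rw [interior_Ioc] at hx
    exact div_neg_of_neg_of_pos (mul_neg_of_pos_of_neg (mul_pos (D.natural.m_pos x hx.1)
      (hL x hx.1 (hx.2.le.trans hle))) (D.sign_u.2.2.1 x hx.1 hx.2)) (D.lower_den_pos hx.1)
  · refine monotoneOn_of_hasDerivAt (convex_Icc xt x₀)
      (fun x hx => dL x (lt_of_lt_of_le D.xt_pos hx.1)) fun x hx => ?_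
    rw [interior_Icc] at hx
    have hx0 : 0 < x := D.xt_pos.trans hx.1
    exact div_nonneg (mul_nonneg (mul_nonneg (D.natural.m_pos x hx0).le
      (hL x hx0 hx.2.le).le) (D.sign_u.2.2.2 x hx.1).le) (D.lower_den_pos hx0).le
  · refine monotoneOn_of_hasDerivAt (convex_Icc x₀ xh)
      (fun x hx => dU x (lt_of_lt_of_le hx₀ hx.1)) fun x hx => ?_
    rw [interior_Icc] at hx
    have hx0 : 0 < x := hx₀.trans hx.1
    exact div_nonneg (mul_nonneg (mul_nonneg (D.natural.m_pos x hx0).le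
      (hU x hx0 hx.1.le).le) (D.sign_d.2.1 x hx0 hx.2).le) (D.upper_den_pos hx0).le

theorem crossingData : CrossingData (lowerPsi m r q ψ u ψq uq θu) (lowerPhi m r q φ v ψq uq θu)
    (upperPsi m r q ψ u φq vq θd) (upperPhi m r q φ v φq vq θd) xt xh where
  xt_pos := D.xt_pos
  lt := D.lt
  Hψ_cont _ hx := (D.deriv_lowerPsi hx).continuousAt.continuousWithinAt
  Hφ_cont _ hx := (D.deriv_lowerPhi hx).continuousAt.continuousWithinAt
  Qψ_cont _ hx := (D.deriv_upperPsi hx).continuousAt.continuousWithinAt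
  Hψ_mono := D.lowerPsi_strictMonoOn
  Hφ_anti := D.lowerPhi_strictAntiOn
  Qψ_anti := D.upperPsi_strictAntiOn
  Qφ_mono := D.upperPhi_strictMonoOn
  Hψ_pos _ hx := D.lowerPsi_pos hx
  Qψ_nonpos := D.exists_upperPsi_nonpos
  ψ_le := D.lowerPsi_le_upperPsi
  Hφ_unbdd := D.lowerPhi_unbounded
  φ_le := D.lowerPhi_le_upperPhi
  combination _ hx₀ := D.combination hx₀

end ControlData

theorem CrossingData.congr {Hψ Hφ Qψ Qφ Hψ' Hφ' Qψ' Qφ' : ℝ → ℝ}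
    (h : CrossingData Hψ Hφ Qψ Qφ xt xh) (e1 : EqOn Hψ Hψ' (Ioi 0)) (e2 : EqOn Hφ Hφ' (Ioi 0))
    (e3 : EqOn Qψ Qψ' (Ioi 0)) (e4 : EqOn Qφ Qφ' (Ioi 0)) :
    CrossingData Hψ' Hφ' Qψ' Qφ' xt xh := by
  have s1 : Ioc 0 xt ⊆ Ioi 0 := fun x hx => hx.1
  have s2 : Ici xh ⊆ Ioi 0 := fun x hx => lt_of_lt_of_le h.xh_pos hx
  have hxt : xt ∈ Ioi (0 : ℝ) := h.xt_pos
  have hxh : xh ∈ Ioi (0 : ℝ) := h.xh_pos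
  refine ⟨h.xt_pos, h.lt, h.Hψ_cont.congr e1.symm, h.Hφ_cont.congr e2.symm,
    h.Qψ_cont.congr e3.symm, h.Hψ_mono.congr (e1.mono s1), h.Hφ_anti.congr (e2.mono s1),
    h.Qψ_anti.congr (e3.mono s2), h.Qφ_mono.congr (e4.mono s2), fun x hx => ?_, ?_, ?_,
    fun N => ?_, ?_, fun x₀ hx₀ => ?_⟩
  · rw [← e1 (s1 hx)]; exact h.Hψ_pos x hx
  · obtain ⟨b, hb, hb'⟩ := h.Qψ_nonpos
    exact ⟨b, hb, by rwa [← e3 (s2 hb)]⟩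
  · rw [← e1 hxt, ← e3 hxh]; exact h.ψ_le
  · obtain ⟨b, hb, hb'⟩ := h.Hφ_unbdd N
    exact ⟨b, hb, by rwa [← e2 (s1 hb)]⟩
  · rw [← e2 hxt, ← e4 hxh]; exact h.φ_le
  · obtain ⟨k, h1, h2, h3, h4, h5⟩ := h.combination x₀ hx₀
    have f1 : EqOn (fun x => Hψ x + k * Hφ x) (fun x => Hψ' x + k * Hφ' x) (Ioi 0) :=
      fun x hx => by simp only [e1 hx, e2 hx]
    have f2 : EqOn (fun x => Qψ x + k * Qφ x) (fun x => Qψ' x + k * Qφ' x) (Ioi 0) :=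
      fun x hx => by simp only [e3 hx, e4 hx]
    have g1 := f1 hx₀
    have g2 := f2 hx₀
    simp only at g1 g2
    refine ⟨k, by rwa [← g1, ← g2], fun hle => (h2 hle).congr (f2.mono s2),
      fun hle => (h3 hle).congr (f1.mono s1),
      h4.congr (f1.mono fun x hx => lt_of_lt_of_le h.xt_pos hx.1),
      h5.congr (f2.mono fun x hx => lt_of_lt_of_le hx₀ hx.1)⟩

end Crossing

/-! ### Scale and speed densities of a diffusion -/

section Densities

variable {s m μ σ f : ℝ → ℝ} {q x : ℝ}

theorem lintegral_Ioc_of_hasDerivAt {M : ℝ → ℝ} (hm : ∀ x, 0 < x → 0 < m x)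
    (hmc : ContinuousOn m (Ioi 0)) (hM' : ∀ x, 0 < x → HasDerivAt M (m x) x) {a b : ℝ} (ha : 0 < a)
    (hab : a ≤ b) : ∫⁻ y in Ioc a b, ENNReal.ofReal (m y) = ENNReal.ofReal (M b - M a) := by
  have hi := intervalIntegrable_of_continuousOn hmc ha (ha.trans_le hab)
  rw [← ofReal_integral_eq_lintegral_ofReal
    ((intervalIntegrable_iff_integrableOn_Ioc_of_le hab).1 hi)
    ((ae_restrict_iff' measurableSet_Ioc).2 (Eventually.of_forall fun y hy =>
      (hm y (ha.trans hy.1)).le)), ← intervalIntegral.integral_of_le hab,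
    intervalIntegral.integral_eq_sub_of_hasDerivAt (fun y hy => hM' y ?_) hi]
  rw [uIcc_of_le hab] at hy
  exact ha.trans_le hy.1

/-- The primitive E is increasing on [1, ∞); were it bounded, its derivative would be integrable
there, against the infinite iterated integral. -/
theorem divergesAtTop_of_lintegral (hs : ∀ x, 0 < x → 0 < s x) (hm : ∀ x, 0 < x → 0 < m x)
    (hmc : ContinuousOn m (Ioi 0))
    (h : (∫⁻ z in Ioi (1 : ℝ), ENNReal.ofReal (s z) * ∫⁻ y in Ioc 1 z, ENNReal.ofReal (m y)) = ⊤) :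
    DivergesAtTop s m := by
  intro M E hM hM' hE'
  have h0 : ∀ x, 1 ≤ x → 0 ≤ s x * M x := fun x hx =>
    mul_nonneg (hs x (pos_of_mem_Ici_one hx)).le (primitive_nonneg hm hM hM' hx)
  have hmono : MonotoneOn E (Ici 1) := monotoneOn_of_hasDerivAt (convex_Ici 1)
    (fun x hx => hE' x (pos_of_mem_Ici_one hx)) fun x hx => h0 x (interior_subset hx)
  by_cases hb : ∃ C, ∀ x, 1 ≤ x → E x ≤ C
  · exfalso
    obtain ⟨C, hC⟩ := hb
    obtain ⟨l, hl, -⟩ := exists_tendsto_atTop_of_monotoneOn hmono hC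
    have hi := integrableOn_Ioi_deriv_of_nonneg' (a := 1)
      (fun x hx => hE' x (pos_of_mem_Ici_one hx)) (fun x hx => h0 x (le_of_lt hx)) hl
    refine hi.lintegral_lt_top.ne ?_
    rw [← h]
    refine setLIntegral_congr_fun measurableSet_Ioi fun z hz => ?_
    have hz1 : (1 : ℝ) ≤ z := le_of_lt hz
    rw [lintegral_Ioc_of_hasDerivAt hm hmc hM' one_pos hz1, hM, sub_zero,
      ENNReal.ofReal_mul (hs z (pos_of_mem_Ici_one hz1)).le]
  · push Not at hb
    refine tendsto_atTop.2 fun C => ?_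
    obtain ⟨x, hx, hxC⟩ := hb C
    filter_upwards [eventually_ge_atTop x] with y hy
    exact hxC.le.trans (hmono hx (mem_Ici.2 (hx.trans hy)) hy)

/-- Below 1 both M and the derivative of E are nonpositive, so E can only diverge to plus infinity
at zero; reflection reduces this to the increasing case at infinity. -/
theorem divergesAtZero_of_lintegral (hs : ∀ x, 0 < x → 0 < s x) (hm : ∀ x, 0 < x → 0 < m x)
    (hmc : ContinuousOn m (Ioi 0))
    (h : (∫⁻ z in Ioc (0 : ℝ) 1, ENNReal.ofReal (s z) *
      ∫⁻ y in Ioc z 1, ENNReal.ofReal (m y)) = ⊤) : DivergesAtZero s m := by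
  intro M E hM hM' hE'
  have hMmono : MonotoneOn M (Ioi 0) := monotoneOn_of_hasDerivAt (convex_Ioi 0) hM'
    fun x hx => (hm x (interior_subset hx)).le
  have h0 : ∀ x, 0 < x → x ≤ 1 → s x * M x ≤ 0 := fun x hx hx1 =>
    mul_nonpos_of_nonneg_of_nonpos (hs x hx).le (hM ▸ hMmono hx (mem_Ioi.2 one_pos) hx1)
  have hderiv : ∀ x, 0 < x → HasDerivAt (reflect E) (reflectDensity (fun y => -(s y * M y)) x) x :=
    fun x hx => by
      convert! hasDerivAt_reflect hx (hE' _ (inv_pos.2 hx)) using 1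
      simp only [reflectDensity]; ring
  have h1 : ∀ x, 1 ≤ x → 0 ≤ reflectDensity (fun y => -(s y * M y)) x := fun x hx =>
    mul_nonneg (neg_nonneg.2 (h0 _ (inv_pos.2 (pos_of_mem_Ici_one hx)) (inv_le_one_of_one_le₀ hx)))
      (inv_nonneg.2 (sq_nonneg x))
  have hmono : MonotoneOn (reflect E) (Ici 1) := monotoneOn_of_hasDerivAt (convex_Ici 1)
    (fun x hx => hderiv x (pos_of_mem_Ici_one hx)) fun x hx => h1 x (interior_subset hx)
  refine tendsto_of_tendsto_reflect ?_
  by_cases hb : ∃ C, ∀ x, 1 ≤ x → reflect E x ≤ C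
  · exfalso
    obtain ⟨C, hC⟩ := hb
    obtain ⟨l, hl, -⟩ := exists_tendsto_atTop_of_monotoneOn hmono hC
    have hi := integrableOn_Ioi_deriv_of_nonneg' (a := 1)
      (fun x hx => hderiv x (pos_of_mem_Ici_one hx)) (fun x hx => h1 x (le_of_lt hx)) hl
    rw [integrableOn_Ioi_reflectDensity one_pos, inv_one] at hi
    refine hi.lintegral_lt_top.ne ?_
    rw [← h]
    refine setLIntegral_congr_fun measurableSet_Ioc fun z hz => ?_
    rw [lintegral_Ioc_of_hasDerivAt hm hmc hM' hz.1 hz.2, hM, zero_sub,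
      ← ENNReal.ofReal_mul (hs z hz.1).le, mul_neg]
  · push Not at hb
    refine tendsto_atTop.2 fun C => ?_
    obtain ⟨x, hx, hxC⟩ := hb C
    filter_upwards [eventually_ge_atTop x] with y hy
    exact hxC.le.trans (hmono hx (mem_Ici.2 (hx.trans hy)) hy)

theorem scaleDensity_pos (x : ℝ) : 0 < scaleDensity μ σ x := Real.exp_pos _

variable (hμ : ContinuousOn μ (Ioi 0)) (hσ : ContinuousOn σ (Ioi 0)) (hσ0 : ∀ x, 0 < x → 0 < σ x)

include hσ0 in
theorem speedDensity_pos (hx : 0 < x) : 0 < speedDensity μ σ x :=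
  div_pos two_pos (mul_pos (pow_pos (hσ0 x hx) 2) (scaleDensity_pos x))

include hμ hσ hσ0

theorem hasDerivAt_scaleDensity (hx : 0 < x) :
    HasDerivAt (scaleDensity μ σ) (-(2 * μ x / σ x ^ 2) * scaleDensity μ σ x) x := by
  have hc : ContinuousOn (fun z => 2 * μ z / σ z ^ 2) (Ioi 0) :=
    (continuousOn_const.mul hμ).div (hσ.pow 2) fun z hz => pow_ne_zero 2 (hσ0 z hz).ne'
  convert! (hasDerivAt_integral_of_continuousOn hc one_pos hx).neg.exp using 1
  simp only [scaleDensity, Pi.neg_apply]; ring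

theorem continuousOn_scaleDensity : ContinuousOn (scaleDensity μ σ) (Ioi 0) :=
  fun _ hx => (hasDerivAt_scaleDensity hμ hσ hσ0 hx).continuousAt.continuousWithinAt

theorem continuousOn_speedDensity : ContinuousOn (speedDensity μ σ) (Ioi 0) :=
  continuousOn_const.div ((hσ.pow 2).mul (continuousOn_scaleDensity hμ hσ hσ0)) fun z hz =>
    (mul_pos (pow_pos (hσ0 z hz) 2) (scaleDensity_pos z)).ne'

theorem naturalPair (h0 : IsNaturalZero μ σ) (h1 : IsNaturalInfty μ σ) :
    NaturalPair (scaleDensity μ σ) (speedDensity μ σ) where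
  s_pos x _ := scaleDensity_pos x
  m_pos _ hx := speedDensity_pos hσ0 hx
  s_cont := continuousOn_scaleDensity hμ hσ hσ0
  m_cont := continuousOn_speedDensity hμ hσ hσ0
  exit_top := divergesAtTop_of_lintegral (fun x _ => scaleDensity_pos x)
    (fun _ hx => speedDensity_pos hσ0 hx) (continuousOn_speedDensity hμ hσ hσ0) h1.1
  entrance_top := divergesAtTop_of_lintegral (fun _ hx => speedDensity_pos hσ0 hx)
    (fun x _ => scaleDensity_pos x) (continuousOn_scaleDensity hμ hσ hσ0) h1.2
  exit_zero := divergesAtZero_of_lintegral (fun x _ => scaleDensity_pos x)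
    (fun _ hx => speedDensity_pos hσ0 hx) (continuousOn_speedDensity hμ hσ hσ0) h0.1
  entrance_zero := divergesAtZero_of_lintegral (fun _ hx => speedDensity_pos hσ0 hx)
    (fun x _ => scaleDensity_pos x) (continuousOn_scaleDensity hμ hσ hσ0) h0.2

/-- Feller's form of the generator: the logarithmic derivative -2 μ / σ² of the scale density
absorbs the drift. -/
theorem hasDerivAt_flux {f' : ℝ → ℝ} {f'' : ℝ} (hf' : HasDerivAt f' f'' x) (hx : 0 < x) :
    HasDerivAt (fun x => f' x / scaleDensity μ σ x)
      ((μ x * f' x + 1 / 2 * σ x ^ 2 * f'') * speedDensity μ σ x) x := by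
  have h1 := (scaleDensity_pos (μ := μ) (σ := σ) x).ne'
  have h2 := (hσ0 x hx).ne'
  convert! hf'.div (hasDerivAt_scaleDensity hμ hσ hσ0 hx) h1 using 1
  rw [speedDensity]
  field_simp
  ring

theorem fluxSolution_of_contDiffOn {ρ : ℝ → ℝ} (hf : ContDiffOn ℝ 2 f (Ioi 0))
    (hode : ∀ x, 0 < x → generator μ σ f x = q * f x + ρ x) :
    FluxSolution (scaleDensity μ σ) (speedDensity μ σ) q ρ f
      (fun x => deriv f x / scaleDensity μ σ x) where
  deriv_fun x hx := by
    rw [div_mul_cancel₀ _ (scaleDensity_pos x).ne']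
    exact ((hf.differentiableOn (by norm_num)).differentiableAt (Ioi_mem_nhds hx)).hasDerivAt
  deriv_flux x hx := by
    rw [← hode x hx]
    have h1 : ContDiffOn ℝ 1 (deriv f) (Ioi 0) :=
      ((contDiffOn_succ_iff_deriv_of_isOpen (n := 1) isOpen_Ioi).1 hf).2.2
    exact hasDerivAt_flux hμ hσ hσ0
      ((h1.differentiableOn (by norm_num)).differentiableAt (Ioi_mem_nhds hx)).hasDerivAt hx

theorem incSolution_of_isPsi (hN : NaturalPair (scaleDensity μ σ) (speedDensity μ σ)) (hq : 0 < q)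
    (hf : IsPsi μ σ q f) : IncSolution (scaleDensity μ σ) (speedDensity μ σ) q f
      (fun x => deriv f x / scaleDensity μ σ x) := by
  have h := fluxSolution_of_contDiffOn (ρ := 0) (q := q) hμ hσ hσ0 hf.1.contDiffOn
    fun x hx => by simpa using sub_eq_zero.1 (hf.1.ode x hx)
  refine ⟨h, hf.1.pos, fun x hx => ?_⟩
  -- Strict monotonicity of f only gives f' ≥ 0; comparison with x / 2 through the strictly
  -- increasing flux makes it strict.
  have h1 := h.strictMonoOn_flux hN hq hf.1.pos (mem_Ioi.2 (half_pos hx)) hx (half_lt_self hx)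
  refine lt_of_le_of_lt (div_nonneg ?_ (scaleDensity_pos _).le) h1
  have h2 : deriv f (x / 2) = derivWithin f (Ioi 0) (x / 2) :=
    (derivWithin_of_isOpen isOpen_Ioi (half_pos hx)).symm
  rw [h2]
  exact hf.2.monotoneOn.derivWithin_nonneg

theorem decSolution_of_isPhi (hN : NaturalPair (scaleDensity μ σ) (speedDensity μ σ)) (hq : 0 < q)
    (hf : IsPhi μ σ q f) : DecSolution (scaleDensity μ σ) (speedDensity μ σ) q f
      (fun x => deriv f x / scaleDensity μ σ x) := by
  have h := fluxSolution_of_contDiffOn (ρ := 0) (q := q) hμ hσ hσ0 hf.1.contDiffOn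
    fun x hx => by simpa using sub_eq_zero.1 (hf.1.ode x hx)
  refine ⟨h, hf.1.pos, fun x hx => ?_⟩
  have hx2 : 0 < x + 1 := by linarith
  have h1 := h.strictMonoOn_flux hN hq hf.1.pos hx (mem_Ioi.2 hx2) (by linarith)
  refine lt_of_lt_of_le h1 (div_nonpos_of_nonpos_of_nonneg ?_ (scaleDensity_pos _).le)
  have h2 : deriv f (x + 1) = derivWithin f (Ioi 0) (x + 1) :=
    (derivWithin_of_isOpen isOpen_Ioi hx2).symm
  rw [h2]
  exact hf.2.antitoneOn.derivWithin_nonpos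

theorem fluxSolution_id (r : ℝ) : FluxSolution (scaleDensity μ σ) (speedDensity μ σ) r
    (fun x => -(r * x - μ x)) (fun x => x) (fun x => 1 / scaleDensity μ σ x) where
  deriv_fun x _ := by
    rw [div_mul_cancel₀ _ (scaleDensity_pos x).ne']
    exact hasDerivAt_id' x
  deriv_flux x hx := by
    convert! hasDerivAt_flux hμ hσ hσ0 (hasDerivAt_const x (1 : ℝ)) hx using 1
    ring

end Densities

/-! ### The discounted occupation measure -/

/-- The measure `e^{-rs} ds` on `(0, ∞)`. -/
noncomputable def discountMeasure (r : ℝ) : Measure ℝ :=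
  (volume.restrict (Ioi 0)).withDensity fun s => ENNReal.ofReal (Real.exp (-r * s))

/-- The measure `A ↦ E_x ∫_0^∞ e^{-rs} 1_A(X_s) ds`. -/
noncomputable def occupationMeasure {Ω : Type*} {mΩ : MeasurableSpace Ω} (P : ℝ → Measure Ω)
    (X : ℝ≥0 → Ω → ℝ) (r x : ℝ) : Measure ℝ :=
  Measure.map (fun p : ℝ × Ω => X p.1.toNNReal p.2) ((discountMeasure r).prod (P x))

theorem isFiniteMeasure_discountMeasure {r : ℝ} (hr : 0 < r) :
    IsFiniteMeasure (discountMeasure r) :=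
  isFiniteMeasure_withDensity_ofReal (exp_neg_integrableOn_Ioi 0 hr).2

theorem integral_discountMeasure (r : ℝ) (F : ℝ → ℝ) :
    ∫ s, F s ∂(discountMeasure r) = ∫ s in Ioi (0 : ℝ), Real.exp (-r * s) * F s := by
  rw [discountMeasure, integral_withDensity_eq_integral_toReal_smul (by fun_prop) (by simp)]
  simp only [ENNReal.toReal_ofReal (Real.exp_pos _).le, smul_eq_mul]

section Occupation

variable {Ω : Type*} {mΩ : MeasurableSpace Ω} {μ σ : ℝ → ℝ} {ℱ : Filtration ℝ≥0 mΩ}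
  {P : ℝ → Measure Ω} {X : ℝ≥0 → Ω → ℝ} {r x : ℝ}

theorem IsDiffusion.measurable (hX : IsDiffusion μ σ ℱ P X) (t : ℝ≥0) : Measurable (X t) :=
  (hX.adapted t).mono (ℱ.le t) le_rfl

theorem IsDiffusion.measurable_uncurry (hX : IsDiffusion μ σ ℱ P X) :
    Measurable (fun p : ℝ × Ω => X p.1.toNNReal p.2) :=
  measurable_uncurry_of_continuous_of_measurable (u := fun (s : ℝ) ω => X s.toNNReal ω)
    (fun ω => (hX.continuous_path ω).comp continuous_real_toNNReal) fun _ => hX.measurable _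

theorem occupationMeasure_restrict (hX : IsDiffusion μ σ ℱ P X) :
    (occupationMeasure P X r x).restrict (Ioi 0) = occupationMeasure P X r x := by
  refine Measure.restrict_eq_self_of_ae_mem ?_
  rw [occupationMeasure]
  exact (ae_map_iff hX.measurable_uncurry.aemeasurable measurableSet_Ioi).2
    (Eventually.of_forall fun p => hX.path_pos _ _)

theorem ae_pos_occupationMeasure (hX : IsDiffusion μ σ ℱ P X) :
    ∀ᵐ y ∂(occupationMeasure P X r x), 0 < y := by
  rw [← occupationMeasure_restrict hX]
  exact ae_restrict_mem measurableSet_Ioi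

variable (hX : IsDiffusion μ σ ℱ P X) (hr : 0 < r) (hx : 0 < x)
include hX hr hx

theorem isFiniteMeasure_occupationMeasure : IsFiniteMeasure (occupationMeasure P X r x) := by
  have := isFiniteMeasure_discountMeasure hr
  have := hX.isProbabilityMeasure x hx
  exact Measure.isFiniteMeasure_map _ _

theorem lintegral_occupationMeasure {F : ℝ → ℝ≥0∞} (hF : Measurable F) :
    ∫⁻ y, F y ∂(occupationMeasure P X r x) =
      ∫⁻ ω, (∫⁻ s in Ioi (0 : ℝ), ENNReal.ofReal (Real.exp (-r * s)) * F (X s.toNNReal ω))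
        ∂(P x) := by
  have := isFiniteMeasure_discountMeasure hr
  have := hX.isProbabilityMeasure x hx
  have hm := hX.measurable_uncurry
  rw [occupationMeasure, lintegral_map hF hm, lintegral_prod_symm _
    (show Measurable fun p : ℝ × Ω => F (X p.1.toNNReal p.2) from hF.comp hm).aemeasurable]
  refine lintegral_congr fun ω => ?_
  rw [discountMeasure, lintegral_withDensity_eq_lintegral_mul _ (by fun_prop)]
  · rfl
  · exact hF.comp (hm.comp measurable_prodMk_right)

theorem integral_occupationMeasure {f : ℝ → ℝ} (hf : Integrable f (occupationMeasure P X r x)) :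
    ∫ y, f y ∂(occupationMeasure P X r x) = resolvent P X r f x := by
  have := isFiniteMeasure_discountMeasure hr
  have := hX.isProbabilityMeasure x hx
  have hm := hX.measurable_uncurry
  rw [occupationMeasure, integral_map hm.aemeasurable hf.1, integral_prod_symm]
  · simp only [integral_discountMeasure, resolvent]
  · exact (integrable_map_measure hf.1 hm.aemeasurable).1 hf

theorem integral_occupationMeasure_swap {f : ℝ → ℝ}
    (hf : Integrable f (occupationMeasure P X r x)) :
    ∫ y, f y ∂(occupationMeasure P X r x) =
      ∫ s in Ioi (0 : ℝ), Real.exp (-r * s) * ∫ ω, f (X s.toNNReal ω) ∂(P x) := by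
  have := isFiniteMeasure_discountMeasure hr
  have := hX.isProbabilityMeasure x hx
  have hm := hX.measurable_uncurry
  rw [occupationMeasure, integral_map hm.aemeasurable hf.1, integral_prod]
  · rw [integral_discountMeasure]
  · exact (integrable_map_measure hf.1 hm.aemeasurable).1 hf

theorem lintegral_abs_lt_top_of_memL1 {f : ℝ → ℝ} (hf : ContinuousOn f (Ioi 0))
    (h : MemL1 P X r f) : ∫⁻ y, ENNReal.ofReal |f y| ∂(occupationMeasure P X r x) < ⊤ := by
  -- Continuity of f is known only on (0, ∞). The extension by zero is Borel on the whole line and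
  -- agrees with f almost everywhere for the occupation measure.
  set g : ℝ → ℝ := (Ioi 0).indicator f with hg
  have hgm : Measurable g := by
    rw [hg, ← piecewise_eq_indicator]
    exact hf.measurable_piecewise continuousOn_const measurableSet_Ioi
  have h1 : ∫⁻ y, ENNReal.ofReal |f y| ∂(occupationMeasure P X r x) =
      ∫⁻ y, ENNReal.ofReal |g y| ∂(occupationMeasure P X r x) := by
    refine lintegral_congr_ae ?_
    filter_upwards [ae_pos_occupationMeasure hX] with y hy
    rw [hg, indicator_of_mem (mem_Ioi.2 hy)]
  rw [h1, lintegral_occupationMeasure hX hr hx (by fun_prop)]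
  refine lt_of_eq_of_lt (lintegral_congr fun ω => ?_) (h x hx)
  refine lintegral_congr fun s => ?_
  rw [hg, indicator_of_mem (mem_Ioi.2 (hX.path_pos _ _)), ENNReal.ofReal_mul (Real.exp_pos _).le]

end Occupation

/-! ### Test functions -/

section TestFunction

variable {Ω : Type*} {mΩ : MeasurableSpace Ω} {μ σ : ℝ → ℝ} {ℱ : Filtration ℝ≥0 mΩ}
  {P : ℝ → Measure Ω} {X : ℝ≥0 → Ω → ℝ} {r x : ℝ} {f : ℝ → ℝ}

theorem generator_eq_zero_of_notMem_tsupport (hx : x ∉ tsupport f) : generator μ σ f x = 0 := by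
  have h0 : f =ᶠ[𝓝 x] fun _ => 0 := notMem_tsupport_iff_eventuallyEq.1 hx
  have h1 : deriv f =ᶠ[𝓝 x] fun _ => 0 := by
    filter_upwards [h0.eventuallyEq_nhds] with y hy
    rw [hy.deriv_eq, deriv_const]
  rw [generator, h1.deriv_eq, h1.eq_of_nhds]
  simp

theorem continuous_generator (hμ : ContinuousOn μ (Ioi 0)) (hσ : ContinuousOn σ (Ioi 0))
    (hf : ContDiff ℝ 2 f) (hsupp : tsupport f ⊆ Ioi 0) : Continuous (generator μ σ f) := by
  have h1 : Continuous (deriv f) := hf.continuous_deriv (by norm_num)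
  have h2 : Continuous (deriv (deriv f)) := by
    have : ContDiff ℝ 1 (deriv f) := ((contDiff_succ_iff_deriv (n := 1)).1 hf).2.2
    exact this.continuous_deriv le_rfl
  refine continuous_iff_continuousAt.2 fun y => ?_
  by_cases hy : y ∈ tsupport f
  · have hy0 : 0 < y := hsupp hy
    have c1 := continuousAt_of_continuousOn hμ hy0
    have c2 := continuousAt_of_continuousOn hσ hy0
    exact (c1.mul h1.continuousAt).add ((continuousAt_const.mul (c2.pow 2)).mul h2.continuousAt)
  · have hev : generator μ σ f =ᶠ[𝓝 y] fun _ => 0 := by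
      filter_upwards [(isClosed_tsupport f).isOpen_compl.mem_nhds hy] with z hz
      exact generator_eq_zero_of_notMem_tsupport hz
    exact continuousAt_const.congr hev.symm

theorem hasCompactSupport_generator (hf : HasCompactSupport f) :
    HasCompactSupport (generator μ σ f) :=
  HasCompactSupport.intro hf fun _ hx => generator_eq_zero_of_notMem_tsupport hx

theorem integrable_comp_of_continuous {ν : Measure Ω} [IsFiniteMeasure ν] {Y : Ω → ℝ}
    (hY : Measurable Y) (hf : Continuous f) (hs : HasCompactSupport f) :
    Integrable (fun ω => f (Y ω)) ν := by
  obtain ⟨C, hC⟩ := hs.exists_bound_of_continuous hf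
  exact Integrable.of_bound (hf.measurable.comp hY).aestronglyMeasurable C
    (Eventually.of_forall fun ω => hC _)

theorem continuous_expectation [IsFiniteMeasure (P x)] (hX : IsDiffusion μ σ ℱ P X)
    (hf : Continuous f) (hs : HasCompactSupport f) :
    Continuous fun s : ℝ => ∫ ω, f (X s.toNNReal ω) ∂(P x) := by
  obtain ⟨C, hC⟩ := hs.exists_bound_of_continuous hf
  refine continuous_of_dominated (bound := fun _ => C)
    (fun s => (hf.measurable.comp (hX.measurable _)).aestronglyMeasurable)
    (fun s => Eventually.of_forall fun ω => hC _) (integrable_const C)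
    (Eventually.of_forall fun ω => hf.comp
      ((hX.continuous_path ω).comp continuous_real_toNNReal))

/-- Dynkin's formula for test functions. -/
theorem IsDiffusion.expectation_eq (hX : IsDiffusion μ σ ℱ P X) (hx : 0 < x)
    (hf : ContDiff ℝ 2 f) (hs : HasCompactSupport f) (hsupp : tsupport f ⊆ Ioi 0) {t : ℝ}
    (ht : 0 ≤ t) : ∫ ω, f (X t.toNNReal ω) ∂(P x) =
      f x + ∫ s in (0 : ℝ)..t, ∫ ω, generator μ σ f (X s.toNNReal ω) ∂(P x) := by
  have := hX.isProbabilityMeasure x hx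
  have hgc := continuous_generator hX.differentiableOn_drift.continuousOn hX.continuousOn_vol
    hf hsupp
  have hgs : HasCompactSupport (generator μ σ f) := hasCompactSupport_generator hs
  have hM := hX.martingale x hx f hf hs hsupp
  have h1 := hM.setIntegral_eq (zero_le : (0 : ℝ≥0) ≤ t.toNNReal) (MeasurableSet.univ (α := Ω))
  simp only [setIntegral_univ, NNReal.coe_zero, intervalIntegral.integral_same, sub_zero,
    Real.coe_toNNReal t ht] at h1
  have h2 : ∫ ω, f (X 0 ω) ∂(P x) = f x := by
    have : (fun ω => f (X 0 ω)) =ᵐ[P x] fun _ => f x := by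
      filter_upwards [hX.initial x hx] with ω hω
      rw [hω]
    rw [integral_congr_ae this]
    simp
  obtain ⟨C, hC⟩ := hgs.exists_bound_of_continuous hgc
  have hprod : Integrable (fun p : Ω × ℝ => generator μ σ f (X p.2.toNNReal p.1))
      ((P x).prod (volume.restrict (Ioc 0 t))) :=
    Integrable.of_bound (hgc.measurable.comp
      (hX.measurable_uncurry.comp measurable_swap)).aestronglyMeasurable C
      (Eventually.of_forall fun p => hC _)
  have hint : Integrable (fun ω => ∫ s in (0 : ℝ)..t, generator μ σ f (X s.toNNReal ω)) (P x) := by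
    simp only [intervalIntegral.integral_of_le ht]
    exact hprod.integral_prod_left
  rw [integral_sub (integrable_comp_of_continuous (hX.measurable _) hf.continuous hs) hint, h2]
    at h1
  have h3 : ∫ ω, (∫ s in (0 : ℝ)..t, generator μ σ f (X s.toNNReal ω)) ∂(P x) =
      ∫ s in (0 : ℝ)..t, ∫ ω, generator μ σ f (X s.toNNReal ω) ∂(P x) := by
    simp only [intervalIntegral.integral_of_le ht]
    exact integral_integral_swap hprod
  rw [h3] at h1
  linarith

/-- The Laplace transform in time of Dynkin's formula: with A(t) = E_x f(X_t) and b = A', the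
integrand e^{-rt} (r A - b) is the derivative of -e^{-rt} A, so only the boundary value A(0) = f(x)
remains. -/
theorem integral_test_eq (hX : IsDiffusion μ σ ℱ P X) (hr : 0 < r) (hx : 0 < x)
    (hf : ContDiff ℝ 2 f) (hs : HasCompactSupport f) (hsupp : tsupport f ⊆ Ioi 0) :
    ∫ y, (r * f y - generator μ σ f y) ∂(occupationMeasure P X r x) = f x := by
  have := hX.isProbabilityMeasure x hx
  have := isFiniteMeasure_occupationMeasure hX hr hx
  have hgc := continuous_generator hX.differentiableOn_drift.continuousOn hX.continuousOn_vol
    hf hsupp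
  have hgs : HasCompactSupport (generator μ σ f) := hasCompactSupport_generator hs
  have hFc : Continuous fun y => r * f y - generator μ σ f y :=
    (continuous_const.mul hf.continuous).sub hgc
  have hFs : HasCompactSupport fun y => r * f y - generator μ σ f y := hs.mul_left.sub hgs
  rw [integral_occupationMeasure_swap hX hr hx
    (show Integrable (fun y => r * f y - generator μ σ f y) (occupationMeasure P X r x) from
      integrable_comp_of_continuous measurable_id hFc hFs)]
  set b : ℝ → ℝ := fun s => ∫ ω, generator μ σ f (X s.toNNReal ω) ∂(P x) with hb
  have hbc : Continuous b := continuous_expectation hX hgc hgs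
  set A : ℝ → ℝ := fun t => f x + ∫ s in (0 : ℝ)..t, b s with hA
  have hA' : ∀ t, HasDerivAt A (b t) t := fun t =>
    (hbc.integral_hasStrictDerivAt 0 t).hasDerivAt.const_add (f x)
  have hAeq : ∀ t, 0 ≤ t → ∫ ω, f (X t.toNNReal ω) ∂(P x) = A t := fun t ht =>
    hX.expectation_eq hx hf hs hsupp ht
  obtain ⟨C, hC⟩ := hs.exists_bound_of_continuous hf.continuous
  obtain ⟨C', hC'⟩ := hgs.exists_bound_of_continuous hgc
  have hAb : ∀ t, 0 ≤ t → |A t| ≤ C := fun t ht => by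
    rw [← hAeq t ht, ← Real.norm_eq_abs]
    simpa using norm_integral_le_of_norm_le_const (μ := P x)
      (Eventually.of_forall fun ω => hC (X t.toNNReal ω))
  have hbb : ∀ t, |b t| ≤ C' := fun t => by
    rw [hb, ← Real.norm_eq_abs]
    simpa using norm_integral_le_of_norm_le_const (μ := P x)
      (Eventually.of_forall fun ω => hC' (X t.toNNReal ω))
  have hAc : Continuous A := continuous_iff_continuousAt.2 fun t => (hA' t).continuousAt
  have hderiv : ∀ t ∈ Ici (0 : ℝ), HasDerivAt (fun t => -(Real.exp (-r * t) * A t))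
      (Real.exp (-r * t) * (r * A t - b t)) t := fun t _ => by
    convert! ((((hasDerivAt_id' t).const_mul (-r)).exp).mul (hA' t)).neg using 1
    ring
  have hexp := exp_neg_integrableOn_Ioi 0 hr
  have hint : IntegrableOn (fun t => Real.exp (-r * t) * (r * A t - b t)) (Ioi 0) := by
    refine Integrable.mono' (Integrable.const_mul hexp (r * C + C'))
      (by fun_prop) ((ae_restrict_iff' measurableSet_Ioi).2 (Eventually.of_forall fun t ht => ?_))
    rw [norm_mul, Real.norm_of_nonneg (Real.exp_pos _).le, mul_comm]
    refine mul_le_mul_of_nonneg_right ?_ (Real.exp_pos _).le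
    rw [Real.norm_eq_abs]
    refine (abs_sub _ _).trans (add_le_add ?_ (hbb t))
    rw [abs_mul, abs_of_pos hr]
    exact mul_le_mul_of_nonneg_left (hAb t (le_of_lt ht)) hr.le
  have hlim : Tendsto (fun t => -(Real.exp (-r * t) * A t)) atTop (𝓝 0) := by
    have h0 : Tendsto (fun t : ℝ => Real.exp (-r * t) * C) atTop (𝓝 0) := by
      have h1 : Tendsto (fun t : ℝ => -r * t) atTop atBot :=
        tendsto_id.const_mul_atTop_of_neg (neg_lt_zero.2 hr)
      simpa using (Real.tendsto_exp_atBot.comp h1).mul_const C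
    refine squeeze_zero_norm' ?_ h0
    filter_upwards [eventually_ge_atTop 0] with t ht
    rw [norm_neg, norm_mul, Real.norm_of_nonneg (Real.exp_pos _).le]
    exact mul_le_mul_of_nonneg_left (hAb t ht) (Real.exp_pos _).le
  have hfin := integral_Ioi_of_hasDerivAt_of_tendsto' hderiv hint hlim
  have hA0 : A 0 = f x := by simp [hA]
  simp only [mul_zero, Real.exp_zero, one_mul, hA0, sub_neg_eq_add, zero_add] at hfin
  rw [← hfin]
  refine setIntegral_congr_fun measurableSet_Ioi fun t ht => ?_
  rw [integral_sub ((integrable_comp_of_continuous (hX.measurable _) hf.continuous hs).const_mul r)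
    (integrable_comp_of_continuous (hX.measurable _) hgc hgs), integral_const_mul,
    hAeq t (le_of_lt ht)]

end TestFunction

/-! ### The resolvent in terms of the Green kernel -/

/-- Continuous functions that vanish outside a compact subset of `(0, ∞)`. -/
def compactFunctions : Submodule ℝ (ℝ → ℝ) where
  carrier := {h | Continuous h ∧ ∃ a b, 0 < a ∧ ∀ y ∉ Icc a b, h y = 0}
  zero_mem' := ⟨continuous_const, 1, 1, one_pos, fun _ _ => rfl⟩
  add_mem' := by
    rintro h h' ⟨hc, a, b, ha, hab⟩ ⟨hc', a', b', ha', hab'⟩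
    refine ⟨hc.add hc', min a a', max b b', lt_min ha ha', fun y hy => ?_⟩
    have h1 : y ∉ Icc a b := fun h => hy ⟨(min_le_left _ _).trans h.1, h.2.trans (le_max_left _ _)⟩
    have h2 : y ∉ Icc a' b' := fun h =>
      hy ⟨(min_le_right _ _).trans h.1, h.2.trans (le_max_right _ _)⟩
    simp [hab y h1, hab' y h2]
  smul_mem' := by
    rintro c h ⟨hc, a, b, ha, hab⟩
    exact ⟨hc.const_smul c, a, b, ha, fun y hy => by simp [hab y hy]⟩

/-- `ν` represents the resolvent at `x` on the range of `r - 𝒜`. -/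
def IsResolventMeasure (μ σ : ℝ → ℝ) (r x : ℝ) (ν : Measure ℝ) : Prop :=
  ∀ f : ℝ → ℝ, ContDiff ℝ 2 f → HasCompactSupport f → tsupport f ⊆ Ioi 0 →
    ∫ y, (r * f y - generator μ σ f y) ∂ν = f x

section Compact

variable {h F : ℝ → ℝ} {x : ℝ}

theorem hasCompactSupport_of_mem (hh : h ∈ compactFunctions) : HasCompactSupport h := by
  obtain ⟨-, a, b, -, hab⟩ := hh
  exact HasCompactSupport.intro isCompact_Icc hab

theorem integrable_mul_of_mem (hh : h ∈ compactFunctions) (hF : ContinuousOn F (Ioi 0)) :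
    Integrable fun y => h y * F y := by
  obtain ⟨hc, a, b, ha, hab⟩ := hh
  refine (integrableOn_iff_integrable_of_support_subset (s := Icc a b) fun y hy => ?_).1
    ((hc.continuousOn.mul (hF.mono fun y hy => lt_of_lt_of_le ha hy.1)).integrableOn_Icc)
  by_contra hy'
  exact hy (by simp [hab y hy'])

theorem integral_eq_Ioi_of_lt {a b : ℝ} (hab : ∀ y ∉ Icc a b, F y = 0) (hx : x < a) :
    ∫ y in Ioi x, F y = ∫ y, F y :=
  setIntegral_eq_integral_of_forall_compl_eq_zero fun y hy =>
    hab y fun h => hy (hx.trans_le h.1)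

theorem setIntegral_Ioc_eq_zero_of_lt {a b : ℝ} (hab : ∀ y ∉ Icc a b, F y = 0) (hx : x < a) :
    ∫ y in Ioc 0 x, F y = 0 :=
  setIntegral_eq_zero_of_forall_eq_zero fun y hy =>
    hab y fun h => absurd h.1 (not_le.2 (hy.2.trans_lt hx))

theorem setIntegral_Ioi_eq_zero_of_lt {a b : ℝ} (hab : ∀ y ∉ Icc a b, F y = 0) (hx : b < x) :
    ∫ y in Ioi x, F y = 0 :=
  setIntegral_eq_zero_of_forall_eq_zero fun y hy =>
    hab y fun h => absurd h.2 (not_le.2 (hx.trans hy))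

theorem integral_Ioc_eq_Ioi_of_lt {a b : ℝ} (hab : ∀ y ∉ Icc a b, F y = 0) (hx : b < x) :
    ∫ y in Ioc 0 x, F y = ∫ y in Ioi 0, F y := by
  symm
  refine setIntegral_eq_of_subset_of_forall_sdiff_eq_zero measurableSet_Ioi
    (fun y hy => hy.1) fun y hy => hab y fun h => hy.2 ⟨hy.1, h.2.trans hx.le⟩

end Compact

section Kernel

variable {μ σ : ℝ → ℝ} {r x B : ℝ} {φ ψ v u h θ : ℝ → ℝ} {ν : Measure ℝ}

theorem greenIntegrable_of_mem {s m : ℝ → ℝ} (hN : NaturalPair s m)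
    (hF : FundamentalPair s m r φ ψ v u B) (hh : h ∈ compactFunctions) :
    GreenIntegrable m φ ψ h where
  cont := hh.1.continuousOn
  int_zero x _ := by
    have := (integrable_mul_of_mem hh (hF.inc.continuousOn.mul hN.m_cont)).integrableOn
      (s := Ioc 0 x)
    simpa only [Pi.mul_apply, ← mul_assoc] using this
  int_top x _ := by
    have := (integrable_mul_of_mem hh (hF.dec.continuousOn.mul hN.m_cont)).integrableOn
      (s := Ioi x)
    simpa only [Pi.mul_apply, ← mul_assoc] using this

variable (hμ : ContinuousOn μ (Ioi 0)) (hσ : ContinuousOn σ (Ioi 0)) (hσ0 : ∀ x, 0 < x → 0 < σ x)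
  (hN : NaturalPair (scaleDensity μ σ) (speedDensity μ σ))
  (hF : FundamentalPair (scaleDensity μ σ) (speedDensity μ σ) r φ ψ v u B)
include hμ hσ hσ0 hN hF

/-- The second derivative exists because G' = κ s is a product of two differentiable functions, and
it is continuous because μ, σ and θ are. -/
theorem contDiffOn_greenFun (hθ : GreenIntegrable (speedDensity μ σ) φ ψ θ) :
    ContDiffOn ℝ 2 (greenFun (speedDensity μ σ) φ ψ B θ) (Ioi 0) ∧ ∀ x, 0 < x →
      generator μ σ (greenFun (speedDensity μ σ) φ ψ B θ) x =
        r * greenFun (speedDensity μ σ) φ ψ B θ x - θ x := by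
  have hG := greenFun_fluxSolution hN hF hθ
  set G := greenFun (speedDensity μ σ) φ ψ B θ with hGdef
  set κ := greenFlux (speedDensity μ σ) φ ψ v u B θ with hκ
  have hs : ∀ x, 0 < x → HasDerivAt (scaleDensity μ σ) _ x := fun x hx =>
    hasDerivAt_scaleDensity hμ hσ hσ0 hx
  have h1 : ∀ x ∈ Ioi (0 : ℝ), deriv G x = κ x * scaleDensity μ σ x := fun x hx =>
    (hG.deriv_fun x hx).deriv
  have h2 : ∀ x ∈ Ioi (0 : ℝ), HasDerivAt (deriv G) ((r * G x + -θ x) * speedDensity μ σ x *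
      scaleDensity μ σ x + κ x * (-(2 * μ x / σ x ^ 2) * scaleDensity μ σ x)) x := fun x hx => by
    refine ((hG.deriv_flux x hx).mul (hs x hx)).congr_of_eventuallyEq ?_
    filter_upwards [Ioi_mem_nhds hx] with y hy using h1 y hy
  have hGc : ContinuousOn G (Ioi 0) := fun x hx =>
    (hG.deriv_fun x hx).continuousAt.continuousWithinAt
  have hκc : ContinuousOn κ (Ioi 0) := fun x hx =>
    (hG.deriv_flux x hx).continuousAt.continuousWithinAt
  refine ⟨?_, fun x hx => ?_⟩
  · refine (contDiffOn_succ_iff_deriv_of_isOpen (n := 1) isOpen_Ioi).2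
      ⟨fun x hx => (hG.deriv_fun x hx).differentiableAt.differentiableWithinAt,
        fun h => absurd h (by decide), ?_⟩
    refine (contDiffOn_succ_iff_deriv_of_isOpen (n := 0) isOpen_Ioi).2
      ⟨fun x hx => (h2 x hx).differentiableAt.differentiableWithinAt,
        fun h => absurd h (by decide), ?_⟩
    refine contDiffOn_zero.2 (ContinuousOn.congr ?_ fun x hx => (h2 x hx).deriv)
    have hcs := continuousOn_scaleDensity hμ hσ hσ0
    have hcm := continuousOn_speedDensity hμ hσ hσ0
    have hq : ContinuousOn (fun x => 2 * μ x / σ x ^ 2) (Ioi 0) :=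
      (continuousOn_const.mul hμ).div (hσ.pow 2) fun z hz => pow_ne_zero 2 (hσ0 z hz).ne'
    exact ((((continuousOn_const.mul hGc).add hθ.cont.neg).mul hcm).mul hcs).add
      (hκc.mul (hq.neg.mul hcs))
  · rw [generator, h1 x hx, (h2 x hx).deriv, speedDensity]
    have h3 := (hσ0 x hx).ne'
    have h4 := (scaleDensity_pos (μ := μ) (σ := σ) x).ne'
    field_simp
    ring

/-- Outside the support of h the Green function is a multiple of φ or of ψ, with the two full
integrals over (0, ∞) as coefficients. When both vanish, its extension by zero is an admissible test
function. -/
theorem exists_test_function (hh : h ∈ compactFunctions)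
    (h1 : ∫ y in Ioi 0, h y * ψ y * speedDensity μ σ y = 0)
    (h2 : ∫ y in Ioi 0, h y * φ y * speedDensity μ σ y = 0) :
    ∃ f : ℝ → ℝ, ContDiff ℝ 2 f ∧ HasCompactSupport f ∧ tsupport f ⊆ Ioi 0 ∧
      (∀ y, r * f y - generator μ σ f y = h y) ∧
      ∀ y, 0 < y → f y = greenFun (speedDensity μ σ) φ ψ B h y := by
  have hG := contDiffOn_greenFun hμ hσ hσ0 hN hF (greenIntegrable_of_mem hN hF hh)
  set G := greenFun (speedDensity μ σ) φ ψ B h with hGdef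
  obtain ⟨hc, a, b, ha, hab⟩ := hh
  have hab1 : ∀ y ∉ Icc a b, h y * ψ y * speedDensity μ σ y = 0 := fun y hy => by simp [hab y hy]
  have hab2 : ∀ y ∉ Icc a b, h y * φ y * speedDensity μ σ y = 0 := fun y hy => by simp [hab y hy]
  have hG0 : ∀ y, 0 < y → y ∉ Icc a b → G y = 0 := fun y hy hy' => by
    rw [hGdef, greenFun]
    rcases lt_or_ge y a with h3 | h3
    · rw [setIntegral_Ioc_eq_zero_of_lt hab1 h3, integral_eq_Ioi_of_lt hab2 h3,
        ← integral_eq_Ioi_of_lt hab2 ha, h2]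
      simp
    · have h4 : b < y := not_le.1 fun h => hy' ⟨h3, h⟩
      rw [setIntegral_Ioi_eq_zero_of_lt hab2 h4, integral_Ioc_eq_Ioi_of_lt hab1 h4, h1]
      simp
  set f : ℝ → ℝ := (Ioi 0).indicator G with hf
  have hf0 : ∀ y ∉ Icc a b, f y = 0 := fun y hy => by
    by_cases hy0 : 0 < y
    · rw [hf, indicator_of_mem (mem_Ioi.2 hy0), hG0 y hy0 hy]
    · rw [hf, indicator_of_notMem (by simpa using hy0)]
  have hfG : ∀ y, 0 < y → f y = G y := fun y hy => by rw [hf, indicator_of_mem (mem_Ioi.2 hy)]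
  have hev : ∀ y, 0 < y → f =ᶠ[𝓝 y] G := fun y hy => by
    filter_upwards [Ioi_mem_nhds hy] with z hz using hfG z hz
  have hts : tsupport f ⊆ Icc a b := closure_minimal
    (fun y hy => by_contra fun h => hy (hf0 y h)) isClosed_Icc
  have htp : tsupport f ⊆ Ioi 0 := hts.trans fun y hy => lt_of_lt_of_le ha hy.1
  refine ⟨f, ?_, HasCompactSupport.intro isCompact_Icc hf0, htp, fun y => ?_, hfG⟩
  · refine contDiff_iff_contDiffAt.2 fun y => ?_
    by_cases hy : 0 < y
    · exact (hG.1.contDiffAt (Ioi_mem_nhds hy)).congr_of_eventuallyEq (hev y hy)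
    · refine (contDiffAt_const (c := (0 : ℝ))).congr_of_eventuallyEq ?_
      exact notMem_tsupport_iff_eventuallyEq.1 fun h => hy (htp h)
  · by_cases hy : 0 < y
    · have h3 : generator μ σ f y = generator μ σ G y := by
        rw [generator, generator, (hev y hy).deriv_eq, (hev y hy).deriv.deriv_eq]
      rw [h3, hG.2 y hy, hfG y hy]
      ring
    · rw [generator_eq_zero_of_notMem_tsupport fun h => hy (htp h), hf0 y fun h => hy
        (lt_of_lt_of_le ha h.1), hab y fun h => hy (lt_of_lt_of_le ha h.1)]
      simp

/-- Test functions determine ν on the common kernel of two linear functionals, so ν differs from the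
Green functional by a linear combination of these two. -/
theorem exists_integral_eq_greenFun_add [IsFiniteMeasure ν] (hx : 0 < x)
    (hν : IsResolventMeasure μ σ r x ν) : ∃ c₁ c₂ : ℝ, ∀ h ∈ compactFunctions,
      ∫ y, h y ∂ν = greenFun (speedDensity μ σ) φ ψ B h x +
        c₁ * (∫ y in Ioi 0, h y * ψ y * speedDensity μ σ y) +
        c₂ * ∫ y in Ioi 0, h y * φ y * speedDensity μ σ y := by
  have hGI : ∀ h : compactFunctions, GreenIntegrable (speedDensity μ σ) φ ψ h := fun h =>
    greenIntegrable_of_mem hN hF h.2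
  have hI : ∀ (F : ℝ → ℝ), ContinuousOn F (Ioi 0) → ∀ h : compactFunctions,
      IntegrableOn (fun y => (h : ℝ → ℝ) y * F y * speedDensity μ σ y) (Ioi 0) := fun F hFc h => by
    have := (integrable_mul_of_mem h.2 (hFc.mul hN.m_cont)).integrableOn (s := Ioi 0)
    simpa only [Pi.mul_apply, ← mul_assoc] using this
  have hν' : ∀ h : compactFunctions, Integrable (h : ℝ → ℝ) ν := fun h =>
    h.2.1.integrable_of_hasCompactSupport (hasCompactSupport_of_mem h.2)
  let L (F : ℝ → ℝ) (hFc : ContinuousOn F (Ioi 0)) : compactFunctions →ₗ[ℝ] ℝ :=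
    { toFun := fun h => ∫ y in Ioi 0, (h : ℝ → ℝ) y * F y * speedDensity μ σ y
      map_add' := fun h h' => by
        rw [← integral_add (hI F hFc h) (hI F hFc h')]
        simp [add_mul]
      map_smul' := fun c h => by
        simp [mul_assoc, integral_const_mul] }
  let Λ : compactFunctions →ₗ[ℝ] ℝ :=
    { toFun := fun h => ∫ y, (h : ℝ → ℝ) y ∂ν - greenFun (speedDensity μ σ) φ ψ B h x
      map_add' := fun h h' => by
        have h1 := greenFun_add (B := B) (hGI h) (hGI h') hx
        have h2 := integral_add (hν' h) (hν' h')
        simp only [Submodule.coe_add, Pi.add_def] at h1 h2 ⊢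
        rw [h1, h2]; ring
      map_smul' := fun c h => by
        have h1 := greenFun_const_mul (m := speedDensity μ σ) (φ := φ) (ψ := ψ) (B := B)
          (θ := h) (x := x) c
        simp only [Submodule.coe_smul, Pi.smul_def, smul_eq_mul, RingHom.id_apply] at h1 ⊢
        rw [h1, integral_const_mul]; ring }
  have hker : ⨅ i, (![L ψ hF.inc.continuousOn, L φ hF.dec.continuousOn] i).ker ≤ Λ.ker := by
    intro h hh
    simp only [Submodule.mem_iInf, Fin.forall_fin_two, LinearMap.mem_ker] at hh
    obtain ⟨f, hf, hfs, hft, hfe, hfx⟩ := exists_test_function hμ hσ hσ0 hN hF h.2 hh.1 hh.2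
    have h1 := hν f hf hfs hft
    simp only [hfe] at h1
    rw [LinearMap.mem_ker]
    exact sub_eq_zero.2 (h1.trans (hfx x hx))
  have hmem := mem_span_of_iInf_ker_le_ker hker
  rw [Matrix.range_cons, Matrix.range_cons, Matrix.range_empty, union_empty,
    singleton_union, Submodule.mem_span_pair] at hmem
  obtain ⟨c₁, c₂, hc⟩ := hmem
  refine ⟨c₁, c₂, fun h hh => ?_⟩
  have h1 : c₁ * (∫ y in Ioi 0, h y * ψ y * speedDensity μ σ y) +
      c₂ * (∫ y in Ioi 0, h y * φ y * speedDensity μ σ y) =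
      ∫ y, h y ∂ν - greenFun (speedDensity μ σ) φ ψ B h x :=
    LinearMap.congr_fun hc ⟨h, hh⟩
  linarith

end Kernel

/-! ### Cutoff functions -/

/-- A trapezoid that equals `1` on `[a, b]` and vanishes outside `[a / 2, b + 1]`. -/
noncomputable def cutoff (a b y : ℝ) : ℝ := max 0 (min 1 (min (2 * y / a - 1) (b + 1 - y)))

section Cutoff

variable {a b x y : ℝ} {F : ℝ → ℝ}

theorem continuous_cutoff : Continuous (cutoff a b) := by unfold cutoff; fun_prop

theorem cutoff_nonneg : 0 ≤ cutoff a b y := le_max_left _ _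

theorem cutoff_le_one : cutoff a b y ≤ 1 := max_le zero_le_one (min_le_left _ _)

theorem cutoff_eq_one (ha : 0 < a) (hy : y ∈ Icc a b) : cutoff a b y = 1 := by
  have h1 : 1 ≤ 2 * y / a - 1 := by
    have : 2 ≤ 2 * y / a := (le_div_iff₀ ha).2 (by linarith [hy.1])
    linarith
  rw [cutoff, min_eq_left (le_min h1 (by linarith [hy.2])), max_eq_right zero_le_one]

theorem cutoff_eq_zero (ha : 0 < a) (hy : y ∉ Icc (a / 2) (b + 1)) : cutoff a b y = 0 := by
  refine max_eq_left ((min_le_right _ _).trans ?_)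
  rcases lt_or_ge y (a / 2) with h | h
  · refine (min_le_left _ _).trans ?_
    have : 2 * y / a ≤ 1 := (div_le_one ha).2 (by linarith)
    linarith
  · have : b + 1 < y := not_le.1 fun h' => hy ⟨h, h'⟩
    exact (min_le_right _ _).trans (by linarith)

theorem mul_cutoff_mem (hF : Continuous F) (ha : 0 < a) :
    (fun y => F y * cutoff a b y) ∈ compactFunctions :=
  ⟨hF.mul continuous_cutoff, a / 2, b + 1, half_pos ha, fun y hy => by
    simp [cutoff_eq_zero ha hy]⟩

theorem cutoff_mem (ha : 0 < a) : cutoff a b ∈ compactFunctions :=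
  ⟨continuous_cutoff, a / 2, b + 1, half_pos ha, fun _ hy => cutoff_eq_zero ha hy⟩

theorem tendsto_cutoff (hy : 0 < y) :
    Tendsto (fun n : ℕ => cutoff (1 / ((n : ℝ) + 1)) n y) atTop (𝓝 1) := by
  refine tendsto_const_nhds.congr' ?_
  have h1 := (tendsto_order.1 (tendsto_one_div_add_atTop_nhds_zero_nat (𝕜 := ℝ))).2 y hy
  filter_upwards [h1, tendsto_natCast_atTop_atTop.eventually_ge_atTop y] with n hn hn'
  exact (cutoff_eq_one Nat.one_div_pos_of_nat ⟨hn.le, hn'⟩).symm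

theorem setIntegral_cutoff_mul_le {S : Set ℝ} (hS : MeasurableSet S) (hS0 : S ⊆ Ioi 0)
    (ha : 0 < a) (hF : ContinuousOn F (Ioi 0)) (hF0 : ∀ y, 0 < y → 0 ≤ F y)
    (hi : IntegrableOn F S) : ∫ y in S, cutoff a b y * F y ≤ ∫ y in S, F y :=
  setIntegral_mono_on (integrable_mul_of_mem (cutoff_mem ha) hF).integrableOn hi hS fun y hy =>
    mul_le_of_le_one_left (hF0 y (hS0 hy)) cutoff_le_one

theorem setIntegral_cutoff_mul_nonneg {S : Set ℝ} (hS : MeasurableSet S) (hS0 : S ⊆ Ioi 0)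
    (hF0 : ∀ y, 0 < y → 0 ≤ F y) : 0 ≤ ∫ y in S, cutoff a b y * F y :=
  setIntegral_nonneg hS fun y hy => mul_nonneg cutoff_nonneg (hF0 y (hS0 hy))

theorem setIntegral_le_cutoff_mul (ha : 0 < a) (hF : ContinuousOn F (Ioi 0))
    (hF0 : ∀ y, 0 < y → 0 ≤ F y) : ∫ y in Ioc a b, F y ≤ ∫ y in Ioi 0, cutoff a b y * F y := by
  have h1 : ∫ y in Ioc a b, F y = ∫ y in Ioc a b, cutoff a b y * F y :=
    setIntegral_congr_fun measurableSet_Ioc fun y hy => by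
      simp [cutoff_eq_one ha ⟨hy.1.le, hy.2⟩]
  rw [h1]
  refine setIntegral_mono_set (integrable_mul_of_mem (cutoff_mem ha) hF).integrableOn ?_
    (Eventually.of_forall fun y hy => ha.trans hy.1)
  exact (ae_restrict_iff' measurableSet_Ioi).2
    (Eventually.of_forall fun y hy => mul_nonneg cutoff_nonneg (hF0 y hy))

end Cutoff

/-- The Green kernel, a density with respect to Lebesgue measure on `(0, ∞)`. -/
noncomputable def greenKernel (m φ ψ : ℝ → ℝ) (B x y : ℝ) : ℝ :=
  (if y ≤ x then φ x * ψ y else ψ x * φ y) * m y / B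

/-! ### The Green kernel as the density of a measure -/

section Kernel

variable {s m : ℝ → ℝ} {r x B : ℝ} {φ ψ v u θ : ℝ → ℝ}

theorem greenKernel_nonneg (hN : NaturalPair s m) (hF : FundamentalPair s m r φ ψ v u B)
    (hx : 0 < x) {y : ℝ} (hy : 0 < y) : 0 ≤ greenKernel m φ ψ B x y := by
  refine div_nonneg (mul_nonneg ?_ (hN.m_pos y hy).le) hF.B_pos.le
  split_ifs
  · exact (mul_pos (hF.dec.pos x hx) (hF.inc.pos y hy)).le
  · exact (mul_pos (hF.inc.pos x hx) (hF.dec.pos y hy)).le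

theorem mul_greenKernel_Ioc (y : ℝ) (hy : y ∈ Ioc 0 x) :
    θ y * greenKernel m φ ψ B x y = φ x / B * (θ y * ψ y * m y) := by
  rw [greenKernel, if_pos hy.2]; ring

theorem mul_greenKernel_Ioi (y : ℝ) (hy : y ∈ Ioi x) :
    θ y * greenKernel m φ ψ B x y = ψ x / B * (θ y * φ y * m y) := by
  rw [greenKernel, if_neg (not_le.2 hy)]; ring

theorem GreenIntegrable.integrableOn_mul_greenKernel (hθ : GreenIntegrable m φ ψ θ) (hx : 0 < x) :
    IntegrableOn (fun y => θ y * greenKernel m φ ψ B x y) (Ioi 0) := by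
  rw [← Ioc_union_Ioi_eq_Ioi hx.le]
  exact (IntegrableOn.congr_fun (Integrable.const_mul (hθ.int_zero x hx) (φ x / B))
      (fun y hy => (mul_greenKernel_Ioc y hy).symm) measurableSet_Ioc).union
    (IntegrableOn.congr_fun (Integrable.const_mul (hθ.int_top x hx) (ψ x / B))
      (fun y hy => (mul_greenKernel_Ioi y hy).symm) measurableSet_Ioi)

theorem GreenIntegrable.integral_mul_greenKernel (hθ : GreenIntegrable m φ ψ θ) (hx : 0 < x) :
    ∫ y in Ioi 0, θ y * greenKernel m φ ψ B x y = greenFun m φ ψ B θ x := by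
  have hi := hθ.integrableOn_mul_greenKernel (B := B) hx
  rw [← Ioc_union_Ioi_eq_Ioi hx.le] at hi ⊢
  rw [setIntegral_union (Ioc_disjoint_Ioi le_rfl) measurableSet_Ioi hi.left_of_union
    hi.right_of_union, setIntegral_congr_fun measurableSet_Ioc mul_greenKernel_Ioc,
    setIntegral_congr_fun measurableSet_Ioi mul_greenKernel_Ioi, integral_const_mul,
    integral_const_mul, greenFun]
  ring

theorem greenIntegrable_of_integrableOn_mul_greenKernel (hF : FundamentalPair s m r φ ψ v u B)
    (hc : ContinuousOn θ (Ioi 0))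
    (hi : ∀ x, 0 < x → IntegrableOn (fun y => θ y * greenKernel m φ ψ B x y) (Ioi 0)) :
    GreenIntegrable m φ ψ θ where
  cont := hc
  int_zero x hx := by
    have h1 := IntegrableOn.congr_fun ((hi x hx).mono_set fun y (hy : y ∈ Ioc 0 x) => hy.1)
      mul_greenKernel_Ioc measurableSet_Ioc
    exact (integrable_const_mul_iff (isUnit_iff_ne_zero.2
      (div_pos (hF.dec.pos x hx) hF.B_pos).ne') _).1 h1
  int_top x hx := by
    have h1 := IntegrableOn.congr_fun ((hi x hx).mono_set (Ioi_subset_Ioi hx.le))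
      mul_greenKernel_Ioi measurableSet_Ioi
    exact (integrable_const_mul_iff (isUnit_iff_ne_zero.2
      (div_pos (hF.inc.pos x hx) hF.B_pos).ne') _).1 h1

theorem greenIntegrable_one (hN : NaturalPair s m) (hr : 0 < r)
    (hF : FundamentalPair s m r φ ψ v u B) : GreenIntegrable m φ ψ (fun _ => 1) where
  cont := continuousOn_const
  int_zero x hx := by simpa only [one_mul] using hF.inc.integrableOn hN hr hx
  int_top x hx := by simpa only [one_mul] using hF.dec.integrableOn hN hr hx

theorem integrableOn_greenKernel (hN : NaturalPair s m) (hr : 0 < r)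
    (hF : FundamentalPair s m r φ ψ v u B) (hx : 0 < x) :
    IntegrableOn (greenKernel m φ ψ B x) (Ioi 0) := by
  simpa only [one_mul] using (greenIntegrable_one hN hr hF).integrableOn_mul_greenKernel hx

/-- The measure with density `greenKernel` on `(0, ∞)`. -/
noncomputable def greenMeasure (m φ ψ : ℝ → ℝ) (B x : ℝ) : Measure ℝ :=
  (volume.restrict (Ioi 0)).withDensity fun y => ENNReal.ofReal (greenKernel m φ ψ B x y)

theorem integral_greenMeasure (hN : NaturalPair s m) (hr : 0 < r)
    (hF : FundamentalPair s m r φ ψ v u B) (hx : 0 < x) (f : ℝ → ℝ) :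
    ∫ y, f y ∂(greenMeasure m φ ψ B x) = ∫ y in Ioi 0, f y * greenKernel m φ ψ B x y := by
  rw [greenMeasure, integral_withDensity_eq_integral_toReal_smul₀
    (integrableOn_greenKernel hN hr hF hx).aemeasurable.ennreal_ofReal (by simp)]
  refine setIntegral_congr_fun measurableSet_Ioi fun y hy => ?_
  simp only [ENNReal.toReal_ofReal (greenKernel_nonneg hN hF hx hy), smul_eq_mul]
  ring

theorem integrable_greenMeasure_iff (hN : NaturalPair s m) (hr : 0 < r)
    (hF : FundamentalPair s m r φ ψ v u B) (hx : 0 < x) {f : ℝ → ℝ} :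
    Integrable f (greenMeasure m φ ψ B x) ↔
      IntegrableOn (fun y => f y * greenKernel m φ ψ B x y) (Ioi 0) := by
  rw [greenMeasure, integrable_withDensity_iff_integrable_smul₀'
    (integrableOn_greenKernel hN hr hF hx).aemeasurable.ennreal_ofReal (by simp)]
  refine integrableOn_congr_fun (fun y hy => ?_) measurableSet_Ioi
  simp only [ENNReal.toReal_ofReal (greenKernel_nonneg hN hF hx hy), smul_eq_mul]
  ring

end Kernel

/-! ### Identification of the resolvent measure with the Green measure -/

section Identification

variable {μ σ : ℝ → ℝ} {r x B : ℝ} {φ ψ v u h θ : ℝ → ℝ} {ν : Measure ℝ}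

theorem eq_zero_of_tendsto_of_bound {ι : Type*} {l : Filter ι} [l.NeBot] {c C : ℝ} {f : ι → ℝ}
    (hf : Tendsto f l atTop) (hC : ∀ᶠ i in l, |c| * f i ≤ C) : c = 0 := by
  by_contra hc
  have h1 := hf.const_mul_atTop (abs_pos.2 hc)
  obtain ⟨i, hi, hi'⟩ := (hC.and (h1.eventually_gt_atTop C)).exists
  exact absurd hi (not_le.2 hi')

variable (hμ : ContinuousOn μ (Ioi 0)) (hσ : ContinuousOn σ (Ioi 0)) (hσ0 : ∀ x, 0 < x → 0 < σ x)
  (hN : NaturalPair (scaleDensity μ σ) (speedDensity μ σ))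
  (hF : FundamentalPair (scaleDensity μ σ) (speedDensity μ σ) r φ ψ v u B)
include hμ hσ hσ0 hN hF

/-- Finiteness excludes the homogeneous terms: on cutoffs both ν and the Green functional stay
bounded, whereas ∫ ψ m diverges at infinity and ∫ φ m diverges at zero. -/
theorem integral_eq_greenFun_of_mem [IsFiniteMeasure ν] (hr : 0 < r) (hx : 0 < x)
    (hν : IsResolventMeasure μ σ r x ν) (hh : h ∈ compactFunctions) :
    ∫ y, h y ∂ν = greenFun (speedDensity μ σ) φ ψ B h x := by
  obtain ⟨c₁, c₂, hc⟩ := exists_integral_eq_greenFun_add hμ hσ hσ0 hN hF hx hν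
  set m := speedDensity μ σ with hm
  have hψm : ContinuousOn (fun y => ψ y * m y) (Ioi 0) := hF.inc.continuousOn.mul hN.m_cont
  have hφm : ContinuousOn (fun y => φ y * m y) (Ioi 0) := hF.dec.continuousOn.mul hN.m_cont
  have hψ0 : ∀ y, 0 < y → 0 ≤ ψ y * m y := fun y hy =>
    (mul_pos (hF.inc.pos y hy) (hN.m_pos y hy)).le
  have hφ0 : ∀ y, 0 < y → 0 ≤ φ y * m y := fun y hy =>
    (mul_pos (hF.dec.pos y hy) (hN.m_pos y hy)).le
  have hφx := hF.dec.pos x hx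
  have hψx := hF.inc.pos x hx
  have hB := hF.B_pos
  set D := (φ x * (∫ y in Ioc 0 x, ψ y * m y) + ψ x * ∫ y in Ioi x, φ y * m y) / B with hD
  have hbound : ∀ a b, 0 < a → |c₁ * (∫ y in Ioi 0, cutoff a b y * (ψ y * m y)) +
      c₂ * ∫ y in Ioi 0, cutoff a b y * (φ y * m y)| ≤ ν.real univ + D := fun a b ha => by
    have h1 := hc _ (cutoff_mem (b := b) ha)
    simp only [mul_assoc] at h1
    have h2 : |∫ y, cutoff a b y ∂ν| ≤ ν.real univ := by
      have := norm_integral_le_of_norm_le_const (μ := ν) (f := cutoff a b) (C := 1)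
        (Eventually.of_forall fun y => by
          rw [Real.norm_of_nonneg cutoff_nonneg]; exact cutoff_le_one)
      simpa using this
    have h3 : |greenFun m φ ψ B (cutoff a b) x| ≤ D := by
      simp only [greenFun, mul_assoc]
      have e1 := setIntegral_cutoff_mul_nonneg (a := a) (b := b) (measurableSet_Ioc (b := x))
        (fun y hy => hy.1) hψ0
      have e2 := setIntegral_cutoff_mul_nonneg (a := a) (b := b) (measurableSet_Ioi (a := x))
        (Ioi_subset_Ioi hx.le) hφ0
      have e3 := setIntegral_cutoff_mul_le (b := b) (measurableSet_Ioc (b := x))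
        (fun y hy => hy.1) ha hψm hψ0 (hF.inc.integrableOn hN hr hx)
      have e4 := setIntegral_cutoff_mul_le (b := b) (measurableSet_Ioi (a := x))
        (Ioi_subset_Ioi hx.le) ha hφm hφ0 (hF.dec.integrableOn hN hr hx)
      rw [abs_of_nonneg (by positivity)]
      rw [hD]
      gcongr
    have h4 : c₁ * (∫ y in Ioi 0, cutoff a b y * (ψ y * m y)) +
      c₂ * (∫ y in Ioi 0, cutoff a b y * (φ y * m y)) =
        ∫ y, cutoff a b y ∂ν - greenFun m φ ψ B (cutoff a b) x := by linarith
    rw [h4]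
    exact (abs_sub _ _).trans (add_le_add h2 h3)
  -- As the right end b tends to infinity, the ψ integral is at least (u b - u 1) / r → ∞, while the
  -- φ integral stays below a convergent tail. The cutoff vanishes below 1 / 2, so the tail may
  -- start at 1 / 4.
  have hc₁ : c₁ = 0 := by
    refine eq_zero_of_tendsto_of_bound (l := atTop) (f := fun b => (u b - u 1) / r)
      (C := ν.real univ + D + |c₂| * ∫ y in Ioi (1 / 4), φ y * m y)
      ((tendsto_atTop_add_const_right _ (-u 1)
        (hF.inc.flux_tendsto_atTop hN hr)).atTop_div_const hr) ?_
    filter_upwards [eventually_ge_atTop 1] with b hb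
    have hb0 : 0 < b := lt_of_lt_of_le one_pos hb
    have e1 := setIntegral_le_cutoff_mul (b := b) one_pos hψm hψ0
    have e2 : ∫ y in Ioc 1 b, ψ y * m y = (u b - u 1) / r := by
      rw [← intervalIntegral.integral_of_le hb, eq_div_iff hr.ne']
      have := integral_Ioc_add_interval hψm (fun a ha => hF.inc.integrableOn hN hr ha) one_pos hb0
      have i1 := hF.inc.integral_eq hN hr one_pos
      have i2 := hF.inc.integral_eq hN hr hb0
      rw [this] at i2
      linarith
    have e3 : ∫ y in Ioi 0, cutoff 1 b y * (φ y * m y) ≤ ∫ y in Ioi (1 / 4), φ y * m y := by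
      have hz : ∀ y ∉ Icc ((1 : ℝ) / 2) (b + 1), cutoff 1 b y * (φ y * m y) = 0 := fun y hy => by
        rw [cutoff_eq_zero one_pos hy, zero_mul]
      rw [integral_eq_Ioi_of_lt hz one_half_pos,
        ← integral_eq_Ioi_of_lt hz (by norm_num : (1 : ℝ) / 4 < 1 / 2)]
      exact setIntegral_cutoff_mul_le measurableSet_Ioi (Ioi_subset_Ioi (by norm_num)) one_pos hφm
        hφ0 (hF.dec.integrableOn hN hr (by norm_num))
    have e4 := setIntegral_cutoff_mul_nonneg (a := 1) (b := b) (measurableSet_Ioi (a := (0 : ℝ)))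
      subset_rfl hφ0
    rw [e2] at e1
    have e5 : (0 : ℝ) ≤ ∫ y in Ioi 0, cutoff 1 b y * (ψ y * m y) :=
      setIntegral_cutoff_mul_nonneg measurableSet_Ioi subset_rfl hψ0
    have e6 := hbound 1 b one_pos
    have e7 := abs_sub_abs_le_abs_sub (c₁ * ∫ y in Ioi 0, cutoff 1 b y * (ψ y * m y))
      (-(c₂ * ∫ y in Ioi 0, cutoff 1 b y * (φ y * m y)))
    rw [sub_neg_eq_add, abs_neg, abs_mul, abs_mul, abs_of_nonneg e4, abs_of_nonneg e5] at e7
    have e8 := mul_le_mul_of_nonneg_left e1 (abs_nonneg c₁)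
    have e9 := mul_le_mul_of_nonneg_left e3 (abs_nonneg c₂)
    linarith
  -- With c₁ = 0 known, the left end a tends to zero, where the flux of φ tends to minus infinity.
  have hc₂ : c₂ = 0 := by
    refine eq_zero_of_tendsto_of_bound (l := 𝓝[>] 0) (f := fun a => (v 1 - v a) / r)
      (C := ν.real univ + D)
      ((tendsto_atTop_add_const_left _ (v 1) (tendsto_neg_atBot_atTop.comp
        (hF.dec.flux_zero_atBot hN hr))).atTop_div_const hr) ?_
    filter_upwards [self_mem_nhdsWithin, mem_nhdsWithin_of_mem_nhds (Iio_mem_nhds one_pos)]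
      with a ha ha1
    have ha0 : (0 : ℝ) < a := ha
    have e1 := setIntegral_le_cutoff_mul (b := 1) ha0 hφm hφ0
    have e2 : ∫ y in Ioc a 1, φ y * m y = (v 1 - v a) / r := by
      rw [eq_div_iff hr.ne']
      have := intervalIntegral.integral_Ioi_sub_Ioi (hF.dec.integrableOn hN hr ha0)
        (le_of_lt ha1)
      rw [intervalIntegral.integral_of_le (le_of_lt ha1)] at this
      have i1 := hF.dec.integral_eq hN hr one_pos
      have i2 := hF.dec.integral_eq hN hr ha0
      rw [← this]
      linarith
    have e6 := hbound a 1 ha0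
    rw [hc₁, zero_mul, zero_add, abs_mul, abs_of_nonneg
      (setIntegral_cutoff_mul_nonneg measurableSet_Ioi subset_rfl hφ0)] at e6
    rw [e2] at e1
    exact (mul_le_mul_of_nonneg_left e1 (abs_nonneg c₂)).trans e6
  rw [hc h hh, hc₁, hc₂]
  ring

/-- Finite measures are determined by bounded continuous functions; since both measures live on (0,
∞), dominated convergence along cutoffs reduces these to compactly supported ones. -/
theorem eq_greenMeasure [IsFiniteMeasure ν] (hr : 0 < r) (hx : 0 < x)
    (hν : IsResolventMeasure μ σ r x ν) (hpos : ∀ᵐ y ∂ν, 0 < y) :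
    ν = greenMeasure (speedDensity μ σ) φ ψ B x := by
  have hfin : IsFiniteMeasure (greenMeasure (speedDensity μ σ) φ ψ B x) :=
    isFiniteMeasure_withDensity_ofReal (integrableOn_greenKernel hN hr hF hx).2
  have hpos' : ∀ᵐ y ∂(greenMeasure (speedDensity μ σ) φ ψ B x), 0 < y :=
    (withDensity_absolutelyContinuous _ _).ae_le (ae_restrict_mem measurableSet_Ioi)
  have hlim : ∀ (ρ : Measure ℝ) [IsFiniteMeasure ρ] (_ : ∀ᵐ y ∂ρ, 0 < y)
      (f : BoundedContinuousFunction ℝ ℝ), Tendsto (fun n : ℕ =>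
        ∫ y, f y * cutoff (1 / ((n : ℝ) + 1)) n y ∂ρ) atTop (𝓝 (∫ y, f y ∂ρ)) := by
    intro ρ _ hρ f
    refine tendsto_integral_of_dominated_convergence (fun _ => ‖f‖)
      (fun n => (f.continuous.mul continuous_cutoff).aestronglyMeasurable)
      (integrable_const _) (fun n => Eventually.of_forall fun y => ?_) ?_
    · rw [norm_mul, Real.norm_of_nonneg cutoff_nonneg]
      exact (mul_le_of_le_one_right (norm_nonneg _) cutoff_le_one).trans (f.norm_coe_le_norm y)
    · filter_upwards [hρ] with y hy
      simpa using (tendsto_cutoff hy).const_mul (f y)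
  refine ext_of_forall_integral_eq_of_IsFiniteMeasure fun f => ?_
  refine tendsto_nhds_unique (hlim ν hpos f) ((hlim _ hpos' f).congr fun n => ?_)
  have hmem := mul_cutoff_mem (b := n) f.continuous (Nat.one_div_pos_of_nat (α := ℝ) (n := n))
  rw [integral_eq_greenFun_of_mem hμ hσ hσ0 hN hF hr hx hν hmem, integral_greenMeasure hN hr hF hx,
    (greenIntegrable_of_mem hN hF hmem).integral_mul_greenKernel hx]

end Identification

/-! ### The probabilistic resolvent as the Green operator -/

section Resolvent

variable {Ω : Type*} {mΩ : MeasurableSpace Ω} {μ σ : ℝ → ℝ} {ℱ : Filtration ℝ≥0 mΩ}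
  {P : ℝ → Measure Ω} {X : ℝ≥0 → Ω → ℝ} {r x B : ℝ} {φ ψ v u θ : ℝ → ℝ}
  (hX : IsDiffusion μ σ ℱ P X) (hr : 0 < r)
  (hN : NaturalPair (scaleDensity μ σ) (speedDensity μ σ))
  (hF : FundamentalPair (scaleDensity μ σ) (speedDensity μ σ) r φ ψ v u B)
include hX hr hN hF

theorem occupationMeasure_eq_greenMeasure (hx : 0 < x) :
    occupationMeasure P X r x = greenMeasure (speedDensity μ σ) φ ψ B x := by
  have := isFiniteMeasure_occupationMeasure hX hr hx
  exact eq_greenMeasure hX.differentiableOn_drift.continuousOn hX.continuousOn_vol hX.vol_pos hN hF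
    hr hx (fun f hf hs hsupp => integral_test_eq hX hr hx hf hs hsupp)
    (ae_pos_occupationMeasure hX)

theorem greenIntegrable_of_memL1 (hc : ContinuousOn θ (Ioi 0)) (hθ : MemL1 P X r θ) :
    GreenIntegrable (speedDensity μ σ) φ ψ θ := by
  refine greenIntegrable_of_integrableOn_mul_greenKernel hF hc fun x hx => ?_
  rw [← integrable_greenMeasure_iff hN hr hF hx,
    ← occupationMeasure_eq_greenMeasure hX hr hN hF hx]
  refine ⟨?_, ?_⟩
  · rw [← occupationMeasure_restrict hX]
    exact hc.aestronglyMeasurable measurableSet_Ioi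
  · rw [hasFiniteIntegral_iff_norm]
    exact lintegral_abs_lt_top_of_memL1 hX hr hx hc hθ

theorem resolvent_eq_greenFun (hθ : GreenIntegrable (speedDensity μ σ) φ ψ θ) (hx : 0 < x) :
    resolvent P X r θ x = greenFun (speedDensity μ σ) φ ψ B θ x := by
  have h1 : Integrable θ (occupationMeasure P X r x) := by
    rw [occupationMeasure_eq_greenMeasure hX hr hN hF hx, integrable_greenMeasure_iff hN hr hF hx]
    exact hθ.integrableOn_mul_greenKernel hx
  rw [← integral_occupationMeasure hX hr hx h1, occupationMeasure_eq_greenMeasure hX hr hN hF hx,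
    integral_greenMeasure hN hr hF hx, hθ.integral_mul_greenKernel hx]

end Resolvent

/-! ### Closed forms of the functionals `Q` and `H` -/

section ClosedForm

variable {μ σ : ℝ → ℝ} {r q B x : ℝ} {φ ψ v u φq ψq h η g θ : ℝ → ℝ}

theorem deriv_eq_neg_greenFlux_mul (hN : NaturalPair (scaleDensity μ σ) (speedDensity μ σ))
    (hF : FundamentalPair (scaleDensity μ σ) (speedDensity μ σ) r φ ψ v u B)
    (hθ : GreenIntegrable (speedDensity μ σ) φ ψ θ)
    (hg : ∀ x, 0 < x → g x = -greenFun (speedDensity μ σ) φ ψ B θ x) (hx : 0 < x) :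
    deriv g x = -(greenFlux (speedDensity μ σ) φ ψ v u B θ x * scaleDensity μ σ x) := by
  refine (((greenFun_fluxSolution hN hF hθ).deriv_fun x hx).neg.congr_of_eventuallyEq ?_).deriv
  filter_upwards [Ioi_mem_nhds hx] with y hy using hg y hy

/-- The Wronskian of φ_q with h evaluates one functional L, the integrated resolvent equation the
other. What survives is r times the Wronskian of h with the Green function and the integral of θ
φ_q. -/
theorem Qfun_eq (hN : NaturalPair (scaleDensity μ σ) (speedDensity μ σ)) (hr : 0 < r)
    (hrq : r < q) (hF : FundamentalPair (scaleDensity μ σ) (speedDensity μ σ) r φ ψ v u B)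
    (hφq : DecSolution (scaleDensity μ σ) (speedDensity μ σ) q φq
      fun x => deriv φq x / scaleDensity μ σ x)
    (hθ : GreenIntegrable (speedDensity μ σ) φ ψ θ)
    (hg : ∀ x, 0 < x → g x = -greenFun (speedDensity μ σ) φ ψ B θ x) (hx : 0 < x)
    (hh : deriv h x = η x * scaleDensity μ σ x)
    (hI : (q - r) * (∫ y in Ioi x, h y * φq y * speedDensity μ σ y) =
      η x * φq x - deriv φq x / scaleDensity μ σ x * h x) :
    Qfun μ σ q φq g h x =
      (r * (h x * greenFlux (speedDensity μ σ) φ ψ v u B θ x -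
          η x * greenFun (speedDensity μ σ) φ ψ B θ x) -
        q * (η x / (deriv φq x / scaleDensity μ σ x)) *
          ∫ y in Ioi x, θ y * φq y * speedDensity μ σ y) / (q - r) := by
  have hG := integral_greenFun_mul_dec hN hr hrq hF hφq hθ hx
  have hgI : ∫ y in Ioi x, g y * φq y * speedDensity μ σ y =
      -∫ y in Ioi x, greenFun (speedDensity μ σ) φ ψ B θ y * φq y * speedDensity μ σ y := by
    rw [← integral_neg]
    exact setIntegral_congr_fun measurableSet_Ioi fun y hy => by
      simp only [hg y (hx.trans hy)]; ring
  have hs := (scaleDensity_pos (μ := μ) (σ := σ) x).ne'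
  have hv := (hφq.flux_neg x hx).ne
  have hd : deriv φq x = deriv φq x / scaleDensity μ σ x * scaleDensity μ σ x :=
    (div_mul_cancel₀ _ hs).symm
  have hl := (sub_pos.2 hrq).ne'
  rw [Qfun, Lfun, Lfun, deriv_eq_neg_greenFlux_mul hN hF hθ hg hx, hgI, hg x hx, hh]
  generalize deriv φq x / scaleDensity μ σ x = w at *
  rw [hd, eq_div_iff hl]
  field_simp
  linear_combination (-q * greenFlux (speedDensity μ σ) φ ψ v u B θ x) * hI + q * η x * hG

theorem Hfun_eq (hN : NaturalPair (scaleDensity μ σ) (speedDensity μ σ)) (hr : 0 < r)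
    (hrq : r < q) (hF : FundamentalPair (scaleDensity μ σ) (speedDensity μ σ) r φ ψ v u B)
    (hψq : IncSolution (scaleDensity μ σ) (speedDensity μ σ) q ψq
      fun x => deriv ψq x / scaleDensity μ σ x)
    (hθ : GreenIntegrable (speedDensity μ σ) φ ψ θ)
    (hg : ∀ x, 0 < x → g x = -greenFun (speedDensity μ σ) φ ψ B θ x) (hx : 0 < x)
    (hh : deriv h x = η x * scaleDensity μ σ x)
    (hI : (q - r) * (∫ y in Ioc 0 x, h y * ψq y * speedDensity μ σ y) =
      deriv ψq x / scaleDensity μ σ x * h x - η x * ψq x) :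
    Hfun μ σ q ψq h g x =
      (r * (h x * greenFlux (speedDensity μ σ) φ ψ v u B θ x -
          η x * greenFun (speedDensity μ σ) φ ψ B θ x) +
        q * (η x / (deriv ψq x / scaleDensity μ σ x)) *
          ∫ y in Ioc 0 x, θ y * ψq y * speedDensity μ σ y) / (q - r) := by
  have hG := integral_greenFun_mul_inc hN hr hrq hF hψq hθ hx
  have hgI : ∫ y in Ioc 0 x, g y * ψq y * speedDensity μ σ y =
      -∫ y in Ioc 0 x, greenFun (speedDensity μ σ) φ ψ B θ y * ψq y * speedDensity μ σ y := by
    rw [← integral_neg]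
    exact setIntegral_congr_fun measurableSet_Ioc fun y hy => by
      simp only [hg y hy.1]; ring
  have hs := (scaleDensity_pos (μ := μ) (σ := σ) x).ne'
  have hv := (hψq.flux_pos x hx).ne'
  have hd : deriv ψq x = deriv ψq x / scaleDensity μ σ x * scaleDensity μ σ x :=
    (div_mul_cancel₀ _ hs).symm
  have hl := (sub_pos.2 hrq).ne'
  rw [Hfun, Kfun, Kfun, deriv_eq_neg_greenFlux_mul hN hF hθ hg hx, hgI, hg x hx, hh]
  generalize deriv ψq x / scaleDensity μ σ x = w at *
  rw [hd, eq_div_iff hl]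
  field_simp
  linear_combination (q * greenFlux (speedDensity μ σ) φ ψ v u B θ x) * hI - q * η x * hG

end ClosedForm

/-! ### The control problem -/

theorem HasPeak.exists_peakAt {θ : ℝ → ℝ} (h : HasPeak θ) : ∃ xs, PeakAt θ (deriv θ) xs ∧
    (0 < xs → ∀ l : ℝ, Tendsto θ (𝓝[>] 0) (𝓝 l) →
      ∃ c : ℝ, 0 < c ∧ ∀ᶠ x in 𝓝[>] (0 : ℝ), l + c * x ≤ θ x) := by
  obtain ⟨hd, xs, h0, hs, hc⟩ := h
  exact ⟨xs, ⟨fun x hx => (hd.differentiableAt (Ioi_mem_nhds hx)).hasDerivAt, h0,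
    fun x hx => (hs x hx).1, fun x hx => (hs x (h0.trans_lt hx)).2.2 hx⟩, hc⟩

/-- Up to its peak θ is increasing, so the limit at zero is at most θ(xs), hence finite, as the
slope condition requires. -/
theorem PeakAt.exists_tendsto {θ θ' : ℝ → ℝ} {xs : ℝ} (h : PeakAt θ θ' xs) (hxs : 0 < xs)
    {l : EReal} (hl : 0 < l) (hlim : Tendsto (fun x => (θ x : EReal)) (𝓝[>] 0) (𝓝 l)) :
    ∃ l' : ℝ, Tendsto θ (𝓝[>] 0) (𝓝 l') := by
  have h1 : l ≤ (θ xs : EReal) := by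
    refine le_of_tendsto hlim ?_
    filter_upwards [Ioc_mem_nhdsGT hxs] with x hx
    exact EReal.coe_le_coe_iff.2 (h.strictMonoOn.monotoneOn hx ⟨hxs, le_rfl⟩ hx.2)
  lift l to ℝ using ⟨(h1.trans_lt (EReal.coe_lt_top _)).ne, (EReal.bot_lt_zero.trans hl).ne'⟩
  exact ⟨l, EReal.tendsto_coe.1 hlim⟩

section Control

variable {Ω : Type*} {mΩ : MeasurableSpace Ω} {μ σ : ℝ → ℝ} {ℱ : Filtration ℝ≥0 mΩ}
  {P : ℝ → Measure Ω} {X : ℝ≥0 → Ω → ℝ} {r lam : ℝ} {pay : ℝ → ℝ} {γ γd γu B : ℝ}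
  {ψ φ v u ψl φl : ℝ → ℝ} {xt xh x : ℝ}

/-- Since π = θ + γ w and x = R_r w, the term γ x cancels against γ R_r w. -/
theorem gfun_eq_neg_greenFun (hX : IsDiffusion μ σ ℱ P X) (hr : 0 < r)
    (hN : NaturalPair (scaleDensity μ σ) (speedDensity μ σ))
    (hF : FundamentalPair (scaleDensity μ σ) (speedDensity μ σ) r φ ψ v u B)
    (hw : GreenIntegrable (speedDensity μ σ) φ ψ fun x => r * x - μ x)
    (hid : GreenIntegrable (speedDensity μ σ) φ ψ fun x => x)
    (hθ : GreenIntegrable (speedDensity μ σ) φ ψ (theta μ r pay γ)) (hx : 0 < x) :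
    gfun P X r pay γ x = -greenFun (speedDensity μ σ) φ ψ B (theta μ r pay γ) x := by
  have hpay : pay = fun x => theta μ r pay γ x + γ * (r * x - μ x) := by
    funext x; rw [theta]; ring
  have hI := hθ.add (hw.const_mul γ)
  have h1 := resolvent_eq_greenFun hX hr hN hF hI hx
  rw [← hpay] at h1
  rw [gfun, h1, hpay, greenFun_add (hpay ▸ hθ) (hw.const_mul γ) hx, greenFun_const_mul,
    greenFun_eq_id hN hr hF (fluxSolution_id hX.differentiableOn_drift.continuousOn
      hX.continuousOn_vol hX.vol_pos r) hw hid hx, ← hpay]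
  ring

theorem greenIntegrable_data (hX : IsDiffusion μ σ ℱ P X) (hr : 0 < r)
    (hN : NaturalPair (scaleDensity μ σ) (speedDensity μ σ))
    (hF : FundamentalPair (scaleDensity μ σ) (speedDensity μ σ) r φ ψ v u B)
    (hA : MainAssumptions μ P X r pay γd γu) :
    GreenIntegrable (speedDensity μ σ) φ ψ (theta μ r pay γd) ∧
    GreenIntegrable (speedDensity μ σ) φ ψ (theta μ r pay γu) ∧
    GreenIntegrable (speedDensity μ σ) φ ψ (fun x => x) ∧
    GreenIntegrable (speedDensity μ σ) φ ψ fun x => r * x - μ x := by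
  have hd := greenIntegrable_of_memL1 hX hr hN hF hA.peak_d.1.continuousOn hA.theta_d_mem
  have hu := greenIntegrable_of_memL1 hX hr hN hF hA.peak_u.1.continuousOn hA.theta_u_mem
  refine ⟨hd, hu, greenIntegrable_of_memL1 hX hr hN hF continuousOn_id hA.id_mem, ?_⟩
  -- No integrability of μ is assumed; it comes from r x - μ = (θ_d - θ_u) / (γ_u - γ_d).
  have h1 := (hd.add (hu.const_mul (-1))).const_mul (γu - γd)⁻¹
  have h2 := (sub_pos.2 hA.price_lt).ne'
  convert! h1 using 1
  funext x
  simp only [theta]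
  field_simp
  ring

theorem exists_controlData (hX : IsDiffusion μ σ ℱ P X) (hr : 0 < r) (hlam : 0 < lam)
    (hA : MainAssumptions μ P X r pay γd γu)
    (hN : NaturalPair (scaleDensity μ σ) (speedDensity μ σ))
    (hF : FundamentalPair (scaleDensity μ σ) (speedDensity μ σ) r φ ψ v u B)
    (hψl : IsPsi μ σ (r + lam) ψl) (hφl : IsPhi μ σ (r + lam) φl) (hxt : 0 < xt)
    (hKxt : Kfun μ σ (r + lam) ψl (theta μ r pay γu) xt = 0)
    (hLxh : Lfun μ σ (r + lam) φl (theta μ r pay γd) xh = 0) (hlt : xt < xh) :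
    ∃ xd xu, ControlData (scaleDensity μ σ) (speedDensity μ σ) r (r + lam) φ ψ v u B φl
      (fun x => deriv φl x / scaleDensity μ σ x) ψl (fun x => deriv ψl x / scaleDensity μ σ x)
      (fun x => r * x - μ x) (fun x => 1 / scaleDensity μ σ x) (theta μ r pay γd)
      (deriv (theta μ r pay γd)) (theta μ r pay γu) (deriv (theta μ r pay γu)) (γu - γd)
      xd xu xt xh := by
  have hμ := hX.differentiableOn_drift.continuousOn
  have hq : 0 < r + lam := add_pos hr hlam
  obtain ⟨hd, hu, hid, hw⟩ := greenIntegrable_data hX hr hN hF hA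
  obtain ⟨xd, hxd, -⟩ := hA.peak_d.exists_peakAt
  obtain ⟨xu, hxu, hslope⟩ := hA.peak_u.exists_peakAt
  obtain ⟨l, hl, hlim⟩ := hA.theta_u_zero
  refine ⟨xd, xu, ?_⟩
  exact {
    natural := hN
    r_pos := hr
    r_lt := by linarith
    pair := hF
    dec := decSolution_of_isPhi hμ hX.continuousOn_vol hX.vol_pos hN hq hφl
    inc := incSolution_of_isPsi hμ hX.continuousOn_vol hX.vol_pos hN hq hψl
    flux_id := fluxSolution_id hμ hX.continuousOn_vol hX.vol_pos r
    green_w := hw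
    green_id := hid
    w_mono := monotoneOn_of_hasDerivAt (convex_Ioi 0) (fun x hx =>
      ((hasDerivAt_id' x).const_mul r).sub
        (hX.differentiableOn_drift.differentiableAt (Ioi_mem_nhds hx)).hasDerivAt) fun x hx => by
        have := hA.drift_deriv_lt x (interior_subset hx)
        linarith
    green_d := hd
    green_u := hu
    peak_d := hxd
    peak_u := hxu
    δ_pos := sub_pos.2 hA.price_lt
    diff := fun x _ => by simp only [theta]; ring
    xt_pos := hxt
    lt := hlt
    root_u := hKxt
    root_d := hLxh
    nonneg_zero := by
      filter_upwards [(tendsto_order.1 hlim).1 0 hl] with x hx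
      exact (EReal.coe_pos.1 hx).le
    slope := fun h0 => by
      obtain ⟨l', hl'⟩ := hxu.exists_tendsto h0 hl hlim
      obtain ⟨c, hc, hc'⟩ := hslope h0 l' hl'
      exact ⟨l', c, hc, hl', hc'⟩
    atBot := hA.theta_d_infty }

theorem crossingData (hX : IsDiffusion μ σ ℱ P X) (hr : 0 < r) (hlam : 0 < lam)
    (hA : MainAssumptions μ P X r pay γd γu) (hψ : IsPsi μ σ r ψ) (hφ : IsPhi μ σ r φ)
    (hψl : IsPsi μ σ (r + lam) ψl) (hφl : IsPhi μ σ (r + lam) φl) (hxt : 0 < xt)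
    (hKxt : Kfun μ σ (r + lam) ψl (theta μ r pay γu) xt = 0)
    (hLxh : Lfun μ σ (r + lam) φl (theta μ r pay γd) xh = 0) (hlt : xt < xh) :
    CrossingData (Hfun μ σ (r + lam) ψl ψ (gfun P X r pay γu))
      (Hfun μ σ (r + lam) ψl φ (gfun P X r pay γu))
      (Qfun μ σ (r + lam) φl (gfun P X r pay γd) ψ)
      (Qfun μ σ (r + lam) φl (gfun P X r pay γd) φ) xt xh := by
  have hμ := hX.differentiableOn_drift.continuousOn
  have hN := naturalPair hμ hX.continuousOn_vol hX.vol_pos hX.natural_zero hX.natural_infty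
  have hrq : r < r + lam := by linarith
  have hq := hr.trans hrq
  obtain ⟨B, hF⟩ := exists_fundamentalPair
    (decSolution_of_isPhi hμ hX.continuousOn_vol hX.vol_pos hN hr hφ)
    (incSolution_of_isPsi hμ hX.continuousOn_vol hX.vol_pos hN hr hψ)
  obtain ⟨hd, hu, hid, hw⟩ := greenIntegrable_data hX hr hN hF hA
  obtain ⟨xd, xu, D⟩ := exists_controlData hX hr hlam hA hN hF hψl hφl hxt hKxt hLxh hlt
  have hgd : ∀ x : ℝ, 0 < x → _ := fun x hx => gfun_eq_neg_greenFun hX hr hN hF hw hid hd hx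
  have hgu : ∀ x : ℝ, 0 < x → _ := fun x hx => gfun_eq_neg_greenFun hX hr hN hF hw hid hu hx
  have hψ' : ∀ x, deriv ψ x = deriv ψ x / scaleDensity μ σ x * scaleDensity μ σ x := fun x =>
    (div_mul_cancel₀ _ (scaleDensity_pos x).ne').symm
  have hφ' : ∀ x, deriv φ x = deriv φ x / scaleDensity μ σ x * scaleDensity μ σ x := fun x =>
    (div_mul_cancel₀ _ (scaleDensity_pos x).ne').symm
  refine D.crossingData.congr (fun x hx => ?_) (fun x hx => ?_) (fun x hx => ?_) fun x hx => ?_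
  · rw [Hfun_eq (η := fun x => deriv ψ x / scaleDensity μ σ x) hN hr hrq hF D.inc hu hgu hx
      (hψ' x)
      (wronskian_zero_inc_integral hN hr hrq hF.inc D.inc hx), lowerPsi,
      inc_mul_greenFlux_sub hF hx]
  · rw [Hfun_eq (η := fun x => deriv φ x / scaleDensity μ σ x) hN hr hrq hF D.inc hu hgu hx
      (hφ' x)
      (wronskian_zero_dec_integral hN hr hrq hF.dec D.inc hx), lowerPhi,
      dec_mul_greenFlux_sub hF hx]
  · rw [Qfun_eq (η := fun x => deriv ψ x / scaleDensity μ σ x) hN hr hrq hF D.dec hd hgd hx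
      (hψ' x)
      (integral_wronskian_of_tendsto_zero hrq hN.m_pos D.dec hF.inc.toFluxSolution hF.inc.pos
        (wronskian_inc_tendsto hN hr hrq hF.inc D.dec) hx), upperPsi,
      inc_mul_greenFlux_sub hF hx]
  · rw [Qfun_eq (η := fun x => deriv φ x / scaleDensity μ σ x) hN hr hrq hF D.dec hd hgd hx
      (hφ' x)
      (integral_wronskian_of_tendsto_zero hrq hN.m_pos D.dec hF.dec.toFluxSolution hF.dec.pos
        (wronskian_dec_tendsto hN hr hq hF.dec D.dec) hx), upperPhi,
      dec_mul_greenFlux_sub hF hx]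

end Control

end PoissonControl

theorem mainTheorem2 {Ω : Type*} {mΩ : MeasurableSpace Ω} (μ σ : ℝ → ℝ)
    (ℱ : Filtration ℝ≥0 mΩ) (P : ℝ → Measure Ω) (X : ℝ≥0 → Ω → ℝ)
    (hX : PoissonControl.IsDiffusion μ σ ℱ P X)
    (r lam : ℝ) (hr : 0 < r) (hlam : 0 < lam)
    (pay : ℝ → ℝ) (γd γu : ℝ)
    (hA : PoissonControl.MainAssumptions μ P X r pay γd γu)
    -- the fundamental solutions for `r` and for `r + lam`
    (ψ φ ψl φl : ℝ → ℝ)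
    (hψ : PoissonControl.IsPsi μ σ r ψ) (hφ : PoissonControl.IsPhi μ σ r φ)
    (hψl : PoissonControl.IsPsi μ σ (r + lam) ψl) (hφl : PoissonControl.IsPhi μ σ (r + lam) φl)
    -- the roots `xt` and `xh`
    (xt xh : ℝ) (hxt : 0 < xt)
    (hKxt : PoissonControl.Kfun μ σ (r + lam) ψl (PoissonControl.theta μ r pay γu) xt = 0)
    (hLxh : PoissonControl.Lfun μ σ (r + lam) φl (PoissonControl.theta μ r pay γd) xh = 0)
    (hlt : xt < xh)
    (gd gu Hψ Hφ Qψ Qφ K : ℝ → ℝ)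
    (hgd : gd = PoissonControl.gfun P X r pay γd)
    (hgu : gu = PoissonControl.gfun P X r pay γu)
    (hHψ : Hψ = PoissonControl.Hfun μ σ (r + lam) ψl ψ gu)
    (hHφ : Hφ = PoissonControl.Hfun μ σ (r + lam) ψl φ gu)
    (hQψ : Qψ = PoissonControl.Qfun μ σ (r + lam) φl gd ψ)
    (hQφ : Qφ = PoissonControl.Qfun μ σ (r + lam) φl gd φ)
    (hK : K = PoissonControl.fixedPointMap Hψ Hφ Qψ Qφ xt xh) :
    (∃! p : ℝ × ℝ, PoissonControl.SolvesPair Hψ Hφ Qψ Qφ p.1 p.2) ∧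
    PoissonControl.FixedPointMapWellDefined Hψ Hφ Qψ Qφ xt xh ∧
    MapsTo K (Ioc 0 xt) (Ioc 0 xt) ∧
    StrictMonoOn K (Ioc 0 xt) ∧
    ∃ a ∈ Ioc 0 xt, K a = a ∧ (∀ x ∈ Ioc 0 xt, K x = x → x = a) ∧
      ∃ b ∈ Ici xh, b = Function.invFunOn Qψ (Ici xh) (Hψ a) ∧
        PoissonControl.SolvesPair Hψ Hφ Qψ Qφ a b := by
  subst hgd hgu hHψ hHφ hQψ hQφ
  exact (PoissonControl.crossingData hX hr hlam hA hψ hφ hψl hφl hxt hKxt hLxh hlt).conclusion hK
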